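/- Let $R$ be a commutative ring and $F$ a one-dimensional commutative formal group law over $R$. Let $\Sigma\subset\Lambda$, $\Sigma\hookrightarrow\Lambda^\vee$, be a reduced semisimple root datum with a fixed set of simple roots $\alpha_1,\dots,\alpha_n$, sets $\Sigma^{\pm}$ of positive and negative roots, root lattice $\Lambda_r$ and Weyl group $W$ with reflections $s_\alpha$. For a lattice $L$ let $R[[L]]_F$ be the quotient of the power series ring $R[[x_L]]$ (the completion of the polynomial ring in the variables $x_l$, $l\in L$, along the ideal generated by the variables) by the closure of the ideal generated by $x_0$ and all $F(x_l,x_m)-x_{l+m}$. Let $\Gamma=\mathbb Z\gamma$ and $S=R[[\Gamma\oplus\Lambda]]_F$, with $W$ acting by $w(x_\gamma)=x_\gamma$, $w(x_\lambda)=x_{w(\lambda)}$. Put $Q^F=S[1/x_\alpha\mid\alpha\in\Sigma]$ and, for a root $\alpha$, let $Q_\alpha\subseteq Q^F$ be the subring $S[1/x_\beta\mid \beta\in\Sigma,\ \beta\ne\pm\alpha]$. Let $Q^F_W=Q^F\rtimes_R R[W]$ be the ring of sums $\sum_{w\in W}a_w\delta_w$, $a_w\in Q^F$, with product $(a\delta_w)(a'\delta_{w'})=a\,w(a')\,\delta_{ww'}$,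 and put $$X_\alpha=\frac1{x_\alpha}-\frac1{x_\alpha}\delta_{s_\alpha},\qquad T_\alpha=x_\gamma X_\alpha+\delta_{s_\alpha}.$$ Let $\mathbf D_F$ (resp. $\mathbf H_F$) be the $R$-subalgebra of $Q_W^F$ generated by $S$ and the $X_{\alpha_i}$ (resp. the $T_{\alpha_i}$), $1\le i\le n$. For $w\in W$ let $\tilde c_w=\prod_{\alpha\in\Sigma(w)}(x_\alpha-x_\gamma)$, where $\Sigma(w)=w\Sigma^-\cap\Sigma^+$. For $z=\sum_w a_w\delta_w\in Q_W^F$ consider the conditions * R1: $x_\alpha a_w\in Q_\alpha$ for all $\alpha\in\Sigma$, $w\in W$; * R2: $a_w+a_{s_\alpha w}\in Q_\alpha$ for all $\alpha\in\Sigma$, $w\in W$; * R3: $a_w/\tilde c_w\in Q^F$ for all $w\in W$. Let $\widetilde{\mathbf D}_F$ be the set of all $z$ satisfying R1 and R2, and $\widetilde{\mathbf H}_F$ the set of all $z$ satisfying R1, R2 and R3. Assume that the root datum is a direct sum of root data with irreducible root systems and that each summand, with lattice $\Lambda'$ and root lattice $\Lambda'_r$ (it is adjoint if $\Lambda'=\Lambda'_r$),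 satisfies the following condition, where $n\cdot_F x=x+_F\cdots+_Fx\in R[[x]]$ and "regular" means not a zero divisor in $R$ (for an integer) or in $R[[x]]$ (for $n\cdot_F x$): * $A_1$: if not adjoint, $2$ is invertible in $R$; $A_l$, $l\ge2$: if not adjoint, $|\Lambda'/\Lambda'_r|$ is regular; * $B_l$, $l\ge3$: $2\cdot_Fx$ is regular if adjoint, $2$ is regular if not; * $C_l$, $l\ge2$: $2\cdot_Fx$ is regular if adjoint, $2$ is invertible in $R$ if not; * $D_l$, $l\ge4$: if not adjoint, $2$ is regular; * $G_2$: $2\cdot_Fx$ and $3\cdot_Fx$ are regular; $F_4$: $2\cdot_Fx$ is regular; * $E_6$: if not adjoint, $3$ is regular; * $E_7$: $2\cdot_Fx$ or $3\cdot_Fx$ is regular if adjoint, $2$ is regular if not; * $E_8$: $2\cdot_Fx$ or $3\cdot_Fx$ is regular. Then $\widetilde{\mathbf D}_F=\mathbf D_F$ and $\widetilde{\mathbf H}_F=\mathbf H_F$ as subsets of $Q_W^F$; in particular $\widetilde{\mathbf D}_F$ and $\widetilde{\mathbf H}_F$ are $R$-subalgebras of $Q_W^F$. -/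

import Mathlib

open MvPowerSeries

namespace FormalHecke

noncomputable section

/-! ### Formal group algebras -/

/-- The ring `R⟦x_σ⟧` of power series in a possibly infinite set `σ` of variables, that is, the
completion of the polynomial ring `R[x_σ]` along the ideal generated by the variables: the formal
series having only finitely many nonzero coefficients in each degree. -/
def FinSeries (R σ : Type*) [CommRing R] : Subalgebra R (MvPowerSeries σ R) where
  carrier := {f | ∀ d : ℕ, {m : σ →₀ ℕ | m.degree ≤ d ∧ coeff m f ≠ 0}.Finite}
  mul_mem' := by
    classical
    intro f g hf hg d
    refine ((hf d).add (hg d)).subset ?_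
    rintro m ⟨hm, hne⟩
    rw [coeff_mul] at hne
    obtain ⟨⟨p, q⟩, hpq, h⟩ := Finset.exists_ne_zero_of_sum_ne_zero hne
    rw [Finset.HasAntidiagonal.mem_antidiagonal] at hpq
    have hdeg : p.degree + q.degree = m.degree := by rw [← map_add, hpq]
    exact Set.mem_add.2 ⟨p, ⟨by omega, left_ne_zero_of_mul h⟩, q,
      ⟨by omega, right_ne_zero_of_mul h⟩, hpq⟩
  add_mem' := by
    intro f g hf hg d
    refine ((hf d).union (hg d)).subset ?_
    rintro m ⟨hm, hne⟩
    by_cases h : coeff m f = 0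
    · exact Or.inr ⟨hm, fun h' => hne (by rw [map_add, h, h', add_zero])⟩
    · exact Or.inl ⟨hm, h⟩
  algebraMap_mem' := by
    classical
    intro r d
    refine (Set.finite_singleton (0 : σ →₀ ℕ)).subset ?_
    rintro m ⟨-, hne⟩
    by_contra h
    apply hne
    rw [MvPowerSeries.algebraMap_apply, coeff_C, if_neg (by simpa using h)]

variable {R : Type*} [CommRing R]

theorem mem_finSeries {σ : Type*} {f : MvPowerSeries σ R} : f ∈ FinSeries R σ ↔
    ∀ d : ℕ, {m : σ →₀ ℕ | m.degree ≤ d ∧ coeff m f ≠ 0}.Finite := Iff.rfl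

theorem X_mem_finSeries {σ : Type*} (s : σ) : (X s : MvPowerSeries σ R) ∈ FinSeries R σ := by
  classical
  intro d
  refine (Set.finite_singleton (Finsupp.single s 1)).subset ?_
  rintro m ⟨-, hne⟩
  by_contra h
  exact hne (by rw [coeff_X, if_neg (by simpa using h)])

/-- The formal sum `x_s +_F x_t = F(x_s, x_t)` of two variables. -/
def fsum (F : FormalGroup R) {σ : Type*} (s t : σ) : MvPowerSeries σ R :=
  F.toPowerSeries.subst ![(X s : MvPowerSeries σ R), X t]

theorem hasSubst_pair {σ : Type*} (s t : σ) :
    HasSubst ![(X s : MvPowerSeries σ R), X t] :=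
  hasSubst_of_constantCoeff_nilpotent fun i => by fin_cases i <;> simp

theorem fsum_mem_finSeries (F : FormalGroup R) {σ : Type*} (s t : σ) :
    fsum F s t ∈ FinSeries R σ := by
  classical
  intro d
  let u : ℕ × ℕ → (σ →₀ ℕ) := fun p => Finsupp.single s p.1 + Finsupp.single t p.2
  refine (((Set.finite_Iic d).prod (Set.finite_Iic d)).image u).subset ?_
  rintro m ⟨hm, hne⟩
  rw [fsum, coeff_subst (hasSubst_pair s t)] at hne
  obtain ⟨e, he⟩ : ∃ e : Fin 2 →₀ ℕ, coeff e F.toPowerSeries • coeff m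
      (e.prod fun i n => (![(X s : MvPowerSeries σ R), X t] i) ^ n) ≠ 0 := by
    by_contra! h
    exact hne (finsum_eq_zero_of_forall_eq_zero h)
  have he' : coeff m (X s ^ e 0 * X t ^ e 1 : MvPowerSeries σ R) ≠ 0 := by
    intro h
    apply he
    rw [Finsupp.prod_fintype _ _ (fun i => pow_zero _), Fin.prod_univ_two]
    simp [h]
  rw [X_pow_eq, X_pow_eq, monomial_mul_monomial, coeff_monomial] at he'
  have hmu : m = u (e 0, e 1) := by
    by_contra h
    exact he' (if_neg h)
  have hd : m.degree = e 0 + e 1 := by simp [hmu, u]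
  exact ⟨(e 0, e 1), ⟨by simp only [Set.mem_Iic]; omega, by simp only [Set.mem_Iic]; omega⟩,
    hmu.symm⟩

/-- The variable `x_s` in `R⟦x_σ⟧`. -/
def finX {σ : Type*} (s : σ) : FinSeries R σ := ⟨X s, X_mem_finSeries s⟩

/-- The ideal of the series of order at least `k`; these ideals define the topology
of `R⟦x_σ⟧`. -/
def orderIdeal (R σ : Type*) [CommRing R] (k : ℕ) : Ideal (FinSeries R σ) where
  carrier := {f | ∀ m : σ →₀ ℕ, m.degree < k → coeff m (f : MvPowerSeries σ R) = 0}
  add_mem' := by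
    intro f g hf hg m hm
    simp [hf m hm, hg m hm]
  zero_mem' := by
    intro m _
    simp
  smul_mem' := by
    classical
    intro c f hf m hm
    rw [smul_eq_mul, Subalgebra.coe_mul, coeff_mul]
    refine Finset.sum_eq_zero fun p hp => ?_
    rw [Finset.HasAntidiagonal.mem_antidiagonal] at hp
    have hdeg : p.1.degree + p.2.degree = m.degree := by rw [← map_add, hp]
    rw [hf p.2 (by omega), mul_zero]

section FormalGroupAlgebra

variable (F : FormalGroup R) (L : Type*) [AddCommGroup L]

/-- The ideal generated by `x_0` and by all `x_l +_F x_m - x_{l+m}`. -/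
def relIdeal : Ideal (FinSeries R L) :=
  Ideal.span ({finX 0} ∪ Set.range fun p : L × L =>
    (⟨fsum F p.1 p.2, fsum_mem_finSeries F p.1 p.2⟩ : FinSeries R L) - finX (p.1 + p.2))

/-- The closure of `relIdeal` in the topology of `R⟦x_L⟧`. -/
def relClosure : Ideal (FinSeries R L) := ⨅ k : ℕ, relIdeal F L ⊔ orderIdeal R L k

/-- The formal group algebra `R⟦L⟧_F`. -/
def FGA : Type _ := FinSeries R L ⧸ relClosure F L

instance : CommRing (FGA F L) := inferInstanceAs (CommRing (FinSeries R L ⧸ relClosure F L))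

instance : Algebra R (FGA F L) := inferInstanceAs (Algebra R (FinSeries R L ⧸ relClosure F L))

variable {L}

/-- The element `x_l` of `R⟦L⟧_F`. -/
def FGA.x (l : L) : FGA F L := Ideal.Quotient.mk (relClosure F L) (finX l)

/-! An additive automorphism `e` of `L` acts on `R⟦L⟧_F` by `x_l ↦ x_{e l}`. -/

/-- The renaming `x_l ↦ x_{e l}` of the variables of `R⟦x_L⟧`. -/
def renameFin (e : L ≃+ L) : FinSeries R L →ₐ[R] FinSeries R L :=
  ((renameEquiv R e.toEquiv).toAlgHom.comp (FinSeries R L).val).codRestrict _ (by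
    rintro ⟨f, hf⟩ d
    refine ((hf d).image (Finsupp.mapDomain e)).subset ?_
    rintro m ⟨hm, hne⟩
    obtain ⟨m', rfl⟩ : ∃ m', Finsupp.embDomain e.toEquiv.toEmbedding m' = m :=
      ⟨Finsupp.mapDomain e.symm m, by
        rw [Finsupp.embDomain_eq_mapDomain, ← Finsupp.mapDomain_comp]
        convert Finsupp.mapDomain_id
        ext; simp⟩
    refine ⟨m', ⟨?_, fun h => hne ?_⟩, by rw [Finsupp.embDomain_eq_mapDomain]; rfl⟩
    · have : (Finsupp.embDomain e.toEquiv.toEmbedding m').degree = m'.degree := by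
        rw [Finsupp.embDomain_eq_mapDomain, Finsupp.degree_mapDomain]
      omega
    · exact (coeff_embDomain_rename e.toEquiv.toEmbedding f m').trans h)

theorem coe_renameFin (e : L ≃+ L) (f : FinSeries R L) :
    (renameFin e f : MvPowerSeries L R) = rename e.toEquiv (f : MvPowerSeries L R) := rfl

theorem renameFin_finX (e : L ≃+ L) (l : L) :
    renameFin e (finX l : FinSeries R L) = finX (e l) :=
  Subtype.ext (by rw [coe_renameFin]; exact rename_X _ _)

theorem rename_fsum (e : L ≃+ L) (l m : L) :
    rename e.toEquiv (fsum F l m) = fsum F (e l) (e m) := by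
  rw [fsum, fsum, rename_eq_subst,
    subst_comp_subst_apply (hasSubst_pair l m) (HasSubst.X_comp _)]
  congr 1
  funext i
  have h : ∀ s : L, subst (X ∘ e.toEquiv : L → MvPowerSeries L R) (X s : MvPowerSeries L R) =
      X (e s) := fun s => subst_X (HasSubst.X_comp (R := R) e.toEquiv) s
  fin_cases i
  · exact h l
  · exact h m

theorem relClosure_le_comap (e : L ≃+ L) :
    relClosure F L ≤ (relClosure F L).comap (renameFin e : FinSeries R L →ₐ[R] FinSeries R L) := by
  intro f hf
  rw [Ideal.mem_comap, relClosure, Ideal.mem_iInf]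
  intro k
  have hk : relIdeal F L ⊔ orderIdeal R L k ≤
      (relIdeal F L ⊔ orderIdeal R L k).comap
        (renameFin e : FinSeries R L →ₐ[R] FinSeries R L) := by
    refine sup_le ?_ ?_
    · rw [relIdeal, Ideal.span_le]
      rintro g (rfl | ⟨⟨l, m⟩, rfl⟩)
      · refine Ideal.mem_sup_left (Ideal.subset_span (Or.inl ?_))
        change renameFin e (finX 0) = finX 0
        rw [renameFin_finX, map_zero]
      · refine Ideal.mem_sup_left (Ideal.subset_span (Or.inr ⟨(e l, e m), ?_⟩))
        change _ = renameFin e _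
        rw [map_sub, renameFin_finX, map_add]
        exact congrArg (· - _) (Subtype.ext (rename_fsum F e l m).symm)
    · intro g hg
      refine Ideal.mem_sup_right fun m hm => ?_
      change coeff m (rename e.toEquiv (g : MvPowerSeries L R)) = 0
      by_cases h : m ∈ Set.range (Finsupp.mapDomain e.toEquiv)
      · obtain ⟨m', rfl⟩ := h
        rw [Finsupp.degree_mapDomain] at hm
        have := coeff_embDomain_rename e.toEquiv.toEmbedding (g : MvPowerSeries L R) m'
        rw [Finsupp.embDomain_eq_mapDomain] at this
        exact this.trans (hg m' hm)
      · exact coeff_rename_eq_zero _ _ h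
  exact hk (by rw [relClosure, Ideal.mem_iInf] at hf; exact hf k)

/-- The automorphism `x_l ↦ x_{e l}` of `R⟦L⟧_F`, as an algebra homomorphism. -/
def FGA.map (e : L ≃+ L) : FGA F L →ₐ[R] FGA F L :=
  Ideal.quotientMapₐ (relClosure F L) (renameFin e) (relClosure_le_comap F e)

theorem FGA.map_mk (e : L ≃+ L) (f : FinSeries R L) :
    FGA.map F e (Ideal.Quotient.mk (relClosure F L) f) =
      Ideal.Quotient.mk (relClosure F L) (renameFin e f) := rfl

theorem FGA.map_x (e : L ≃+ L) (l : L) : FGA.map F e (FGA.x F l) = FGA.x F (e l) := by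
  rw [FGA.x, FGA.map_mk, renameFin_finX, FGA.x]

theorem FGA.map_refl (f : FGA F L) : FGA.map F (AddEquiv.refl L) f = f := by
  obtain ⟨f, rfl⟩ := Ideal.Quotient.mk_surjective f
  rw [FGA.map_mk]
  congr 1
  exact Subtype.ext (rename_id_apply _)

theorem FGA.map_map (e e' : L ≃+ L) (f : FGA F L) :
    FGA.map F e (FGA.map F e' f) = FGA.map F (e'.trans e) f := by
  obtain ⟨f, rfl⟩ := Ideal.Quotient.mk_surjective f
  rw [FGA.map_mk, FGA.map_mk, FGA.map_mk]
  congr 1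
  exact Subtype.ext (rename_rename e'.toEquiv e.toEquiv _)

end FormalGroupAlgebra

/-! ### The twisted formal group algebra -/

section Twisted

variable (F : FormalGroup R) {ι M N : Type*} [AddCommGroup M] [AddCommGroup N]
  (P : RootPairing ι ℤ M N)

variable {P} in
/-- The automorphism of the lattice `Γ ⊕ Λ`, where `Γ = ℤ`, that is the identity on `Γ` and the
action of `w` on `Λ`. -/
def weylAct (w : P.weylGroup) : ℤ × M ≃+ ℤ × M :=
  (AddEquiv.refl ℤ).prodCongr (DistribMulAction.toAddEquiv M w)

/-- The algebra `S = R⟦Γ ⊕ Λ⟧_F`, where `Γ = ℤ` is generated by `γ = 1`. -/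
abbrev SF (_ : RootPairing ι ℤ M N) : Type _ := FGA F (ℤ × M)

instance : MulSemiringAction P.weylGroup (SF F P) where
  smul w f := FGA.map F (weylAct w) f
  one_smul f := by
    have h : weylAct (1 : P.weylGroup) = AddEquiv.refl _ := by
      ext x
      · rfl
      · exact one_smul P.weylGroup x.2
    change FGA.map F (weylAct 1) f = f
    rw [h, FGA.map_refl]
  mul_smul w w' f := by
    have h : weylAct (w * w') = (weylAct w').trans (weylAct w) := by
      ext x
      · rfl
      · exact mul_smul w w' x.2
    change FGA.map F (weylAct (w * w')) f = FGA.map F (weylAct w) (FGA.map F (weylAct w') f)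
    rw [h, FGA.map_map]
  smul_zero w := map_zero (FGA.map F (weylAct w))
  smul_add w := map_add (FGA.map F (weylAct w))
  smul_one w := map_one (FGA.map F (weylAct w))
  smul_mul w := map_mul (FGA.map F (weylAct w))

/-- The element `x_γ` of `S`. -/
def xγ : SF F P := FGA.x F ((1, 0) : ℤ × M)

/-- The element `x_l` of `S`, for `l ∈ Λ`. -/
def xΛ (l : M) : SF F P := FGA.x F ((0, l) : ℤ × M)

/-- The element `x_α` of `S`, where `α` is the root with index `i`. -/
def xr (i : ι) : SF F P := xΛ F P (P.root i)

theorem smul_xΛ (w : P.weylGroup) (l : M) : w • xΛ F P l = xΛ F P (w • l) :=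
  FGA.map_x F (weylAct w) (0, l)

theorem smul_xr (w : P.weylGroup) (i : ι) : w • xr F P i = xr F P (w • i) := by
  rw [xr, smul_xΛ, RootPairing.weylGroup_apply_root]
  rfl

theorem smul_algebraMap_SF (w : P.weylGroup) (r : R) :
    w • algebraMap R (SF F P) r = algebraMap R (SF F P) r :=
  (FGA.map F (weylAct w)).commutes r

/-- The multiplicative set generated by the `x_α`, for all roots `α`. -/
def rootMonoid : Submonoid (SF F P) := Submonoid.closure (Set.range (xr F P))

theorem xr_mem (i : ι) : xr F P i ∈ rootMonoid F P := Submonoid.subset_closure ⟨i, rfl⟩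

/-- The localization `Q = S[1/x_α]`. Since `x_{-α}` is the product of `x_α` and a unit of `S`, it
does not matter whether `α` runs through all the roots or through the positive ones. -/
def QF : Type _ := Localization (rootMonoid F P)

instance : CommRing (QF F P) := inferInstanceAs (CommRing (Localization (rootMonoid F P)))

instance : Algebra (SF F P) (QF F P) :=
  inferInstanceAs (Algebra (SF F P) (Localization (rootMonoid F P)))

instance : Algebra R (QF F P) := inferInstanceAs (Algebra R (Localization (rootMonoid F P)))

instance : IsScalarTower R (SF F P) (QF F P) :=
  inferInstanceAs (IsScalarTower R (SF F P) (Localization (rootMonoid F P)))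

instance : IsLocalization (rootMonoid F P) (QF F P) :=
  inferInstanceAs (IsLocalization (rootMonoid F P) (Localization (rootMonoid F P)))

/-- The element `1 / x_α` of `Q`. -/
def invx (i : ι) : QF F P := IsLocalization.mk' (QF F P) 1 ⟨xr F P i, xr_mem F P i⟩

theorem rootMonoid_le_comap (w : P.weylGroup) : rootMonoid F P ≤
    (rootMonoid F P).comap (MulSemiringAction.toRingHom P.weylGroup (SF F P) w) := by
  rw [rootMonoid, Submonoid.closure_le]
  rintro _ ⟨i, rfl⟩
  change w • xr F P i ∈ rootMonoid F P
  rw [smul_xr]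
  exact xr_mem F P _

/-- The ring homomorphism `Q → Q` induced by the action of `w` on `S`. -/
def QF.act (w : P.weylGroup) : QF F P →+* QF F P :=
  IsLocalization.map (QF F P) (MulSemiringAction.toRingHom P.weylGroup (SF F P) w)
    (rootMonoid_le_comap F P w)

theorem QF.act_algebraMap (w : P.weylGroup) (s : SF F P) :
    QF.act F P w (algebraMap _ _ s) = algebraMap _ _ (w • s) :=
  IsLocalization.map_eq _ s

instance : MulSemiringAction P.weylGroup (QF F P) where
  smul w q := QF.act F P w q
  one_smul q := by
    refine RingHom.congr_fun (f := QF.act F P 1) (g := RingHom.id _) ?_ q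
    refine IsLocalization.ringHom_ext (rootMonoid F P) (RingHom.ext fun s => ?_)
    simp [QF.act_algebraMap]
  mul_smul w w' q := by
    refine RingHom.congr_fun (f := QF.act F P (w * w'))
      (g := (QF.act F P w).comp (QF.act F P w')) ?_ q
    refine IsLocalization.ringHom_ext (rootMonoid F P) (RingHom.ext fun s => ?_)
    simp [QF.act_algebraMap, mul_smul]
  smul_zero w := map_zero (QF.act F P w)
  smul_add w := map_add (QF.act F P w)
  smul_one w := map_one (QF.act F P w)
  smul_mul w := map_mul (QF.act F P w)

theorem smul_algebraMap_QF (w : P.weylGroup) (s : SF F P) :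
    w • algebraMap (SF F P) (QF F P) s = algebraMap (SF F P) (QF F P) (w • s) :=
  QF.act_algebraMap F P w s

instance : SMulCommClass P.weylGroup R (QF F P) where
  smul_comm w r q := by
    rw [Algebra.smul_def, Algebra.smul_def, smul_mul',
      IsScalarTower.algebraMap_apply R (SF F P) (QF F P), smul_algebraMap_QF, smul_algebraMap_SF]

/-- The twisted formal group algebra `Q_W = Q ⋊ R[W]`: its elements are the sums `∑ a_w δ_w`,
with `δ_w a = w(a) δ_w` for `a ∈ Q`. It is an `R`-algebra. -/
abbrev QW : Type _ := SkewMonoidAlgebra (QF F P) P.weylGroup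

variable {P}

/-- The image of `s ∈ S` in `Q_W`. -/
def ofS (s : SF F P) : QW F P := SkewMonoidAlgebra.single 1 (algebraMap (SF F P) (QF F P) s)

variable (P) in
/-- The formal Demazure element `X_α = 1/x_α - (1/x_α) δ_{s_α}`. -/
def demX (i : ι) : QW F P :=
  SkewMonoidAlgebra.single 1 (invx F P i) -
    SkewMonoidAlgebra.single (RootPairing.weylGroup.ofIdx P i) (invx F P i)

variable (P) in
/-- The Demazure-Lusztig element `T_α = x_γ X_α + δ_{s_α}`. -/
def demT (i : ι) : QW F P :=
  ofS F (xγ F P) * demX F P i + SkewMonoidAlgebra.single (RootPairing.weylGroup.ofIdx P i) 1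

/-- The formal affine Demazure algebra `D_F`, generated by `S` and the `X_α`, `α` simple. -/
def DF (b : P.Base) : Subalgebra R (QW F P) :=
  Algebra.adjoin R (Set.range (ofS F) ∪ demX F P '' b.support)

/-- The formal affine Hecke algebra `H_F`, generated by `S` and the `T_α`, `α` simple. -/
def HF (b : P.Base) : Subalgebra R (QW F P) :=
  Algebra.adjoin R (Set.range (ofS F) ∪ demT F P '' b.support)

/-! ### The residue conditions -/

variable (P) in
/-- The subring `Q_α = S[1/x_β | β ≠ ±α]` of `Q`. -/
def Qα (i : ι) : Subalgebra (SF F P) (QF F P) :=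
  Algebra.adjoin (SF F P)
    (invx F P '' {j | P.root j ≠ P.root i ∧ P.root j ≠ -P.root i})

/-- The root with index `i` is positive. -/
def IsPosRoot (b : P.Base) (i : ι) : Prop :=
  P.root i ∈ AddSubmonoid.closure (P.root '' b.support)

open scoped Classical in
/-- `c̃_w = ∏ (x_α - x_γ)` over the `α` in `Σ(w) = w Σ⁻ ∩ Σ⁺`. -/
def ctilde [Fintype ι] (b : P.Base) (w : P.weylGroup) : SF F P :=
  ∏ i : ι with IsPosRoot b i ∧ ¬ IsPosRoot b (w⁻¹ • i), (xr F P i - xγ F P)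

/-- Condition R1: `x_α a_w ∈ Q_α`. -/
def R1 (z : QW F P) : Prop :=
  ∀ (i : ι) (w : P.weylGroup), algebraMap (SF F P) (QF F P) (xr F P i) * z.coeff w ∈ Qα F P i

/-- Condition R2: `a_w + a_{s_α w} ∈ Q_α`. -/
def R2 (z : QW F P) : Prop :=
  ∀ (i : ι) (w : P.weylGroup),
    z.coeff w + z.coeff (RootPairing.weylGroup.ofIdx P i * w) ∈ Qα F P i

/-- Condition R3: `a_w / c̃_w ∈ Q`. -/
def R3 [Fintype ι] (b : P.Base) (z : QW F P) : Prop :=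
  ∀ w : P.weylGroup, ∃ q : QF F P, z.coeff w = algebraMap (SF F P) (QF F P) (ctilde F b w) * q

variable (P) in
/-- The elements of `Q_W` satisfying R1 and R2. -/
def DFres : Set (QW F P) := {z | R1 F z ∧ R2 F z}

/-- The elements of `Q_W` satisfying R1, R2 and R3. -/
def HFres [Fintype ι] (b : P.Base) : Set (QW F P) := {z | z ∈ DFres F P ∧ R3 F b z}

end Twisted

/-! ### The assumption on the root datum and the formal group law -/

/-- The formal integer `n ·_F x = x +_F ... +_F x` in `R⟦x⟧`. -/
def formalInt (F : FormalGroup R) : ℕ → PowerSeries R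
  | 0 => 0
  | n + 1 => F.toPowerSeries.subst ![formalInt F n, PowerSeries.X]

/-- The types of irreducible reduced root systems. -/
inductive DynkinType
  | A (l : ℕ) | B (l : ℕ) | C (l : ℕ) | D (l : ℕ) | E₆ | E₇ | E₈ | F₄ | G₂

namespace DynkinType

/-- The number of simple roots. -/
def rank : DynkinType → ℕ
  | A l => l | B l => l | C l => l | D l => l
  | E₆ => 6 | E₇ => 7 | E₈ => 8 | F₄ => 4 | G₂ => 2

/-- The ranges of `l` for which every irreducible root system has exactly one type;
`A₁ = B₁ = C₁` is listed as `A₁` and `B₂ = C₂` as `C₂`. -/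
def IsProper : DynkinType → Prop
  | A l => 1 ≤ l | B l => 3 ≤ l | C l => 2 ≤ l | D l => 4 ≤ l
  | E₆ => True | E₇ => True | E₈ => True | F₄ => True | G₂ => True

/-- The Cartan matrix, with entries `⟨α_p, α_q^∨⟩`. -/
def cartan : (t : DynkinType) → Matrix (Fin t.rank) (Fin t.rank) ℤ
  | A l => CartanMatrix.A l | B l => CartanMatrix.B l
  | C l => CartanMatrix.C l | D l => CartanMatrix.D l
  | E₆ => CartanMatrix.E₆ | E₇ => CartanMatrix.E₇ | E₈ => CartanMatrix.E₈
  | F₄ => CartanMatrix.F₄ | G₂ => CartanMatrix.G₂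

end DynkinType

section Assumption

variable (F : FormalGroup R) {ι M N : Type*} [AddCommGroup M] [AddCommGroup N]
  {P : RootPairing ι ℤ M N}

variable (P) in
/-- The root datum is semisimple: the root lattice spans `Λ ⊗ ℚ`. -/
def IsSemisimpleDatum : Prop := ∀ l : M, ∃ n : ℕ, n ≠ 0 ∧ n • l ∈ P.rootSpan ℤ

variable (P) in
/-- The root lattice of the component of the root datum whose lattice is `L`. -/
def rootLattice (L : Submodule ℤ M) : Submodule ℤ M :=
  Submodule.span ℤ {m | m ∈ L ∧ m ∈ Set.range P.root}

/-- The simple roots lying in `L` have, in a suitable order, the Cartan matrix of type `t`. -/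
def HasType (b : P.Base) (L : Submodule ℤ M) (t : DynkinType) : Prop :=
  t.IsProper ∧ ∃ e : Fin t.rank ≃ {i : ι // i ∈ b.support ∧ P.root i ∈ L},
    ∀ p q, P.pairing (e p) (e q) = t.cartan p q

/-- The regularity conditions on an irreducible root datum of type `t`, with lattice `L` and root
lattice `Lr`; it is adjoint when `L = Lr`. A root datum of type `C_l` (where `C₁ = A₁`) that is not
adjoint is simply connected; one of type `E₈`, `F₄` or `G₂` is always adjoint. -/
def TypeCondition (L Lr : Submodule ℤ M) : DynkinType → Prop
  | .A l => L ≠ Lr → if l = 1 then IsUnit (2 : R)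
      else IsRegular ((Lr.toAddSubgroup.relIndex L.toAddSubgroup : ℕ) : R)
  | .B _ => (L = Lr → IsRegular (formalInt F 2)) ∧ (L ≠ Lr → IsRegular (2 : R))
  | .C _ => (L = Lr → IsRegular (formalInt F 2)) ∧ (L ≠ Lr → IsUnit (2 : R))
  | .D _ => L ≠ Lr → IsRegular (2 : R)
  | .G₂ => IsRegular (formalInt F 2) ∧ IsRegular (formalInt F 3)
  | .F₄ => IsRegular (formalInt F 2)
  | .E₆ => L ≠ Lr → IsRegular (3 : R)
  | .E₇ => (L = Lr → IsRegular (formalInt F 2) ∨ IsRegular (formalInt F 3)) ∧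
      (L ≠ Lr → IsRegular (2 : R))
  | .E₈ => IsRegular (formalInt F 2) ∨ IsRegular (formalInt F 3)

/-- The root datum is a direct sum of irreducible root data, each of which has a Dynkin type
and satisfies the regularity condition for this type. -/
def DivAssumption (b : P.Base) : Prop :=
  ∃ (k : ℕ) (L : Fin k → Submodule ℤ M), DirectSum.IsInternal L ∧
    (∀ i, ∃ j, P.root i ∈ L j) ∧
    ∀ j, ∃ t : DynkinType, HasType b (L j) t ∧ TypeCondition F (L j) (rootLattice P (L j)) t

end Assumption

end

end FormalHecke

/-! A basis of a lattice identifies its formal group algebra with the power series ring in the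
corresponding variables (`nonempty_coord`), so divisibility in `S` becomes divisibility of power
series. The type-by-type hypotheses enter only through `RegularDatum`: every root is `d` times a
basis vector with `d` a unit of `R`, and two roots `α ≠ ±β` have the form `d • B p` and `k • B p + c
• B q` with `d` a unit and `c ·_F x` regular. Hence `x_α` is associated to a variable, and `x_α ∣
x_β f` implies `x_α ∣ f`, because modulo `X p` the element `x_β` becomes `c ·_F X q`. Similarly `x_α
- x_γ` is associated to `x_{α-γ}`, and `α - γ` is a basis vector of `Γ ⊕ Λ`; so it is regular and
prime to every `x_β`. It follows that the intersection of all `Q_α` is `S`, and that divisibility by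
`c̃_w` can be tested after clearing the denominators of `Q`.

The algebras satisfy the residue conditions because `1` does and the conditions are stable under
left multiplication by the generators. For R1 and R2 this rests on two facts: `s_α` acts trivially
on `Q_α` modulo `x_α`, and `1/x_α + 1/x_{-α}` lies in `S`. For R3 it rests on the recursion `c̃_{s_j
w} = (x_j - x_γ) s_j(c̃_w)` when `s_j w` is longer than `w`.

The converse is a triangular elimination along the length `|Σ(w)|`. Let `w` have maximal length in
the support of `z`. At `α ∈ Σ(w)` condition R1 allows a simple pole of `a_w`. At any other positive
`α` the element `s_α w` is longer, so its coefficient vanishes and R2 leaves no pole. Hence `a_w` is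
an `S`-multiple of `∏ 1/x_α` over `Σ(w)`, the leading coefficient of a product of the `-X_{α_i}`
along a reduced word. With R3 it is an `S`-multiple of `∏ (x_α - x_γ)/x_α`, the leading coefficient
of the corresponding product of the `T_{α_i}`.

The type conditions yield `RegularDatum` through Gram determinants. Normalized on the root lattice
of a component, the invariant form is even, and the half squared lengths of the roots are at most `m
= 1, 2, 3`. A rank two Gram determinant is then positive and congruent to `0` or `3` modulo `4`,
while for two roots it is at most `4 m ^ 2`. This bounds the index `c`; what remains is controlled
by an integer killing `Λ'/Λ'_r`. -/

open MvPowerSeries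

namespace FormalHecke

noncomputable section

variable {R : Type*} [CommRing R]

/-! ### Order and divisibility of power series -/

section Order

variable {σ τ : Type*}

/-- The ideal of the power series of order at least `k`. -/
def ordIdeal (R σ : Type*) [CommRing R] (k : ℕ) : Ideal (MvPowerSeries σ R) where
  carrier := {f | ∀ m : σ →₀ ℕ, m.degree < k → coeff m f = 0}
  add_mem' := by
    intro f g hf hg m hm
    simp [hf m hm, hg m hm]
  zero_mem' := by
    intro m _
    simp
  smul_mem' := by
    classical
    intro c f hf m hm
    rw [smul_eq_mul, coeff_mul]
    refine Finset.sum_eq_zero fun p hp => ?_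
    rw [Finset.HasAntidiagonal.mem_antidiagonal] at hp
    have hdeg : p.1.degree + p.2.degree = m.degree := by rw [← map_add, hp]
    rw [hf p.2 (by omega), mul_zero]

theorem ordIdeal_zero : ordIdeal R σ 0 = ⊤ :=
  eq_top_iff.2 fun _ _ _ h => absurd h (Nat.not_lt_zero _)

theorem mem_ordIdeal_one {f : MvPowerSeries σ R} :
    f ∈ ordIdeal R σ 1 ↔ constantCoeff f = 0 := by
  refine ⟨fun h => h 0 (by simp), fun h m hm => ?_⟩
  obtain rfl : m = 0 := (Finsupp.degree_eq_zero_iff m).1 (by omega)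
  exact h

theorem mul_mem_ordIdeal {j k : ℕ} {f g : MvPowerSeries σ R} (hf : f ∈ ordIdeal R σ j)
    (hg : g ∈ ordIdeal R σ k) : f * g ∈ ordIdeal R σ (j + k) := by
  classical
  intro m hm
  rw [coeff_mul]
  refine Finset.sum_eq_zero fun p hp => ?_
  rw [Finset.HasAntidiagonal.mem_antidiagonal] at hp
  have hdeg : p.1.degree + p.2.degree = m.degree := by rw [← map_add, hp]
  by_cases h : p.1.degree < j
  · rw [hf p.1 h, zero_mul]
  · rw [hg p.2 (by omega), mul_zero]

theorem pow_mem_ordIdeal {f : MvPowerSeries σ R} (hf : constantCoeff f = 0) (n : ℕ) :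
    f ^ n ∈ ordIdeal R σ n := by
  induction n with
  | zero => rw [ordIdeal_zero]; trivial
  | succ n ih => rw [pow_succ]; exact mul_mem_ordIdeal ih (mem_ordIdeal_one.2 hf)

theorem prod_pow_mem_ordIdeal {a : τ → MvPowerSeries σ R} (ha : ∀ i, constantCoeff (a i) = 0)
    (d : τ →₀ ℕ) : (d.prod fun i n => a i ^ n) ∈ ordIdeal R σ d.degree := by
  classical
  induction d using Finsupp.induction with
  | zero => rw [map_zero, ordIdeal_zero]; trivial
  | single_add i n d hi hn ih =>
    rw [Finsupp.prod_add_index' (fun _ => pow_zero _) (fun _ => pow_add _),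
      map_add, Finsupp.degree_single, Finsupp.prod_single_index (h := fun i n => a i ^ n)
        (pow_zero _)]
    exact mul_mem_ordIdeal (pow_mem_ordIdeal (ha i) n) ih

theorem eq_of_forall_sub_mem_ordIdeal {f g : MvPowerSeries σ R}
    (h : ∀ k, f - g ∈ ordIdeal R σ k) : f = g := by
  ext m
  have := h (m.degree + 1) m (Nat.lt_succ_self _)
  rwa [map_sub, sub_eq_zero] at this

theorem subst_mem_ordIdeal [Finite τ] {a : τ → MvPowerSeries σ R}
    (ha : ∀ i, constantCoeff (a i) = 0) {k : ℕ} {g : MvPowerSeries τ R}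
    (hg : g ∈ ordIdeal R τ k) : g.subst a ∈ ordIdeal R σ k := by
  intro m hm
  rw [coeff_subst (hasSubst_of_constantCoeff_zero ha)]
  refine finsum_eq_zero_of_forall_eq_zero fun d => ?_
  by_cases hd : d.degree < k
  · rw [hg d hd, zero_smul]
  · rw [prod_pow_mem_ordIdeal ha d m (by omega), smul_zero]

theorem aeval_mem_ordIdeal {a : τ → MvPowerSeries σ R} (ha : ∀ i, constantCoeff (a i) = 0)
    {k : ℕ} {p : MvPolynomial τ R} (hp : (p : MvPowerSeries τ R) ∈ ordIdeal R τ k) :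
    MvPolynomial.aeval a p ∈ ordIdeal R σ k := by
  rw [MvPolynomial.aeval_def, MvPolynomial.eval₂_eq]
  refine Ideal.sum_mem _ fun d _ => ?_
  by_cases hd : d.degree < k
  · have := hp d hd
    rw [MvPolynomial.coeff_coe] at this
    rw [this, map_zero, zero_mul]
    exact zero_mem _
  · refine Ideal.mul_mem_left _ _ fun m hm => prod_pow_mem_ordIdeal ha d m (by omega)

theorem sub_truncTotal_mem_ordIdeal [Finite τ] (k : ℕ) (g : MvPowerSeries τ R) :
    g - (truncTotal k g : MvPolynomial τ R) ∈ ordIdeal R τ k := by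
  intro m hm
  rw [map_sub, MvPolynomial.coeff_coe, coeff_truncTotal _ hm, sub_self]

/-- `killCompl` sets the extra variable to zero, so it retains exactly the coefficients of the
monomials free of that variable. -/
theorem X_none_dvd_of_killCompl_eq_zero {f : MvPowerSeries (Option σ) R}
    (h : killCompl Function.Embedding.some f = 0) : X none ∣ f := by
  rw [X_dvd_iff]
  intro m hm
  have hm' : Finsupp.embDomain Function.Embedding.some m.some = m := by
    ext (_ | i)
    · rw [hm]
      exact Finsupp.embDomain_of_notMem_range _ _ _ (by simp)
    · exact Finsupp.embDomain_apply_self _ _ _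
  have := congrArg (coeff m.some) h
  rwa [coeff_killCompl, hm', coeff_zero] at this

theorem exists_eq_rename_some_add (f : MvPowerSeries (Option σ) R) :
    ∃ g, f = rename Function.Embedding.some (killCompl Function.Embedding.some f) +
      X none * g := by
  obtain ⟨g, hg⟩ := X_none_dvd_of_killCompl_eq_zero (σ := σ) (R := R)
    (f := f - rename Function.Embedding.some (killCompl Function.Embedding.some f))
    (by rw [map_sub, killCompl_rename_app, sub_self])
  exact ⟨g, by rw [← hg]; ring⟩

variable [Finite σ]

theorem hasSubst_option {c : MvPowerSeries σ R} (hc : constantCoeff c = 0) :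
    HasSubst (fun o : Option σ => o.elim c X) :=
  hasSubst_of_constantCoeff_zero (by rintro (_ | i) <;> simp [hc])

theorem subst_option_rename {c : MvPowerSeries σ R} (hc : constantCoeff c = 0)
    (f : MvPowerSeries σ R) :
    subst (fun o : Option σ => o.elim c X) (rename Function.Embedding.some f) = f := by
  rw [rename_eq_subst, subst_comp_subst_apply (HasSubst.X_comp _) (hasSubst_option hc)]
  have : (fun s : σ => subst (fun o : Option σ => o.elim c X)
      ((X ∘ Function.Embedding.some : σ → MvPowerSeries (Option σ) R) s)) = X := by
    funext s
    exact subst_X (hasSubst_option hc) (some s)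
  rw [this, subst_self, id]

theorem subst_option_zero (f : MvPowerSeries (Option σ) R) :
    subst (fun o : Option σ => o.elim (0 : MvPowerSeries σ R) X) f =
      killCompl Function.Embedding.some f := by
  obtain ⟨g, hg⟩ := exists_eq_rename_some_add f
  conv_lhs => rw [hg]
  rw [subst_add (hasSubst_option (map_zero _)), subst_option_rename (map_zero _),
    subst_mul (hasSubst_option (map_zero _)), subst_X (hasSubst_option (map_zero _))]
  simp

/-- If `a i ≡ b i` modulo `c` for all `i`, then `f(a) ≡ f(b)` modulo `c`. -/
theorem dvd_subst_sub_subst [Finite τ] {a b : τ → MvPowerSeries σ R} {c : MvPowerSeries σ R}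
    (ha : ∀ i, constantCoeff (a i) = 0) (hc : constantCoeff c = 0)
    (h : ∀ i, c ∣ b i - a i) (f : MvPowerSeries τ R) : c ∣ f.subst b - f.subst a := by
  -- Generic case first: the extra variable `t` replaces `c`. The series `f(a + t u)` and `f(a)`
  -- agree at `t = 0`, so they differ by a multiple of `t`; specializing `t` to `c` gives the claim.
  choose u hu using h
  let a₁ : τ → MvPowerSeries (Option σ) R := fun i => rename Function.Embedding.some (a i)
  let b₁ : τ → MvPowerSeries (Option σ) R := fun i =>
    rename Function.Embedding.some (a i) + X none * rename Function.Embedding.some (u i)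
  have ha₁ : HasSubst a₁ := hasSubst_of_constantCoeff_zero fun i => by
    simp only [a₁, constantCoeff_rename, ha]
  have hb₁ : HasSubst b₁ := hasSubst_of_constantCoeff_zero fun i => by
    simp only [b₁, map_add, map_mul, constantCoeff_rename, ha, constantCoeff_X, zero_mul, add_zero]
  obtain ⟨g, hg⟩ : X none ∣ f.subst b₁ - f.subst a₁ := by
    refine X_none_dvd_of_killCompl_eq_zero ?_
    rw [map_sub, sub_eq_zero, ← subst_option_zero, ← subst_option_zero,
      subst_comp_subst_apply hb₁ (hasSubst_option (map_zero _)),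
      subst_comp_subst_apply ha₁ (hasSubst_option (map_zero _))]
    congr 1
    funext i
    simp only [b₁, a₁]
    rw [subst_add (hasSubst_option (map_zero _)), subst_mul (hasSubst_option (map_zero _)),
      subst_X (hasSubst_option (map_zero _))]
    simp
  have h₁ := congrArg (subst (fun o : Option σ => o.elim c X)) hg
  rw [subst_sub (hasSubst_option hc), subst_mul (hasSubst_option hc),
    subst_X (hasSubst_option hc), subst_comp_subst_apply hb₁ (hasSubst_option hc),
    subst_comp_subst_apply ha₁ (hasSubst_option hc)] at h₁
  have hb : (fun i => subst (fun o : Option σ => o.elim c X) (b₁ i)) = b := by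
    funext i
    simp only [b₁]
    rw [subst_add (hasSubst_option hc), subst_mul (hasSubst_option hc),
      subst_X (hasSubst_option hc), subst_option_rename hc, subst_option_rename hc,
      Option.elim_none, ← hu]
    ring
  have ha' : (fun i => subst (fun o : Option σ => o.elim c X) (a₁ i)) = a := by
    funext i
    exact subst_option_rename hc _
  rw [hb, ha'] at h₁
  exact ⟨_, h₁⟩

end Order

/-! ### The points of a formal group -/

section Points

variable (F : FormalGroup R) {σ : Type*}

/-- The formal sum `f +_F g = F(f, g)`. -/
abbrev fadd (f g : MvPowerSeries σ R) : MvPowerSeries σ R := F.toPowerSeries.subst ![f, g]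

variable {F} in
theorem hasSubst_two {f g : MvPowerSeries σ R} (hf : constantCoeff f = 0)
    (hg : constantCoeff g = 0) : HasSubst ![f, g] :=
  hasSubst_of_constantCoeff_zero fun i => by fin_cases i <;> simp [hf, hg]

theorem powerSeries_hasSubst {f : MvPowerSeries σ R} (hf : constantCoeff f = 0) :
    PowerSeries.HasSubst f := PowerSeries.HasSubst.of_constantCoeff_zero hf

theorem constantCoeff_fadd {f g : MvPowerSeries σ R} (hf : constantCoeff f = 0)
    (hg : constantCoeff g = 0) : constantCoeff (fadd F f g) = 0 :=
  constantCoeff_subst_eq_zero (hasSubst_two hf hg)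
    (fun i => by fin_cases i <;> simp [hf, hg]) F.zero_constantCoeff

/-- `F(x, y) = x + y + x y G(x, y)` for some `G`. -/
theorem exists_toPowerSeries_eq : ∃ G : MvPowerSeries (Fin 2) R,
    F.toPowerSeries = X 0 + X 1 + X 0 * X 1 * G := by
  have hX : (![X 0, X 1] : Fin 2 → MvPowerSeries (Fin 2) R) = X := by
    funext i; fin_cases i <;> rfl
  have self_eq (f : MvPowerSeries (Fin 2) R) : f.subst ![X 0, X 1] = f := by
    rw [hX, subst_self, id]
  have key0 : ∀ f : MvPowerSeries (Fin 2) R, X 0 ∣ f - f.subst ![0, X 1] := fun f => by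
    conv_rhs => enter [1]; rw [← self_eq f]
    refine dvd_subst_sub_subst ?_ ?_ ?_ _
    · intro i; fin_cases i <;> simp
    · simp
    · intro i; fin_cases i <;> simp
  have key1 : ∀ f : MvPowerSeries (Fin 2) R, X 1 ∣ f - f.subst ![X 0, 0] := fun f => by
    conv_rhs => enter [1]; rw [← self_eq f]
    refine dvd_subst_sub_subst ?_ ?_ ?_ _
    · intro i; fin_cases i <;> simp
    · simp
    · intro i; fin_cases i <;> simp
  -- From `F(0, y) = y` one gets `F = y + x A`. Then `F(x, 0) = x` and the regularity of `x` give
  -- `A(x, 0) = 1`, so that `A = 1 + y G`.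
  obtain ⟨A, hA⟩ := key0 F.toPowerSeries
  rw [F.zero_add (powerSeries_hasSubst (constantCoeff_X _))] at hA
  obtain ⟨G, hG⟩ := key1 A
  have h2 : HasSubst ![X 0, (0 : MvPowerSeries (Fin 2) R)] := HasSubst.X_zero
  have hA1 : A.subst ![X 0, (0 : MvPowerSeries (Fin 2) R)] = 1 := by
    have h := congrArg (subst ![X 0, (0 : MvPowerSeries (Fin 2) R)]) hA
    rw [subst_sub h2, F.add_zero (powerSeries_hasSubst (constantCoeff_X _)), subst_mul h2,
      subst_X h2, subst_X h2] at h
    simp only [Matrix.cons_val_zero, Matrix.cons_val_one, Matrix.cons_val_fin_one, sub_zero] at h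
    have hreg : (X 0 : MvPowerSeries (Fin 2) R) ∈ nonZeroDivisors _ :=
      X_mem_nonzeroDivisors
    refine ((mul_cancel_left_mem_nonZeroDivisors hreg).1 ?_)
    rw [← h, mul_one]
  rw [hA1] at hG
  exact ⟨G, by linear_combination hA + X 0 * hG⟩

theorem exists_fadd_eq : ∃ G : MvPowerSeries (Fin 2) R, ∀ {σ : Type*} {f g : MvPowerSeries σ R},
    constantCoeff f = 0 → constantCoeff g = 0 →
      fadd F f g = f + g + f * g * G.subst ![f, g] := by
  obtain ⟨G, hG⟩ := exists_toPowerSeries_eq F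
  refine ⟨G, fun {σ f g} hf hg => ?_⟩
  have h := hasSubst_two hf hg
  rw [fadd, hG, subst_add h, subst_add h, subst_mul h, subst_mul h, subst_X h, subst_X h]
  rfl

end Points

end

end FormalHecke

open MvPowerSeries

namespace FormalHecke

noncomputable section

variable {R : Type*} [CommRing R]

/-! ### The group of points of a formal group law -/

section PointGroup

variable (F : FormalGroup R) {σ : Type*}

/-- Every power series without constant term has an inverse for the formal group law. -/
theorem exists_fadd_eq_zero [Finite σ] {f : MvPowerSeries σ R} (hf : constantCoeff f = 0) :
    ∃ g : MvPowerSeries σ R, constantCoeff g = 0 ∧ fadd F f g = 0 := by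
  obtain ⟨G, hG⟩ := exists_fadd_eq F
  -- As `F(f, g) = f + g + f g G(f, g)`, the inverses of `f` are the fixed points of `T`. Since `f`
  -- has no constant term, `T` raises the order of differences by one, and its iterates converge.
  let T : MvPowerSeries σ R → MvPowerSeries σ R := fun g => -f - f * (g * G.subst ![f, g])
  have hT0 : ∀ g, constantCoeff (T g) = 0 := fun g => by simp [T, hf]
  have hT : ∀ g h, constantCoeff g = 0 → constantCoeff h = 0 → ∀ k, g - h ∈ ordIdeal R σ k →
      T g - T h ∈ ordIdeal R σ (k + 1) := by
    intro g h hg hh k hgh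
    obtain ⟨c, hc⟩ : g - h ∣ g * G.subst ![f, g] - h * G.subst ![f, h] := by
      obtain ⟨c, hc⟩ : g - h ∣ G.subst ![f, g] - G.subst ![f, h] := by
        refine dvd_subst_sub_subst ?_ (by simp [hg, hh]) ?_ G
        · intro i; fin_cases i <;> simp [hf, hh]
        · intro i; fin_cases i <;> simp
      exact ⟨G.subst ![f, g] + h * c, by linear_combination h * hc⟩
    have : T g - T h = (f * (g - h)) * (-c) := by
      simp only [T]
      linear_combination (-f) * hc
    rw [this, Nat.add_comm]
    exact Ideal.mul_mem_right _ _ (mul_mem_ordIdeal (mem_ordIdeal_one.2 hf) hgh)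
  let s : ℕ → MvPowerSeries σ R := fun n => T^[n] 0
  have hs0 : ∀ n, constantCoeff (s n) = 0 := by
    rintro (_ | n)
    · simp [s]
    · simp only [s, Function.iterate_succ_apply', hT0]
  have hs : ∀ n k, s (n + k) - s n ∈ ordIdeal R σ n := by
    intro n k
    induction n with
    | zero => rw [ordIdeal_zero]; trivial
    | succ n ih =>
      rw [show n + 1 + k = n + k + 1 by ring]
      simp only [s, Function.iterate_succ_apply']
      exact hT _ _ (hs0 _) (hs0 _) _ ih
  -- Coefficients of degree `d` no longer change from the iterate `d + 1` on.
  let g : MvPowerSeries σ R := fun m => coeff m (s (m.degree + 1))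
  have hg : ∀ n, g - s n ∈ ordIdeal R σ n := by
    intro n m hm
    obtain ⟨k, rfl⟩ := Nat.exists_eq_add_of_le (Nat.succ_le_of_lt hm)
    have := hs (m.degree + 1) k m (Nat.lt_succ_self _)
    rw [map_sub, sub_eq_zero] at this ⊢
    exact this.symm
  have hg0 : constantCoeff g = 0 := by
    have := hg 1
    rw [mem_ordIdeal_one, map_sub, hs0, sub_zero] at this
    exact this
  refine ⟨g, hg0, ?_⟩
  have hfix : T g = g := by
    refine eq_of_forall_sub_mem_ordIdeal fun k => ?_
    have h1 := hT g (s k) hg0 (hs0 k) k (hg k)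
    have h2 := hg (k + 1)
    have h3 : T g - g = (T g - T (s k)) - (g - s (k + 1)) := by
      simp only [s, Function.iterate_succ_apply']
      ring
    rw [h3]
    exact fun m hm => sub_mem h1 h2 m (by omega)
  rw [hG hf hg0]
  simp only [T] at hfix
  linear_combination -hfix

/-- The power series without constant term, with the addition given by the formal group law. -/
def Pt (_ : FormalGroup R) (σ : Type*) : Type _ := {f : MvPowerSeries σ R // constantCoeff f = 0}

variable {F}

theorem fadd_assoc {f g h : MvPowerSeries σ R} (hf : constantCoeff f = 0)
    (hg : constantCoeff g = 0) (hh : constantCoeff h = 0) :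
    fadd F (fadd F f g) h = fadd F f (fadd F g h) :=
  F.assoc' (powerSeries_hasSubst hf) (powerSeries_hasSubst hg) (powerSeries_hasSubst hh)

theorem fadd_zero {f : MvPowerSeries σ R} (hf : constantCoeff f = 0) : fadd F f 0 = f :=
  F.add_zero (powerSeries_hasSubst hf)

theorem zero_fadd {f : MvPowerSeries σ R} (hf : constantCoeff f = 0) : fadd F 0 f = f :=
  F.zero_add (powerSeries_hasSubst hf)

theorem fadd_comm [F.IsComm] {f g : MvPowerSeries σ R} (hf : constantCoeff f = 0)
    (hg : constantCoeff g = 0) : fadd F f g = fadd F g f :=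
  F.comm' (powerSeries_hasSubst hf) (powerSeries_hasSubst hg)

instance : Add (Pt F σ) := ⟨fun x y => ⟨fadd F x.1 y.1, constantCoeff_fadd F x.2 y.2⟩⟩

instance : Zero (Pt F σ) := ⟨⟨0, map_zero _⟩⟩

variable [Finite σ]

instance : Neg (Pt F σ) := ⟨fun x => ⟨(exists_fadd_eq_zero F x.2).choose,
  (exists_fadd_eq_zero F x.2).choose_spec.1⟩⟩

theorem Pt.add_comm [F.IsComm] (x y : Pt F σ) : x + y = y + x :=
  Subtype.ext (fadd_comm x.2 y.2)

theorem Pt.neg_add_cancel [F.IsComm] (x : Pt F σ) : -x + x = 0 :=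
  (Pt.add_comm _ _).trans (Subtype.ext (exists_fadd_eq_zero F x.2).choose_spec.2)

instance [F.IsComm] : AddCommGroup (Pt F σ) where
  add_assoc x y z := Subtype.ext (fadd_assoc x.2 y.2 z.2)
  zero_add x := Subtype.ext (zero_fadd x.2)
  add_zero x := Subtype.ext (fadd_zero x.2)
  neg_add_cancel := Pt.neg_add_cancel
  add_comm := Pt.add_comm
  nsmul := nsmulRec
  zsmul := zsmulRec

theorem Pt.coe_add [F.IsComm] (x y : Pt F σ) : (x + y).1 = fadd F x.1 y.1 := rfl

theorem Pt.coe_zero [F.IsComm] : (0 : Pt F σ).1 = 0 := rfl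

variable (F) in
/-- The homomorphism from a free abelian group to the points of the formal group that maps the
basis to the variables. -/
theorem exists_coordinates [F.IsComm] {L : Type*} [AddCommGroup L] (b : Module.Basis σ ℤ L) :
    ∃ y : L → MvPowerSeries σ R, (∀ l, constantCoeff (y l) = 0) ∧ y 0 = 0 ∧
      (∀ l m, y (l + m) = fadd F (y l) (y m)) ∧ ∀ i, y (b i) = X i := by
  let v : σ → Pt F σ := fun i => ⟨X i, constantCoeff_X i⟩
  let f : L →ₗ[ℤ] Pt F σ := b.constr ℤ v
  refine ⟨fun l => (f l).1, fun l => (f l).2, ?_, fun l m => ?_, fun i => ?_⟩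
  · simp only [map_zero, Pt.coe_zero]
  · simp only [map_add, Pt.coe_add]
  · exact congrArg Subtype.val (b.constr_basis ℤ v i)

end PointGroup

/-! ### Evaluation of series in infinitely many variables -/

section Evaluation

variable {σ L τ : Type*} [Finite σ]

theorem sub_mem_orderIdeal_iff {f g : FinSeries R L} {k : ℕ} : f - g ∈ orderIdeal R L k ↔
    (f : MvPowerSeries L R) - g ∈ ordIdeal R L k := Iff.rfl

/-- Only finitely many monomials of bounded degree occur, so the truncation is a genuine polynomial.
This is what makes series in infinitely many variables evaluable. -/
theorem exists_polynomial_approx (f : FinSeries R L) (k : ℕ) :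
    ∃ p : MvPolynomial L R, (f : MvPowerSeries L R) - p ∈ ordIdeal R L k := by
  refine ⟨truncFinset R (f.2 k).toFinset f, fun m hm => ?_⟩
  rw [map_sub, MvPolynomial.coeff_coe]
  by_cases h : coeff m (f : MvPowerSeries L R) = 0
  · rw [h, zero_sub, neg_eq_zero]
    exact coeff_truncFinset_eq_zero _ (by simp [h])
  · rw [coeff_truncFinset_of_mem _ (by simp [h, hm.le]), sub_self]

/-- Each `y l` has order at least one, so a polynomial of order `k` takes a value of order `k`. The
values at polynomial approximations of `f` therefore form a Cauchy family, with limit `g`. -/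
theorem exists_evalFin (y : L → MvPowerSeries σ R) (hy : ∀ l, constantCoeff (y l) = 0)
    (f : FinSeries R L) : ∃ g : MvPowerSeries σ R, ∀ (k : ℕ) (p : MvPolynomial L R),
      (f : MvPowerSeries L R) - p ∈ ordIdeal R L k →
        g - MvPolynomial.aeval y p ∈ ordIdeal R σ k := by
  choose p hp using exists_polynomial_approx f
  let g : MvPowerSeries σ R := fun m => coeff m (MvPolynomial.aeval y (p (m.degree + 1)))
  refine ⟨g, fun k q hq m hm => ?_⟩
  rw [map_sub, sub_eq_zero]
  have h : ((p (m.degree + 1) - q : MvPolynomial L R) : MvPowerSeries L R) ∈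
      ordIdeal R L (m.degree + 1) := by
    intro n hn
    have h1 := hp (m.degree + 1) n hn
    have h2 := hq n (by omega)
    rw [map_sub, MvPolynomial.coeff_coe] at h1 h2
    rw [MvPolynomial.coeff_coe, MvPolynomial.coeff_sub]
    linear_combination h2 - h1
  have := aeval_mem_ordIdeal hy h m (Nat.lt_succ_self _)
  rw [map_sub, map_sub, sub_eq_zero] at this
  exact this

theorem coe_mul_approx {f g : MvPowerSeries L R} {p q : MvPowerSeries L R} {k : ℕ}
    (hp : f - p ∈ ordIdeal R L k) (hq : g - q ∈ ordIdeal R L k) :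
    f * g - p * q ∈ ordIdeal R L k := by
  have : f * g - p * q = (f - p) * g + p * (g - q) := by ring
  rw [this]
  exact add_mem (Ideal.mul_mem_right _ _ hp) (Ideal.mul_mem_left _ _ hq)

/-- The evaluation of a series in `R⟦x_L⟧` at power series without constant term. -/
def evalFin (y : L → MvPowerSeries σ R) (hy : ∀ l, constantCoeff (y l) = 0) :
    FinSeries R L →ₐ[R] MvPowerSeries σ R :=
  have spec := fun f => (exists_evalFin y hy f).choose_spec
  have poly : ∀ (f : FinSeries R L) (p : MvPolynomial L R), (f : MvPowerSeries L R) = p →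
      (exists_evalFin y hy f).choose = MvPolynomial.aeval y p := fun f p h =>
    eq_of_forall_sub_mem_ordIdeal fun k => spec f k p (by rw [h, sub_self]; exact zero_mem _)
  { toFun := fun f => (exists_evalFin y hy f).choose
    map_one' := (poly 1 1 (by simp)).trans (map_one _)
    map_zero' := (poly 0 0 (by simp)).trans (map_zero _)
    commutes' := fun r => (poly _ (MvPolynomial.C r) (by
      simp [MvPowerSeries.algebraMap_apply])).trans (MvPolynomial.aeval_C _ _)
    map_add' := fun f g => by
      refine eq_of_forall_sub_mem_ordIdeal fun k => ?_
      obtain ⟨p, hp⟩ := exists_polynomial_approx f k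
      obtain ⟨q, hq⟩ := exists_polynomial_approx g k
      have h1 := spec (f + g) k (p + q) (by
        have := add_mem hp hq
        simp only [Subalgebra.coe_add, MvPolynomial.coe_add]
        convert this using 1
        ring)
      have h2 := add_mem (spec f k p hp) (spec g k q hq)
      rw [map_add] at h1
      convert sub_mem h1 h2 using 1
      ring
    map_mul' := fun f g => by
      refine eq_of_forall_sub_mem_ordIdeal fun k => ?_
      obtain ⟨p, hp⟩ := exists_polynomial_approx f k
      obtain ⟨q, hq⟩ := exists_polynomial_approx g k
      have h1 := spec (f * g) k (p * q) (by
        simp only [Subalgebra.coe_mul, MvPolynomial.coe_mul]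
        exact coe_mul_approx hp hq)
      have h2 := coe_mul_approx (spec f k p hp) (spec g k q hq)
      rw [map_mul] at h1
      convert sub_mem h1 h2 using 1
      ring }

variable {y : L → MvPowerSeries σ R} {hy : ∀ l, constantCoeff (y l) = 0}

theorem evalFin_sub_aeval_mem {f : FinSeries R L} {k : ℕ} {p : MvPolynomial L R}
    (h : (f : MvPowerSeries L R) - p ∈ ordIdeal R L k) :
    evalFin y hy f - MvPolynomial.aeval y p ∈ ordIdeal R σ k :=
  (exists_evalFin y hy f).choose_spec k p h

theorem evalFin_finX (l : L) : evalFin y hy (finX l) = y l := by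
  refine eq_of_forall_sub_mem_ordIdeal fun k => ?_
  have := evalFin_sub_aeval_mem (y := y) (hy := hy) (f := finX l) (k := k)
    (p := MvPolynomial.X l) (by
      rw [MvPolynomial.coe_X]
      simp [finX])
  rwa [MvPolynomial.aeval_X] at this

theorem evalFin_mem_ordIdeal {f : FinSeries R L} {k : ℕ} (h : f ∈ orderIdeal R L k) :
    evalFin y hy f ∈ ordIdeal R σ k := by
  have := evalFin_sub_aeval_mem (y := y) (hy := hy) (f := f) (k := k) (p := 0) (by
    rw [MvPolynomial.coe_zero, sub_zero]
    exact h)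
  rwa [map_zero, sub_zero] at this

theorem subst_sub_subst_truncTotal_mem [Finite τ] {a : τ → MvPowerSeries L R}
    (ha : ∀ i, constantCoeff (a i) = 0) (g : MvPowerSeries τ R) (k : ℕ) :
    g.subst a - MvPolynomial.aeval a (truncTotal k g) ∈ ordIdeal R L k := by
  rw [← subst_coe, ← subst_sub (hasSubst_of_constantCoeff_zero ha)]
  exact subst_mem_ordIdeal ha (sub_truncTotal_mem_ordIdeal k g)

theorem evalFin_subst_X [Finite τ] (g : MvPowerSeries τ R) (l : τ → L) {f : FinSeries R L}
    (hf : (f : MvPowerSeries L R) = g.subst (X ∘ l : τ → MvPowerSeries L R)) :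
    evalFin y hy f = g.subst (y ∘ l) := by
  refine eq_of_forall_sub_mem_ordIdeal fun k => ?_
  have h1 := subst_sub_subst_truncTotal_mem (a := (X ∘ l : τ → MvPowerSeries L R))
    (fun i => constantCoeff_X _) g k
  have h2 := subst_sub_subst_truncTotal_mem (a := y ∘ l) (fun i => hy _) g k
  have h3 : MvPolynomial.aeval (X ∘ l : τ → MvPowerSeries L R) (truncTotal k g) =
      (MvPolynomial.rename l (truncTotal k g) : MvPolynomial L R) := by
    induction truncTotal k g using MvPolynomial.induction_on with
    | C r => simp [MvPowerSeries.algebraMap_apply]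
    | add p q hp hq => simp [hp, hq]
    | mul_X p i hp => simp [hp]
  rw [h3, ← hf] at h1
  have h4 := evalFin_sub_aeval_mem (y := y) (hy := hy) h1
  rw [MvPolynomial.aeval_rename] at h4
  convert sub_mem h4 h2 using 1
  ring

end Evaluation

/-! ### Coordinates on the formal group algebra -/

section Coordinates

variable {L τ : Type*}

theorem aeval_sub_aeval_mem {A : Type*} [CommRing A] [Algebra R A] {I : Ideal A} {a a' : τ → A}
    (p : MvPolynomial τ R) (h : ∀ i, a i - a' i ∈ I) :
    MvPolynomial.aeval a p - MvPolynomial.aeval a' p ∈ I := by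
  induction p using MvPolynomial.induction_on with
  | C r => simp
  | add p q hp hq =>
    rw [map_add, map_add, add_sub_add_comm]
    exact add_mem hp hq
  | mul_X p i hp =>
    rw [map_mul, map_mul, MvPolynomial.aeval_X, MvPolynomial.aeval_X]
    have := add_mem (I.mul_mem_right (a i) hp) (I.mul_mem_left (MvPolynomial.aeval a' p) (h i))
    convert this using 1
    ring

theorem coe_aeval_finSeries (a : τ → FinSeries R L) (q : MvPolynomial τ R) :
    ((MvPolynomial.aeval a q : FinSeries R L) : MvPowerSeries L R) =
      MvPolynomial.aeval (fun i => (a i : MvPowerSeries L R)) q :=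
  (MvPolynomial.aeval_algebraMap_apply (B := MvPowerSeries L R) a q).symm

variable (F : FormalGroup R) [AddCommGroup L]

/-- The ideal is closed, so modulo each `orderIdeal` the elements may be replaced by approximations,
for which congruences reduce to polynomial identities. -/
theorem sub_mem_relClosure {f g : FinSeries R L}
    (h : ∀ k, ∃ f' g' : FinSeries R L, f - f' ∈ orderIdeal R L k ∧
      g - g' ∈ orderIdeal R L k ∧ f' - g' ∈ relClosure F L) : f - g ∈ relClosure F L := by
  rw [relClosure, Ideal.mem_iInf]
  intro k
  obtain ⟨f', g', h1, h2, h3⟩ := h k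
  rw [relClosure, Ideal.mem_iInf] at h3
  have : f - g = (f' - g') + ((f - f') - (g - g')) := by ring
  rw [this]
  exact add_mem (h3 k) (Ideal.mem_sup_right (sub_mem h1 h2))

variable [Finite τ]

/-- Power series respect congruences modulo the closed ideal of relations. -/
theorem subst_sub_subst_mem_relClosure (g : MvPowerSeries τ R) {a a' : τ → FinSeries R L}
    (ha : ∀ i, constantCoeff (a i : MvPowerSeries L R) = 0)
    (ha' : ∀ i, constantCoeff (a' i : MvPowerSeries L R) = 0)
    (h : ∀ i, a i - a' i ∈ relClosure F L) {w w' : FinSeries R L}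
    (hw : (w : MvPowerSeries L R) = g.subst fun i => (a i : MvPowerSeries L R))
    (hw' : (w' : MvPowerSeries L R) = g.subst fun i => (a' i : MvPowerSeries L R)) :
    w - w' ∈ relClosure F L := by
  refine sub_mem_relClosure F fun k => ⟨MvPolynomial.aeval a (truncTotal k g),
    MvPolynomial.aeval a' (truncTotal k g), ?_, ?_, ?_⟩
  · rw [sub_mem_orderIdeal_iff, hw, coe_aeval_finSeries]
    exact subst_sub_subst_truncTotal_mem ha g k
  · rw [sub_mem_orderIdeal_iff, hw', coe_aeval_finSeries]
    exact subst_sub_subst_truncTotal_mem ha' g k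
  · exact aeval_sub_aeval_mem _ h

theorem subst_mem_finSeries (g : MvPowerSeries τ R) {a : τ → MvPowerSeries L R}
    (ha : ∀ i, constantCoeff (a i) = 0) (h : ∀ i, a i ∈ FinSeries R L) :
    g.subst a ∈ FinSeries R L := by
  intro d
  have hmem : MvPolynomial.aeval a (truncTotal (d + 1) g) ∈ FinSeries R L := by
    lift a to τ → FinSeries R L using h
    rw [← coe_aeval_finSeries]
    exact (MvPolynomial.aeval a (truncTotal (d + 1) g)).2
  refine (hmem d).subset ?_
  rintro m ⟨hm, hne⟩
  have := subst_sub_subst_truncTotal_mem ha g (d + 1) m (Nat.lt_succ_of_le hm)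
  rw [map_sub, sub_eq_zero] at this
  exact ⟨hm, this ▸ hne⟩

theorem subst_X_mem_finSeries (g : MvPowerSeries τ R) (l : τ → L) :
    g.subst (X ∘ l : τ → MvPowerSeries L R) ∈ FinSeries R L :=
  subst_mem_finSeries g (fun _ => constantCoeff_X _) fun _ => X_mem_finSeries _

theorem fadd_sub_fadd_mem_relClosure {f g f' g' w w' : FinSeries R L}
    (hf : constantCoeff (f : MvPowerSeries L R) = 0)
    (hg : constantCoeff (g : MvPowerSeries L R) = 0)
    (hf' : constantCoeff (f' : MvPowerSeries L R) = 0)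
    (hg' : constantCoeff (g' : MvPowerSeries L R) = 0)
    (h : f - f' ∈ relClosure F L) (h' : g - g' ∈ relClosure F L)
    (hw : (w : MvPowerSeries L R) = fadd F f g) (hw' : (w' : MvPowerSeries L R) = fadd F f' g') :
    w - w' ∈ relClosure F L := by
  have e : ∀ f g : FinSeries R L, (![(f : MvPowerSeries L R), g] : Fin 2 → MvPowerSeries L R) =
      fun i => ((![f, g] : Fin 2 → FinSeries R L) i : MvPowerSeries L R) := by
    intro f g
    funext i
    fin_cases i <;> rfl
  rw [fadd, e] at hw hw'
  refine subst_sub_subst_mem_relClosure F F.toPowerSeries (fun i => ?_) (fun i => ?_)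
    (fun i => ?_) hw hw' <;> fin_cases i <;> assumption

end Coordinates

end

end FormalHecke

open MvPowerSeries

namespace FormalHecke

noncomputable section

variable {R : Type*} [CommRing R]

/-! ### The formal group algebra of a free lattice as a power series ring -/

section Coordinates

variable (F : FormalGroup R) {L σ : Type*} [AddCommGroup L] [Finite σ]

/-- An identification of `R⟦L⟧_F` with the power series ring in the variables `x_{b i}`, where `b`
is a basis of `L`. -/
structure Coord (b : Module.Basis σ ℤ L) where
  equiv : FGA F L ≃ₐ[R] MvPowerSeries σ R
  x_basis (i : σ) : equiv (FGA.x F (b i)) = X i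
  constantCoeff_x (l : L) : constantCoeff (equiv (FGA.x F l)) = 0
  x_add (l m : L) : equiv (FGA.x F (l + m)) = fadd F (equiv (FGA.x F l)) (equiv (FGA.x F m))
  map_eq (e : L ≃+ L) (f : FGA F L) :
    equiv (FGA.map F e f) = (equiv f).subst fun i => equiv (FGA.x F (e (b i)))

theorem sub_mem_relClosure_of_finX {φ : MvPolynomial L R →ₐ[R] FinSeries R L}
    (h : ∀ l, φ (MvPolynomial.X l) - finX l ∈ relClosure F L) (p : MvPolynomial L R) :
    φ p - MvPolynomial.aeval finX p ∈ relClosure F L := by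
  have : φ p = MvPolynomial.aeval (fun l => φ (MvPolynomial.X l)) p := by
    rw [← MvPolynomial.comp_aeval_apply, MvPolynomial.aeval_X_left_apply]
  rw [this]
  exact aeval_sub_aeval_mem p h

theorem coe_aeval_finX (p : MvPolynomial L R) :
    ((MvPolynomial.aeval finX p : FinSeries R L) : MvPowerSeries L R) = p := by
  induction p using MvPolynomial.induction_on with
  | C r => simp [MvPowerSeries.algebraMap_apply]
  | add p q hp hq => rw [map_add, Subalgebra.coe_add, hp, hq, MvPolynomial.coe_add]
  | mul_X p i hp =>
    rw [map_mul, Subalgebra.coe_mul, hp, MvPolynomial.coe_mul, MvPolynomial.aeval_X,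
      MvPolynomial.coe_X, finX]

/-- Evaluation `φ` sends `x_l` to `y l`, where `y` is the homomorphism from `L` to the points of the
formal group with `y (b i) = X i`; in the other direction `ψ` sends `g` to its value at the `x_{b
i}`. Clearly `φ ∘ ψ = id`. For `ψ ∘ φ`, the `l` with `ψ (y l) ≡ x_l` modulo the closed ideal form a
subgroup containing the basis, and density of polynomials does the rest. -/
theorem nonempty_coord [F.IsComm] (b : Module.Basis σ ℤ L) : Nonempty (Coord F b) := by
  obtain ⟨y, hy, hy0, hadd, hb⟩ := exists_coordinates F b
  let φ : FinSeries R L →ₐ[R] MvPowerSeries σ R := evalFin y hy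
  have hφrel : ∀ f ∈ relIdeal F L, φ f = 0 := by
    intro f hf
    have : relIdeal F L ≤ RingHom.ker φ := by
      rw [relIdeal, Ideal.span_le]
      rintro g (rfl | ⟨⟨l, m⟩, rfl⟩)
      · exact (evalFin_finX _).trans hy0
      · change φ _ = 0
        rw [map_sub, sub_eq_zero]
        refine (evalFin_subst_X F.toPowerSeries ![l, m] ?_).trans ?_
        · change fsum F l m = _
          rw [fsum]
          congr 1
          funext i
          fin_cases i <;> rfl
        · refine Eq.trans ?_ (evalFin_finX _).symm
          rw [hadd]
          congr 1
          funext i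
          fin_cases i <;> rfl
    exact this hf
  have hφ : ∀ f ∈ relClosure F L, φ f = 0 := by
    intro f hf
    refine eq_of_forall_sub_mem_ordIdeal fun k => ?_
    rw [relClosure, Ideal.mem_iInf] at hf
    obtain ⟨u, hu, v, hv, rfl⟩ := Submodule.mem_sup.1 (hf k)
    rw [map_add, hφrel u hu, zero_add, sub_zero]
    exact evalFin_mem_ordIdeal hv
  have hXb : HasSubst (X ∘ b : σ → MvPowerSeries L R) :=
    hasSubst_of_constantCoeff_zero fun i => constantCoeff_X _
  let ψ : MvPowerSeries σ R →ₐ[R] FinSeries R L :=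
    (substAlgHom hXb).codRestrict (FinSeries R L) fun g => by
        rw [substAlgHom_apply]
        exact subst_X_mem_finSeries g b
  have hψ : ∀ g, (ψ g : MvPowerSeries L R) = g.subst (X ∘ b : σ → MvPowerSeries L R) :=
    fun g => substAlgHom_apply hXb g
  have hφψ : ∀ g, φ (ψ g) = g := by
    intro g
    refine (evalFin_subst_X g b (hψ g)).trans ?_
    have : y ∘ b = X := funext hb
    rw [this, subst_self, id]
  have hψ0 : ∀ g, constantCoeff g = 0 → constantCoeff (ψ g : MvPowerSeries L R) = 0 := by
    intro g hg
    rw [hψ]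
    exact constantCoeff_subst_eq_zero hXb (fun i => constantCoeff_X _) hg
  have hψadd : ∀ f g, constantCoeff f = 0 → constantCoeff g = 0 →
      (ψ (fadd F f g) : MvPowerSeries L R) = fadd F (ψ f : MvPowerSeries L R) (ψ g) := by
    intro f g hf hg
    rw [hψ, fadd, subst_comp_subst_apply (hasSubst_two hf hg) hXb]
    congr 1
    funext i
    fin_cases i <;> exact (hψ _).symm
  have hX : ∀ l : L, constantCoeff (finX l : FinSeries R L).1 = 0 := fun l => constantCoeff_X _
  have hrel : ∀ l m, (⟨fsum F l m, fsum_mem_finSeries F l m⟩ : FinSeries R L) - finX (l + m) ∈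
      relClosure F L := by
    intro l m
    rw [relClosure, Ideal.mem_iInf]
    exact fun k => Ideal.mem_sup_left (Ideal.subset_span (Or.inr ⟨(l, m), rfl⟩))
  have hrel0 : (finX 0 : FinSeries R L) ∈ relClosure F L := by
    rw [relClosure, Ideal.mem_iInf]
    exact fun k => Ideal.mem_sup_left (Ideal.subset_span (Or.inl rfl))
  -- the series `x_l` is congruent to its expression in the coordinates
  have hH : ∀ l, ψ (y l) - finX l ∈ relClosure F L := by
    have hAdd : ∀ l m, ψ (y l) - finX l ∈ relClosure F L → ψ (y m) - finX m ∈ relClosure F L →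
        ψ (y (l + m)) - finX (l + m) ∈ relClosure F L := by
      intro l m hl hm
      have := fadd_sub_fadd_mem_relClosure F (hψ0 _ (hy l)) (hψ0 _ (hy m)) (hX l) (hX m) hl hm
        (w := ψ (y (l + m))) (w' := ⟨fsum F l m, fsum_mem_finSeries F l m⟩)
        (by rw [hadd, hψadd _ _ (hy l) (hy m)]) rfl
      have h2 := add_mem this (hrel l m)
      rwa [sub_add_sub_cancel] at h2
    have hZero : ψ (y 0) - finX 0 ∈ relClosure F L := by
      rw [hy0, map_zero, zero_sub]
      exact neg_mem hrel0
    -- Uniqueness of inverses: modulo the ideal both `ψ (y (-l))` and `x_{-l}` are formal inverses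
    -- of `x_l`. The two bracketings of the formal sum of `ψ (y (-l))`, `x_l` and `x_{-l}` reduce to
    -- the one and to the other.
    have hNeg : ∀ l, ψ (y l) - finX l ∈ relClosure F L →
        ψ (y (-l)) - finX (-l) ∈ relClosure F L := by
      intro l hl
      have hXl := hX l
      have hXn := hX (-l)
      have hyn := hψ0 _ (hy (-l))
      have h0 : constantCoeff ((0 : FinSeries R L) : MvPowerSeries L R) = 0 := map_zero _
      let sum : ∀ f g : FinSeries R L, constantCoeff f.1 = 0 → constantCoeff g.1 = 0 →
          FinSeries R L := fun f g hf hg => ⟨fadd F f.1 g.1, subst_mem_finSeries _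
        (fun i => by fin_cases i; exacts [hf, hg]) (fun i => by fin_cases i; exacts [f.2, g.2])⟩
      have hsum : ∀ f g hf hg, constantCoeff (sum f g hf hg).1 = 0 := fun f g hf hg =>
        constantCoeff_fadd F hf hg
      have hA : sum _ _ hXl hXn - 0 ∈ relClosure F L := by
        have h := add_mem (hrel l (-l)) (show finX (l + -l) ∈ relClosure F L by
          rw [add_neg_cancel]; exact hrel0)
        rw [sub_add_cancel] at h
        rw [sub_zero]
        exact h
      have hB : sum _ _ hyn hXl - 0 ∈ relClosure F L := by
        refine fadd_sub_fadd_mem_relClosure F hyn hXl hyn (hψ0 _ (hy l)) (by simp)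
          (by rw [← neg_sub]; exact neg_mem hl) rfl ?_
        rw [← hψadd _ _ (hy _) (hy _), ← hadd, neg_add_cancel, hy0, map_zero]
      have h1 := fadd_sub_fadd_mem_relClosure F hyn (hsum _ _ hXl hXn) hyn h0 (by simp) hA
        (w := sum _ _ hyn (hsum _ _ hXl hXn)) (w' := ψ (y (-l))) rfl (fadd_zero hyn).symm
      have h2 := fadd_sub_fadd_mem_relClosure F (hsum _ _ hyn hXl) hXn h0 hXn hB (by simp)
        (w := sum _ _ (hsum _ _ hyn hXl) hXn) (w' := finX (-l)) rfl (zero_fadd hXn).symm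
      have h3 : sum _ _ (hsum _ _ hyn hXl) hXn = sum _ _ hyn (hsum _ _ hXl hXn) :=
        Subtype.ext (fadd_assoc hyn hXl hXn)
      rw [h3] at h2
      convert sub_mem h2 h1 using 1
      ring
    let H : AddSubgroup L :=
      { carrier := {l | ψ (y l) - finX l ∈ relClosure F L}
        add_mem' := fun {l m} hl hm => hAdd l m hl hm
        zero_mem' := hZero
        neg_mem' := fun {l} hl => hNeg l hl }
    have hle : Submodule.span ℤ (Set.range b) ≤ AddSubgroup.toIntSubmodule H := by
      rw [Submodule.span_le]
      rintro _ ⟨i, rfl⟩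
      change ψ (y (b i)) - finX (b i) ∈ relClosure F L
      have : ψ (y (b i)) = finX (b i) := Subtype.ext (by
        rw [hψ, hb, subst_X hXb]
        rfl)
      rw [this, sub_self]
      exact zero_mem _
    intro l
    rw [b.span_eq] at hle
    exact hle (Submodule.mem_top (x := l))
  have hψφ : ∀ f, f - ψ (φ f) ∈ relClosure F L := by
    intro f
    refine sub_mem_relClosure F fun k => ?_
    obtain ⟨p, hp⟩ := exists_polynomial_approx f k
    refine ⟨MvPolynomial.aeval finX p, ψ (MvPolynomial.aeval y p), ?_, ?_, ?_⟩
    · rw [sub_mem_orderIdeal_iff, coe_aeval_finX]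
      exact hp
    · rw [sub_mem_orderIdeal_iff, ← Subalgebra.coe_sub, ← map_sub, hψ]
      exact subst_mem_ordIdeal (fun i => constantCoeff_X _) (evalFin_sub_aeval_mem hp)
    · rw [← neg_mem_iff, neg_sub]
      refine sub_mem_relClosure_of_finX F (φ := ψ.comp (MvPolynomial.aeval y)) (fun l => ?_) p
      rw [AlgHom.comp_apply, MvPolynomial.aeval_X]
      exact hH l
  let Φ : FGA F L →ₐ[R] MvPowerSeries σ R := Ideal.Quotient.liftₐ (relClosure F L) φ hφ
  let E : FGA F L ≃ₐ[R] MvPowerSeries σ R := AlgEquiv.ofBijective Φ (by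
    constructor
    · rw [injective_iff_map_eq_zero]
      intro f hf
      obtain ⟨f, rfl⟩ := Ideal.Quotient.mk_surjective f
      have hf' : φ f = 0 := hf
      have := hψφ f
      rw [hf', map_zero, sub_zero] at this
      exact Ideal.Quotient.eq_zero_iff_mem.2 this
    · exact fun g => ⟨Ideal.Quotient.mk _ (ψ g), hφψ g⟩)
  have hE : ∀ f, E (Ideal.Quotient.mk (relClosure F L) f) = φ f := fun f => rfl
  have hEx : ∀ l, E (FGA.x F l) = y l := fun l => evalFin_finX (hy := hy) l
  refine ⟨⟨E, fun i => by rw [hEx, hb], fun l => by rw [hEx, hy],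
    fun l m => by rw [hEx, hEx, hEx, hadd], fun e f => ?_⟩⟩
  obtain ⟨g, rfl⟩ := E.symm.surjective f
  have hg : E.symm g = Ideal.Quotient.mk (relClosure F L) (ψ g) :=
    (AlgEquiv.symm_apply_eq E).2 ((hE _).trans (hφψ g)).symm
  rw [AlgEquiv.apply_symm_apply, hg]
  refine (hE (renameFin e (ψ g))).trans ?_
  refine (evalFin_subst_X g (e ∘ b) ?_).trans ?_
  · rw [coe_renameFin, hψ, rename_eq_subst, subst_comp_subst_apply hXb
      (HasSubst.X_comp _)]
    congr 1
    funext i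
    exact subst_X (HasSubst.X_comp (R := R) e.toEquiv) (b i)
  · congr 1
    funext i
    exact (hEx _).symm

end Coordinates

end

end FormalHecke

open MvPowerSeries

namespace FormalHecke

noncomputable section

variable {R : Type*} [CommRing R]

/-! ### Cancelling a factor that involves a single variable -/

section Slice

variable {σ : Type*}

/-- The series in one variable formed by the coefficients of `f` along the ray `m + ℕ s`. -/
def slice (m : σ →₀ ℕ) (s : σ) (f : MvPowerSeries σ R) : PowerSeries R :=
  PowerSeries.mk fun j => coeff (m + Finsupp.single s j) f

theorem slice_add (m : σ →₀ ℕ) (s : σ) (f g : MvPowerSeries σ R) :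
    slice m s (f + g) = slice m s f + slice m s g := by
  ext j
  simp [slice]

variable {m : σ →₀ ℕ} {s : σ}

theorem slice_X_mul (hm : m s = 0) (f : MvPowerSeries σ R) :
    slice m s (X s * f) = PowerSeries.X * slice m s f := by
  ext j
  cases j with
  | zero =>
    rw [PowerSeries.coeff_zero_X_mul, slice, PowerSeries.coeff_mk]
    exact X_dvd_iff.1 (dvd_mul_right _ _) _ (by simp [hm])
  | succ j =>
    rw [PowerSeries.coeff_succ_X_mul, slice, slice, PowerSeries.coeff_mk, PowerSeries.coeff_mk,
      show m + Finsupp.single s (j + 1) = Finsupp.single s 1 + (m + Finsupp.single s j) by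
        rw [add_comm j, Finsupp.single_add]; abel, X, coeff_add_monomial_mul, one_mul]

theorem slice_X_pow_mul (hm : m s = 0) (k : ℕ) (f : MvPowerSeries σ R) :
    slice m s (X s ^ k * f) = PowerSeries.X ^ k * slice m s f := by
  induction k with
  | zero => simp
  | succ k ih => rw [pow_succ', mul_assoc, slice_X_mul hm, ih, pow_succ', mul_assoc]

theorem slice_C_mul (r : R) (f : MvPowerSeries σ R) :
    slice m s (C r * f) = PowerSeries.C r * slice m s f := by
  ext j
  simp [slice]

theorem slice_aeval_mul (hm : m s = 0) (p : Polynomial R) (f : MvPowerSeries σ R) :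
    slice m s (Polynomial.aeval (X s) p * f) = (p : PowerSeries R) * slice m s f := by
  induction p using Polynomial.induction_on' with
  | add p q hp hq => rw [map_add, add_mul, slice_add, hp, hq, Polynomial.coe_add, add_mul]
  | monomial n r =>
    rw [Polynomial.aeval_monomial, MvPowerSeries.algebraMap_apply, mul_assoc]
    simp only [Algebra.algebraMap_self, RingHom.id_apply]
    rw [slice_C_mul, slice_X_pow_mul hm, ← Polynomial.C_mul_X_pow_eq_monomial, Polynomial.coe_mul,
      Polynomial.coe_C, Polynomial.coe_pow, Polynomial.coe_X, mul_assoc]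

/-- Modulo `X ^ (n + 1)` the series `g` is a polynomial, for which the identity is algebraic; the
tail of `g` contributes multiples of that power to both sides. -/
theorem slice_subst_X_mul (hm : m s = 0) (g : PowerSeries R) (f : MvPowerSeries σ R) :
    slice m s (g.subst (X s : MvPowerSeries σ R) * f) = g * slice m s f := by
  have hs : PowerSeries.HasSubst (X s : MvPowerSeries σ R) :=
    powerSeries_hasSubst (constantCoeff_X s)
  ext n
  have key : (PowerSeries.X : PowerSeries R) ^ (n + 1) ∣
      slice m s (g.subst (X s : MvPowerSeries σ R) * f) - g * slice m s f := by
    obtain ⟨q, hq⟩ : ∃ q : PowerSeries R, g = PowerSeries.X ^ (n + 1) * q + ((g.trunc (n + 1) : Polynomial R) : PowerSeries R) :=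
      ⟨_, PowerSeries.eq_X_pow_mul_shift_add_trunc (n + 1) g⟩
    generalize g.trunc (n + 1) = p at hq
    rw [hq, PowerSeries.subst_add hs, PowerSeries.subst_mul hs, PowerSeries.subst_pow hs,
      PowerSeries.subst_X hs, PowerSeries.subst_coe hs, add_mul, slice_add, slice_aeval_mul hm,
      mul_assoc, slice_X_pow_mul hm]
    exact ⟨slice m s (q.subst (X s : MvPowerSeries σ R) * f) - q * slice m s f, by ring⟩
  have := PowerSeries.X_pow_dvd_iff.1 key n n.lt_succ_self
  rwa [map_sub, sub_eq_zero] at this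

/-- Multiplication by a series in `X s` alone acts on each slice in direction `s` as multiplication
by `g`. Divisibility by `X t` means that the slices along the `m` with `m t = 0` vanish, and a
regular `g` can be cancelled slice by slice. -/
theorem X_dvd_of_X_dvd_subst_X_mul {t : σ} (hst : s ≠ t) {g : PowerSeries R} (hg : IsRegular g)
    {f : MvPowerSeries σ R} (h : X t ∣ g.subst (X s : MvPowerSeries σ R) * f) : X t ∣ f := by
  classical
  rw [X_dvd_iff] at h ⊢
  intro m hm
  have hm' : (m.erase s) s = 0 := Finsupp.erase_same
  have h0 : slice (m.erase s) s (g.subst (X s : MvPowerSeries σ R) * f) = 0 := by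
    ext j
    rw [slice, PowerSeries.coeff_mk, map_zero]
    refine h _ ?_
    rw [Finsupp.add_apply, Finsupp.erase_ne hst.symm, hm, Finsupp.single_eq_of_ne hst.symm, add_zero]
  rw [slice_subst_X_mul hm'] at h0
  have h1 : slice (m.erase s) s f = 0 := hg.left (by simpa using h0)
  have := congrArg (PowerSeries.coeff (m s)) h1
  rwa [slice, PowerSeries.coeff_mk, Finsupp.erase_add_single, map_zero] at this

end Slice

/-! ### Formal integers -/

section FormalInt

variable (F : FormalGroup R)

theorem constantCoeff_formalInt (n : ℕ) : constantCoeff (formalInt F n) = 0 := by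
  induction n with
  | zero => rfl
  | succ n ih => exact constantCoeff_fadd F ih (PowerSeries.constantCoeff_X)

theorem exists_formalInt_eq (n : ℕ) :
    ∃ h : PowerSeries R, formalInt F n = PowerSeries.X * ((n : PowerSeries R) + PowerSeries.X * h) := by
  induction n with
  | zero => exact ⟨0, by simp [formalInt]⟩
  | succ n ih =>
    obtain ⟨h, hh⟩ := ih
    obtain ⟨G, hG⟩ := exists_fadd_eq F
    have : formalInt F (n + 1) = formalInt F n + PowerSeries.X + formalInt F n * PowerSeries.X *
        G.subst ![formalInt F n, PowerSeries.X] :=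
      hG (constantCoeff_formalInt F n) PowerSeries.constantCoeff_X
    refine ⟨h + ((n : PowerSeries R) + PowerSeries.X * h) * G.subst ![formalInt F n, PowerSeries.X], ?_⟩
    rw [this, hh]
    push_cast
    ring

/-- Once the factor `X` is removed the constant term is `n`, and a series with regular constant term
is regular. -/
theorem isRegular_formalInt {n : ℕ} (hn : IsRegular (n : R)) : IsRegular (formalInt F n) := by
  obtain ⟨h, hh⟩ := exists_formalInt_eq F n
  rw [hh, isRegular_iff_mem_nonZeroDivisors]
  refine mul_mem (X_mem_nonzeroDivisors (i := ())) (mem_nonZeroDivisors_of_constantCoeff ?_)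
  change PowerSeries.constantCoeff ((n : PowerSeries R) + PowerSeries.X * h) ∈ nonZeroDivisors R
  rw [map_add, map_mul, map_natCast, PowerSeries.constantCoeff_X, zero_mul, add_zero,
    ← isRegular_iff_mem_nonZeroDivisors]
  exact hn

theorem isRegular_formalInt_one : IsRegular (formalInt F 1) :=
  isRegular_formalInt F (by rw [Nat.cast_one]; exact isRegular_one)

end FormalInt

/-! ### Divisibility between the elements `x_l` -/

section Elements

variable (F : FormalGroup R) {L : Type*} [AddCommGroup L]

theorem x_zero : FGA.x F (0 : L) = 0 := by
  refine Ideal.Quotient.eq_zero_iff_mem.2 ?_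
  rw [relClosure, Ideal.mem_iInf]
  exact fun k => Ideal.mem_sup_left (Ideal.subset_span (Or.inl rfl))

theorem subst_formalInt_succ (n : ℕ) {σ : Type*} {f : MvPowerSeries σ R}
    (hf : constantCoeff f = 0) :
    (formalInt F (n + 1)).subst f = fadd F ((formalInt F n).subst f) f := by
  have hs := powerSeries_hasSubst hf
  have h2 := hasSubst_two (constantCoeff_formalInt F n) PowerSeries.constantCoeff_X
  refine (subst_comp_subst_apply h2 hs.const F.toPowerSeries).trans ?_
  have : (fun i => subst (fun _ => f) (![formalInt F n, PowerSeries.X] i)) =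
      ![(formalInt F n).subst f, f] := by
    funext i
    fin_cases i
    · rfl
    · exact PowerSeries.subst_X hs
  exact congrArg (fun a => subst a F.toPowerSeries) this

variable {F} in
theorem Coord.x_nsmul {σ : Type*} [Finite σ] {b : Module.Basis σ ℤ L} (c : Coord F b) (n : ℕ)
    (l : L) : c.equiv (FGA.x F (n • l)) = (formalInt F n).subst (c.equiv (FGA.x F l)) := by
  induction n with
  | zero =>
    rw [zero_smul, x_zero, map_zero,
      ← PowerSeries.coe_substAlgHom (powerSeries_hasSubst (c.constantCoeff_x l))]
    exact (map_zero _).symm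
  | succ n ih => rw [succ_nsmul, c.x_add, ih, subst_formalInt_succ F n (c.constantCoeff_x l)]

variable [Module.Free ℤ L] [Module.Finite ℤ L] [F.IsComm]

variable (L) in
theorem exists_coord : ∃ (n : ℕ) (b : Module.Basis (Fin n) ℤ L), Nonempty (Coord F b) :=
  ⟨_, Module.finBasis ℤ L, nonempty_coord F _⟩

theorem exists_x_add (l m : L) :
    ∃ g, FGA.x F (l + m) = FGA.x F l + FGA.x F m + FGA.x F l * FGA.x F m * g := by
  obtain ⟨n, b, ⟨c⟩⟩ := exists_coord F L
  obtain ⟨G, hG⟩ := exists_fadd_eq F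
  refine ⟨c.equiv.symm (G.subst ![c.equiv (FGA.x F l), c.equiv (FGA.x F m)]), c.equiv.injective ?_⟩
  rw [c.x_add, hG (c.constantCoeff_x l) (c.constantCoeff_x m)]
  simp

theorem isUnit_add_x_mul {r : R} (hr : IsUnit r) (l : L) (g : FGA F L) :
    IsUnit (algebraMap R _ r + FGA.x F l * g) := by
  obtain ⟨n, b, ⟨c⟩⟩ := exists_coord F L
  rw [← MulEquiv.isUnit_map c.equiv, isUnit_iff_constantCoeff]
  simp [c.constantCoeff_x, MvPowerSeries.algebraMap_apply, hr]

theorem isUnit_one_add_x_mul (l : L) (g : FGA F L) : IsUnit (1 + FGA.x F l * g) := by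
  simpa using isUnit_add_x_mul F isUnit_one l g

theorem exists_x_add_x_neg (l : L) :
    ∃ g, FGA.x F l + FGA.x F (-l) + FGA.x F l * FGA.x F (-l) * g = 0 := by
  obtain ⟨g, hg⟩ := exists_x_add F l (-l)
  exact ⟨g, by rw [← hg, add_neg_cancel, x_zero]⟩

/-- The relation reads `x_l + x_{-l} (1 + x_l g) = 0`, and the bracket is a unit. -/
theorem associated_x_neg (l : L) : Associated (FGA.x F (-l)) (FGA.x F l) := by
  obtain ⟨g, hg⟩ := exists_x_add_x_neg F l
  obtain ⟨u, hu⟩ := isUnit_one_add_x_mul F l g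
  refine ⟨-u, ?_⟩
  rw [Units.val_neg, hu]
  linear_combination -hg

theorem exists_x_nsmul (n : ℕ) (l : L) :
    ∃ h, FGA.x F (n • l) = FGA.x F l * (n + FGA.x F l * h) := by
  induction n with
  | zero => exact ⟨0, by simp [x_zero]⟩
  | succ n ih =>
    obtain ⟨h, hh⟩ := ih
    obtain ⟨g, hg⟩ := exists_x_add F (n • l) l
    refine ⟨h + (n + FGA.x F l * h) * g, ?_⟩
    rw [succ_nsmul, hg, hh]
    push_cast
    ring

theorem associated_x_nsmul {d : ℕ} (hd : IsUnit (d : R)) (l : L) :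
    Associated (FGA.x F (d • l)) (FGA.x F l) := by
  obtain ⟨h, hh⟩ := exists_x_nsmul F d l
  obtain ⟨u, hu⟩ := isUnit_add_x_mul F hd l h
  rw [map_natCast] at hu
  refine Associated.symm ⟨u, ?_⟩
  rw [hh, hu]

theorem x_dvd_x_zsmul (l : L) (k : ℤ) : FGA.x F l ∣ FGA.x F (k • l) := by
  obtain ⟨n, rfl | rfl⟩ := k.eq_nat_or_neg
  · obtain ⟨h, hh⟩ := exists_x_nsmul F n l
    exact ⟨_, by rw [natCast_zsmul]; exact hh⟩
  · obtain ⟨h, hh⟩ := exists_x_nsmul F n l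
    rw [neg_smul, natCast_zsmul]
    exact (Dvd.intro _ hh.symm).trans (associated_x_neg F _).symm.dvd

/-- Modulo `x_{l₀}` the elements `x_{l + k l₀}` and `x_l` agree, so `e` fixes all coordinates and
hence, by `dvd_subst_sub_subst`, all series. The case of interest is a reflection `e` in the root
`l₀`. -/
theorem x_dvd_map_sub {e : L ≃+ L} {l₀ : L} (he : ∀ l, ∃ k : ℤ, e l = l + k • l₀) (f : FGA F L) :
    FGA.x F l₀ ∣ FGA.map F e f - f := by
  obtain ⟨n, b, ⟨c⟩⟩ := exists_coord F L
  rw [← map_dvd_iff c.equiv, map_sub, c.map_eq]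
  have h0 : (c.equiv f).subst (X : Fin n → MvPowerSeries (Fin n) R) = c.equiv f := by
    rw [subst_self, id]
  nth_rw 2 [← h0]
  refine dvd_subst_sub_subst (fun i => constantCoeff_X i) (c.constantCoeff_x l₀) (fun i => ?_) _
  obtain ⟨k, hk⟩ := he (b i)
  rw [← c.x_basis, ← map_sub, hk, map_dvd_iff]
  obtain ⟨g, hg⟩ := exists_x_add F (b i) (k • l₀)
  rw [hg]
  obtain ⟨q, hq⟩ := x_dvd_x_zsmul F l₀ k
  exact ⟨q * (1 + FGA.x F (b i) * g), by rw [hq]; ring⟩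

theorem associated_x_sub_x (l m : L) :
    Associated (FGA.x F l - FGA.x F m) (FGA.x F (l - m)) := by
  obtain ⟨g, hg⟩ := exists_x_add F m (l - m)
  obtain ⟨u, hu⟩ := isUnit_one_add_x_mul F m g
  rw [add_sub_cancel] at hg
  refine Associated.symm ⟨u, ?_⟩
  rw [hu, hg]
  ring

theorem isRegular_x_basis {σ : Type*} [Finite σ] (b : Module.Basis σ ℤ L) (i : σ) :
    IsRegular (FGA.x F (b i)) := by
  obtain ⟨c⟩ := nonempty_coord F b
  have hX : IsRegular (X i : MvPowerSeries σ R) :=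
    isRegular_iff_mem_nonZeroDivisors.2 X_mem_nonzeroDivisors
  refine ⟨fun f g h => c.equiv.injective (hX.left ?_), fun f g h => c.equiv.injective (hX.right ?_)⟩
  · have h := congrArg c.equiv h
    simpa only [map_mul, c.x_basis] using h
  · have h := congrArg c.equiv h
    simpa only [map_mul, c.x_basis] using h

/-- Modulo `x_{b i}` the factor `x_{k b_i + n b_j}` becomes `n ·_F x_{b j}`, a regular series in
another variable. -/
theorem x_basis_dvd_of_dvd_mul {σ : Type*} [Finite σ] (b : Module.Basis σ ℤ L) {i j : σ}
    (hij : i ≠ j) (k : ℤ) {n : ℕ} (hn : IsRegular (formalInt F n)) {f : FGA F L}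
    (h : FGA.x F (b i) ∣ FGA.x F (k • b i + n • b j) * f) : FGA.x F (b i) ∣ f := by
  obtain ⟨c⟩ := nonempty_coord F b
  obtain ⟨g, hg⟩ := exists_x_add F (k • b i) (n • b j)
  obtain ⟨q, hq⟩ := x_dvd_x_zsmul F (b i) k
  have h1 : FGA.x F (b i) ∣ FGA.x F (n • b j) * f := by
    obtain ⟨r, hr⟩ := h
    refine ⟨r - q * (1 + FGA.x F (n • b j) * g) * f, ?_⟩
    rw [hg, hq] at hr
    linear_combination hr
  rw [← map_dvd_iff c.equiv, map_mul, c.x_nsmul, c.x_basis, c.x_basis] at h1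
  rw [← map_dvd_iff c.equiv, c.x_basis]
  exact X_dvd_of_X_dvd_subst_X_mul hij.symm hn h1

end Elements

end

end FormalHecke

open MvPowerSeries

namespace FormalHecke

noncomputable section

/-! ### Root lengths, parity and cokernels of the Cartan matrices -/

section CartanMatrices

variable {r : ℕ}

/-- The lengths of the simple roots are multiples of a common length, by factors at most `m`. -/
def LengthBound (C : Matrix (Fin r) (Fin r) ℤ) (m : ℤ) : Prop :=
  ∀ B : Fin r → ℤ, (∀ q, 0 < B q) → (∀ p q, C p q * B q = C q p * B p) →
    ∃ κ, 0 < κ ∧ ∀ q, ∃ s, 1 ≤ s ∧ s ≤ m ∧ B q = κ * s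

/-- Each row of the matrix has an odd entry. -/
def HasOddRows (C : Matrix (Fin r) (Fin r) ℤ) : Prop := ∀ p, ∃ q, Odd (C p q)

/-- The cokernel of the matrix is killed by `N`. -/
def KillsCokernel (C : Matrix (Fin r) (Fin r) ℤ) (N : ℤ) : Prop :=
  ∀ (u : Fin r → ℤ) (n : ℤ), (∀ q, n ∣ ∑ p, u p * C p q) → ∀ p, n ∣ N * u p

/-- Multiplying the row `u C` by the adjugate gives `det C • u`. This settles the exceptional types;
for `B`, `C` and `D` direct elimination avoids a determinant in arbitrary rank. -/
theorem killsCokernel_det (C : Matrix (Fin r) (Fin r) ℤ) : KillsCokernel C C.det := by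
  intro u n hu p
  have h1 : Matrix.vecMul (Matrix.vecMul u C) C.adjugate = C.det • u := by
    rw [Matrix.vecMul_vecMul, Matrix.mul_adjugate, Matrix.vecMul_smul, Matrix.vecMul_one]
  have h2 := congrFun h1 p
  rw [Pi.smul_apply, smul_eq_mul] at h2
  rw [← h2]
  change n ∣ ∑ q, (∑ p, u p * C p q) * C.adjugate q p
  exact Finset.dvd_sum fun q _ => Dvd.dvd.mul_right (hu q) _

theorem killsCokernel_of_det_eq {C : Matrix (Fin r) (Fin r) ℤ} {n : ℤ} (h : C.det = n) :
    KillsCokernel C n := h ▸ killsCokernel_det C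

theorem int_dvd_of_eq {n a b : ℤ} (h : n ∣ a) (e : b = a) : n ∣ b := e ▸ h

theorem sum_eq_two {f : Fin r → ℤ} (a b : Fin r) (hab : a ≠ b)
    (h : ∀ p, p ≠ a → p ≠ b → f p = 0) : ∑ p, f p = f a + f b := by
  rw [← Finset.sum_subset (Finset.subset_univ {a, b}), Finset.sum_pair hab]
  intro p _ hp
  simp only [Finset.mem_insert, Finset.mem_singleton, not_or] at hp
  exact h p hp.1 hp.2

theorem sum_eq_three {f : Fin r → ℤ} (a b c : Fin r) (hab : a ≠ b) (hac : a ≠ c) (hbc : b ≠ c)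
    (h : ∀ p, p ≠ a → p ≠ b → p ≠ c → f p = 0) : ∑ p, f p = f a + f b + f c := by
  rw [← Finset.sum_subset (Finset.subset_univ {a, b, c}), Finset.sum_insert (by simp [hab, hac]),
    Finset.sum_pair hbc, add_assoc]
  intro p _ hp
  simp only [Finset.mem_insert, Finset.mem_singleton, not_or] at hp
  exact h p hp.1 hp.2.1 hp.2.2

theorem sum_eq_four {f : Fin r → ℤ} (a b c d : Fin r) (hab : a ≠ b) (hac : a ≠ c) (had : a ≠ d)
    (hbc : b ≠ c) (hbd : b ≠ d) (hcd : c ≠ d)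
    (h : ∀ p, p ≠ a → p ≠ b → p ≠ c → p ≠ d → f p = 0) :
    ∑ p, f p = f a + f b + f c + f d := by
  rw [← Finset.sum_subset (Finset.subset_univ {a, b, c, d}),
    Finset.sum_insert (by simp [hab, hac, had]), Finset.sum_insert (by simp [hbc, hbd]),
    Finset.sum_pair hcd]
  · ring
  · intro p _ hp
    simp only [Finset.mem_insert, Finset.mem_singleton, not_or] at hp
    exact h p hp.1 hp.2.1 hp.2.2.1 hp.2.2.2

/-- The recursion is that of an arithmetic progression modulo `n` starting from a fictitious entry
`0` in position `-1`; hence the factor `q + 1`. -/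
theorem dvd_sub_of_chain {u : ℕ → ℤ} {n : ℤ} {K : ℕ} (h0 : 1 ≤ K → n ∣ 2 * u 0 - u 1)
    (h : ∀ q, q + 2 ≤ K → n ∣ -u q + 2 * u (q + 1) - u (q + 2)) :
    ∀ q ≤ K, n ∣ u q - (q + 1) * u 0 := by
  intro q
  induction q using Nat.strong_induction_on with
  | _ q ih =>
    intro hq
    match q with
    | 0 => simp
    | 1 =>
      have := h0 hq
      rw [← dvd_neg]
      refine int_dvd_of_eq this ?_
      push_cast
      ring
    | q + 2 =>
      have h1 := ih q (by omega) (by omega)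
      have h2 := ih (q + 1) (by omega) (by omega)
      have h3 := h q hq
      have := dvd_sub (dvd_sub (dvd_mul_of_dvd_right h2 2) h1) h3
      refine int_dvd_of_eq this ?_
      push_cast
      ring

theorem eq_of_chain {B : ℕ → ℤ} {K : ℕ} (h : ∀ q, q + 1 ≤ K → B q = B (q + 1)) :
    ∀ q ≤ K, B q = B 0 := by
  intro q hq
  induction q with
  | zero => rfl
  | succ q ih => rw [← h q hq, ih (by omega)]

/-- Extension of a finite sequence by zeros. -/
def extendFin (u : Fin r → ℤ) (i : ℕ) : ℤ := if h : i < r then u ⟨i, h⟩ else 0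

theorem extendFin_of_lt (u : Fin r → ℤ) {i : ℕ} (h : i < r) : extendFin u i = u ⟨i, h⟩ := dif_pos h

theorem extendFin_coe (u : Fin r → ℤ) (i : Fin r) : extendFin u i = u i := dif_pos i.2

/-! ### The classical families -/

section Families

variable {l : ℕ}

theorem cartanA_apply (i j : Fin l) : CartanMatrix.A l i j =
    if i = j then 2 else if i.val + 1 = j.val ∨ j.val + 1 = i.val then -1 else 0 := rfl

theorem cartanB_apply (i j : Fin l) : CartanMatrix.B l i j =
    if i = j then 2 else if i.val + 1 = j.val then if j.val = l - 1 then -2 else -1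
    else if j.val + 1 = i.val then -1 else 0 := rfl

theorem cartanC_apply (i j : Fin l) : CartanMatrix.C l i j =
    if i = j then 2 else if i.val + 1 = j.val then -1
    else if j.val + 1 = i.val then if i.val = l - 1 then -2 else -1 else 0 := rfl

theorem cartanD_apply (i j : Fin l) : CartanMatrix.D l i j =
    if i = j then 2
    else if l ≤ 2 then 0
    else if i.val + 1 = j.val ∧ j.val + 2 < l then -1
    else if j.val + 1 = i.val ∧ i.val + 2 < l then -1
    else if i.val + 3 = l ∧ (j.val + 2 = l ∨ j.val + 1 = l) then -1
    else if j.val + 3 = l ∧ (i.val + 2 = l ∨ i.val + 1 = l) then -1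
    else 0 := rfl

theorem cartanB_eq_zero {i j : Fin l} (h : i ≠ j) (h1 : i.val + 1 ≠ j) (h2 : j.val + 1 ≠ i) :
    CartanMatrix.B l i j = 0 := by
  rw [cartanB_apply, if_neg h, if_neg h1, if_neg h2]

theorem cartanC_eq_zero {i j : Fin l} (h : i ≠ j) (h1 : i.val + 1 ≠ j) (h2 : j.val + 1 ≠ i) :
    CartanMatrix.C l i j = 0 := by
  rw [cartanC_apply, if_neg h, if_neg h1, if_neg h2]

theorem cartanC_succ {i j : Fin l} (h : i.val + 1 = j) : CartanMatrix.C l i j = -1 := by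
  rw [cartanC_apply, if_neg (by rintro rfl; omega), if_pos h]

theorem cartanC_pred {i j : Fin l} (h : j.val + 1 = i) :
    CartanMatrix.C l i j = if i.val = l - 1 then -2 else -1 := by
  rw [cartanC_apply, if_neg (by rintro rfl; omega), if_neg (by omega), if_pos h]

theorem cartanD_eq_zero (hl : 4 ≤ l) {i j : Fin l} (h : i ≠ j)
    (h1 : ¬ (i.val + 1 = j.val ∧ j.val + 2 < l)) (h2 : ¬ (j.val + 1 = i.val ∧ i.val + 2 < l))
    (h3 : ¬ (i.val + 3 = l ∧ (j.val + 2 = l ∨ j.val + 1 = l)))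
    (h4 : ¬ (j.val + 3 = l ∧ (i.val + 2 = l ∨ i.val + 1 = l))) : CartanMatrix.D l i j = 0 := by
  rw [cartanD_apply, if_neg h, if_neg (by omega), if_neg h1, if_neg h2, if_neg h3, if_neg h4]

theorem lengthBound_A (hl : 1 ≤ l) : LengthBound (CartanMatrix.A l) 1 := by
  intro B hB h
  have key : ∀ q ≤ l - 1, extendFin B q = extendFin B 0 := by
    refine eq_of_chain fun q hq => ?_
    have := h ⟨q, by omega⟩ ⟨q + 1, by omega⟩
    rw [extendFin_of_lt B (show q < l by omega), extendFin_of_lt B (show q + 1 < l by omega)]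
    simp [cartanA_apply] at this
    omega
  refine ⟨B ⟨0, by omega⟩, hB _, fun q => ⟨1, le_rfl, le_rfl, ?_⟩⟩
  rw [← extendFin_coe B q, key q (by omega), extendFin_of_lt B (show 0 < l by omega), mul_one]

theorem lengthBound_B (hl : 3 ≤ l) : LengthBound (CartanMatrix.B l) 2 := by
  intro B hB h
  have key : ∀ q ≤ l - 2, extendFin B q = extendFin B 0 := by
    refine eq_of_chain fun q hq => ?_
    have := h ⟨q, by omega⟩ ⟨q + 1, by omega⟩
    rw [extendFin_of_lt B (show q < l by omega), extendFin_of_lt B (show q + 1 < l by omega)]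
    simp [cartanB_apply, show q + 1 ≠ l - 1 by omega] at this
    omega
  have hlast := h ⟨l - 2, by omega⟩ ⟨l - 1, by omega⟩
  simp [cartanB_apply, show l - 2 ≠ l - 1 by omega, show l - 2 + 1 = l - 1 by omega,
    show l - 1 ≠ l - 2 by omega, show l - 1 + 1 ≠ l - 2 by omega] at hlast
  have hm := key (l - 2) le_rfl
  rw [extendFin_of_lt B (show l - 2 < l by omega)] at hm
  refine ⟨B ⟨l - 1, by omega⟩, hB _, fun q => ?_⟩
  by_cases hq : q.val = l - 1
  · exact ⟨1, le_rfl, one_le_two, by rw [mul_one]; exact congrArg B (Fin.ext hq)⟩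
  · refine ⟨2, one_le_two, le_rfl, ?_⟩
    rw [← extendFin_coe B q, key q (by omega), ← hm]
    omega

theorem lengthBound_C (hl : 2 ≤ l) : LengthBound (CartanMatrix.C l) 2 := by
  intro B hB h
  have key : ∀ q ≤ l - 2, extendFin B q = extendFin B 0 := by
    refine eq_of_chain fun q hq => ?_
    have := h ⟨q, by omega⟩ ⟨q + 1, by omega⟩
    rw [extendFin_of_lt B (show q < l by omega), extendFin_of_lt B (show q + 1 < l by omega)]
    simp [cartanC_apply, show q + 1 ≠ l - 1 by omega] at this
    omega
  have hlast := h ⟨l - 2, by omega⟩ ⟨l - 1, by omega⟩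
  simp [cartanC_apply, show l - 2 ≠ l - 1 by omega, show l - 2 + 1 = l - 1 by omega,
    show l - 1 ≠ l - 2 by omega, show l - 1 + 1 ≠ l - 2 by omega] at hlast
  have hm := key (l - 2) le_rfl
  rw [extendFin_of_lt B (show l - 2 < l by omega)] at hm
  refine ⟨B ⟨l - 2, by omega⟩, hB _, fun q => ?_⟩
  by_cases hq : q.val = l - 1
  · refine ⟨2, one_le_two, le_rfl, ?_⟩
    rw [show q = ⟨l - 1, by omega⟩ from Fin.ext hq]
    omega
  · refine ⟨1, le_rfl, one_le_two, ?_⟩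
    rw [← extendFin_coe B q, key q (by omega), ← hm, mul_one]

theorem lengthBound_D (hl : 4 ≤ l) : LengthBound (CartanMatrix.D l) 1 := by
  intro B hB h
  have key : ∀ q ≤ l - 3, extendFin B q = extendFin B 0 := by
    refine eq_of_chain fun q hq => ?_
    have := h ⟨q, by omega⟩ ⟨q + 1, by omega⟩
    rw [extendFin_of_lt B (show q < l by omega), extendFin_of_lt B (show q + 1 < l by omega)]
    simp [cartanD_apply, show ¬ l ≤ 2 by omega, show q + 1 + 2 < l by omega] at this
    omega
  have h2 := h ⟨l - 3, by omega⟩ ⟨l - 2, by omega⟩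
  have h1 := h ⟨l - 3, by omega⟩ ⟨l - 1, by omega⟩
  simp only [cartanD_apply, Fin.mk.injEq] at h1 h2
  have hm := key (l - 3) le_rfl
  rw [extendFin_of_lt B (show l - 3 < l by omega)] at hm
  refine ⟨B ⟨l - 3, by omega⟩, hB _, fun q => ⟨1, le_rfl, le_rfl, ?_⟩⟩
  rw [mul_one]
  by_cases hq : q.val = l - 1
  · rw [show q = ⟨l - 1, by omega⟩ from Fin.ext hq]
    split_ifs at h1 <;> omega
  · by_cases hq' : q.val = l - 2
    · rw [show q = ⟨l - 2, by omega⟩ from Fin.ext hq']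
      split_ifs at h2 <;> omega
    · rw [← extendFin_coe B q, key q (by omega), ← hm]

theorem hasOddRows_A (hl : 2 ≤ l) : HasOddRows (CartanMatrix.A l) := by
  intro p
  by_cases hp : p.val = 0
  · exact ⟨⟨1, by omega⟩, by simp [cartanA_apply, Fin.ext_iff, hp]⟩
  · refine ⟨⟨p - 1, by omega⟩, -1, ?_⟩
    rw [cartanA_apply, if_neg (by simp only [Fin.ext_iff]; omega), if_pos (by simp only; omega)]
    rfl

theorem hasOddRows_B (hl : 3 ≤ l) : HasOddRows (CartanMatrix.B l) := by
  intro p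
  by_cases hp : p.val = 0
  · refine ⟨⟨1, by omega⟩, -1, ?_⟩
    rw [cartanB_apply, if_neg (by simp only [Fin.ext_iff]; omega), if_pos (by simp only; omega),
      if_neg (by simp only; omega)]
    rfl
  · refine ⟨⟨p - 1, by omega⟩, -1, ?_⟩
    rw [cartanB_apply, if_neg (by simp only [Fin.ext_iff]; omega), if_neg (by simp only; omega),
      if_pos (by simp only; omega)]
    rfl

theorem hasOddRows_D (hl : 4 ≤ l) : HasOddRows (CartanMatrix.D l) := by
  intro p
  obtain ⟨q, hq⟩ : ∃ q : Fin l, CartanMatrix.D l p q = -1 := by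
    by_cases hp : p.val = 0
    · refine ⟨⟨1, by omega⟩, ?_⟩
      simp only [cartanD_apply, Fin.ext_iff]
      split_ifs <;> omega
    · by_cases hp' : p.val = l - 1
      · refine ⟨⟨l - 3, by omega⟩, ?_⟩
        simp only [cartanD_apply, Fin.ext_iff]
        split_ifs <;> omega
      · refine ⟨⟨p - 1, by omega⟩, ?_⟩
        simp only [cartanD_apply, Fin.ext_iff]
        split_ifs <;> omega
  exact ⟨q, -1, by rw [hq]; rfl⟩

theorem killsCokernel_A_one : KillsCokernel (CartanMatrix.A 1) 2 := by
  have h : (CartanMatrix.A 1).det = 2 := by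
    rw [CartanMatrix.A_one, Matrix.det_fin_one]
    rfl
  exact h ▸ killsCokernel_det (CartanMatrix.A 1)

/-- The chain gives `u_q ≡ (q + 1) u_0`. The last column, with off-diagonal entry `-2`, gives `2
u_{l-1} ≡ 2 u_{l-2}`, so `2 u_0 ≡ 0`. -/
theorem killsCokernel_B (hl : 3 ≤ l) : KillsCokernel (CartanMatrix.B l) 2 := by
  intro u n hu
  have hchain : ∀ q ≤ l - 1, n ∣ extendFin u q - (q + 1) * extendFin u 0 := by
    refine dvd_sub_of_chain (fun _ => ?_) fun q hq => ?_
    · have := hu ⟨0, by omega⟩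
      rw [sum_eq_two ⟨0, by omega⟩ ⟨1, by omega⟩ (by simp) (fun p h0 h1 => by
        simp only [ne_eq, Fin.ext_iff] at h0 h1
        rw [cartanB_eq_zero (by simp only [ne_eq, Fin.ext_iff]; omega) (by simp only; omega)
          (by simp only; omega), mul_zero])] at this
      rw [extendFin_of_lt u (show 0 < l by omega), extendFin_of_lt u (show 1 < l by omega)]
      refine int_dvd_of_eq this ?_
      simp [cartanB_apply]
      ring
    · have := hu ⟨q + 1, by omega⟩
      rw [sum_eq_three ⟨q, by omega⟩ ⟨q + 1, by omega⟩ ⟨q + 2, by omega⟩ (by simp) (by simp)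
        (by simp) (fun p h0 h1 h2 => by
        simp only [ne_eq, Fin.ext_iff] at h0 h1 h2
        rw [cartanB_eq_zero (by simp only [ne_eq, Fin.ext_iff]; omega) (by simp only; omega)
          (by simp only; omega), mul_zero])] at this
      rw [extendFin_of_lt u (show q < l by omega), extendFin_of_lt u (show q + 1 < l by omega),
        extendFin_of_lt u (show q + 2 < l by omega)]
      refine int_dvd_of_eq this ?_
      simp [cartanB_apply, show q + 1 ≠ l - 1 by omega]
      ring
  have hlast := hu ⟨l - 1, by omega⟩
  rw [sum_eq_two ⟨l - 2, by omega⟩ ⟨l - 1, by omega⟩ (by simp; omega) (fun p h0 h1 => by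
    simp only [ne_eq, Fin.ext_iff] at h0 h1
    rw [cartanB_eq_zero (by simp only [ne_eq, Fin.ext_iff]; omega) (by simp only; omega)
      (by simp only; omega), mul_zero])] at hlast
  simp [cartanB_apply, show l - 2 ≠ l - 1 by omega, show l - 2 + 1 = l - 1 by omega] at hlast
  rw [← extendFin_of_lt u (show l - 2 < l by omega),
    ← extendFin_of_lt u (show l - 1 < l by omega)] at hlast
  have h1 := hchain (l - 2) (by omega)
  have h2 := hchain (l - 1) (by omega)
  have h0 : n ∣ 2 * extendFin u 0 := by
    have := dvd_add (dvd_sub (dvd_mul_of_dvd_right h1 2) (dvd_mul_of_dvd_right h2 2)) hlast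
    refine int_dvd_of_eq this ?_
    rw [show ((l - 1 : ℕ) : ℤ) = ((l - 2 : ℕ) : ℤ) + 1 by omega]
    ring
  intro p
  rw [← extendFin_coe u p]
  have := dvd_add (dvd_mul_of_dvd_right (hchain p (by omega)) 2)
    (dvd_mul_of_dvd_right h0 ((p : ℤ) + 1))
  refine int_dvd_of_eq this ?_
  ring

theorem killsCokernel_C (hl : 2 ≤ l) : KillsCokernel (CartanMatrix.C l) 2 := by
  intro u n hu
  have hlast := hu ⟨l - 1, by omega⟩
  rw [sum_eq_two ⟨l - 2, by omega⟩ ⟨l - 1, by omega⟩ (by simp; omega) (fun p h0 h1 => by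
    simp only [ne_eq, Fin.ext_iff] at h0 h1
    rw [cartanC_eq_zero (by simp only [ne_eq, Fin.ext_iff]; omega) (by simp only; omega)
      (by simp only; omega), mul_zero])] at hlast
  simp [cartanC_apply, show l - 2 ≠ l - 1 by omega, show l - 2 + 1 = l - 1 by omega] at hlast
  rw [← extendFin_of_lt u (show l - 2 < l by omega),
    ← extendFin_of_lt u (show l - 1 < l by omega)] at hlast
  -- Doubling the last entry absorbs the exceptional entry `-2`, so the recursion of the chain holds
  -- up to the end; the last column then says that the step `v 0` vanishes.
  let v : ℕ → ℤ := fun q => if q = l - 1 then 2 * extendFin u q else extendFin u q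
  have hv : ∀ q, q ≠ l - 1 → v q = extendFin u q := fun q hq => if_neg hq
  have hv' : v (l - 1) = 2 * extendFin u (l - 1) := if_pos rfl
  have hchain : ∀ q ≤ l - 1, n ∣ v q - (q + 1) * v 0 := by
    refine dvd_sub_of_chain (fun _ => ?_) fun q hq => ?_
    · have := hu ⟨0, by omega⟩
      rw [sum_eq_two ⟨0, by omega⟩ ⟨1, by omega⟩ (by simp) (fun p h0 h1 => by
        simp only [ne_eq, Fin.ext_iff] at h0 h1
        rw [cartanC_eq_zero (by simp only [ne_eq, Fin.ext_iff]; omega) (by simp only; omega)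
          (by simp only; omega), mul_zero])] at this
      simp only [v]
      rw [if_neg (by omega), extendFin_of_lt u (show 0 < l by omega),
        extendFin_of_lt u (show 1 < l by omega)]
      refine int_dvd_of_eq this ?_
      rw [CartanMatrix.C_diag, cartanC_pred rfl]
      simp only [zero_add]
      split_ifs <;> ring
    · have := hu ⟨q + 1, by omega⟩
      rw [sum_eq_three ⟨q, by omega⟩ ⟨q + 1, by omega⟩ ⟨q + 2, by omega⟩ (by simp) (by simp)
        (by simp) (fun p h0 h1 h2 => by
        simp only [ne_eq, Fin.ext_iff] at h0 h1 h2
        rw [cartanC_eq_zero (by simp only [ne_eq, Fin.ext_iff]; omega) (by simp only; omega)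
          (by simp only; omega), mul_zero])] at this
      simp only [v]
      rw [if_neg (by omega), if_neg (by omega), extendFin_of_lt u (show q < l by omega),
        extendFin_of_lt u (show q + 1 < l by omega), extendFin_of_lt u (show q + 2 < l by omega)]
      refine int_dvd_of_eq this ?_
      rw [CartanMatrix.C_diag, cartanC_succ rfl, cartanC_pred rfl]
      simp only
      split_ifs <;> ring
  have h1 := hchain (l - 2) (by omega)
  have h2 := hchain (l - 1) le_rfl
  have h0 : n ∣ v 0 := by
    have := dvd_add (dvd_sub h1 h2) hlast
    rw [hv _ (by omega), hv'] at this
    refine int_dvd_of_eq this ?_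
    rw [show ((l - 1 : ℕ) : ℤ) = ((l - 2 : ℕ) : ℤ) + 1 by omega]
    ring
  have hall : ∀ q ≤ l - 1, n ∣ v q := fun q hq =>
    (dvd_sub_left (dvd_mul_of_dvd_right h0 _)).1 (hchain q hq)
  intro p
  rw [← extendFin_coe u p]
  have := hall p (by omega)
  by_cases hp : p.val = l - 1
  · rw [hp] at this ⊢
    rwa [hv'] at this
  · rw [hv _ hp] at this
    exact dvd_mul_of_dvd_right this _

theorem killsCokernel_D (hl : 4 ≤ l) : KillsCokernel (CartanMatrix.D l) 4 := by
  intro u n hu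
  have hchain : ∀ q ≤ l - 3, n ∣ extendFin u q - (q + 1) * extendFin u 0 := by
    refine dvd_sub_of_chain (fun _ => ?_) fun q hq => ?_
    · have := hu ⟨0, by omega⟩
      rw [sum_eq_two ⟨0, by omega⟩ ⟨1, by omega⟩ (by simp) (fun p h0 h1 => by
        simp only [ne_eq, Fin.ext_iff] at h0 h1
        rw [cartanD_eq_zero (by omega) (by simp only [ne_eq, Fin.ext_iff]; omega)
          (by simp only; omega) (by simp only; omega) (by simp only; omega)
          (by simp only; omega), mul_zero])] at this
      rw [extendFin_of_lt u (show 0 < l by omega), extendFin_of_lt u (show 1 < l by omega)]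
      refine int_dvd_of_eq this ?_
      simp [cartanD_apply, show ¬ l ≤ 2 by omega, show 1 + 2 < l by omega]
      ring
    · have := hu ⟨q + 1, by omega⟩
      rw [sum_eq_three ⟨q, by omega⟩ ⟨q + 1, by omega⟩ ⟨q + 2, by omega⟩ (by simp) (by simp)
        (by simp) (fun p h0 h1 h2 => by
        simp only [ne_eq, Fin.ext_iff] at h0 h1 h2
        rw [cartanD_eq_zero (by omega) (by simp only [ne_eq, Fin.ext_iff]; omega)
          (by simp only; omega) (by simp only; omega) (by simp only; omega)
          (by simp only; omega), mul_zero])] at this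
      rw [extendFin_of_lt u (show q < l by omega), extendFin_of_lt u (show q + 1 < l by omega),
        extendFin_of_lt u (show q + 2 < l by omega)]
      refine int_dvd_of_eq this ?_
      simp [cartanD_apply, show ¬ l ≤ 2 by omega, show q + 1 + 2 < l by omega,
        show q + 2 + 2 < l by omega]
      ring
  have c1 := hu ⟨l - 1, by omega⟩
  rw [sum_eq_two ⟨l - 3, by omega⟩ ⟨l - 1, by omega⟩ (by simp; omega) (fun p h0 h1 => by
    simp only [ne_eq, Fin.ext_iff] at h0 h1
    rw [cartanD_eq_zero (by omega) (by simp only [ne_eq, Fin.ext_iff]; omega)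
      (by simp only; omega) (by simp only; omega) (by simp only; omega)
      (by simp only; omega), mul_zero])] at c1
  have c2 := hu ⟨l - 2, by omega⟩
  rw [sum_eq_two ⟨l - 3, by omega⟩ ⟨l - 2, by omega⟩ (by simp; omega) (fun p h0 h1 => by
    simp only [ne_eq, Fin.ext_iff] at h0 h1
    rw [cartanD_eq_zero (by omega) (by simp only [ne_eq, Fin.ext_iff]; omega)
      (by simp only; omega) (by simp only; omega) (by simp only; omega)
      (by simp only; omega), mul_zero])] at c2
  have c3 := hu ⟨l - 3, by omega⟩
  rw [sum_eq_four ⟨l - 4, by omega⟩ ⟨l - 3, by omega⟩ ⟨l - 2, by omega⟩ ⟨l - 1, by omega⟩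
    (by simp; omega) (by simp; omega) (by simp; omega) (by simp; omega) (by simp; omega)
    (by simp; omega) (fun p h0 h1 h2 h3 => by
    simp only [ne_eq, Fin.ext_iff] at h0 h1 h2 h3
    rw [cartanD_eq_zero (by omega) (by simp only [ne_eq, Fin.ext_iff]; omega)
      (by simp only; omega) (by simp only; omega) (by simp only; omega)
      (by simp only; omega), mul_zero])] at c3
  have e1 : CartanMatrix.D l ⟨l - 3, by omega⟩ ⟨l - 1, by omega⟩ = -1 := by
    simp only [cartanD_apply, Fin.ext_iff]
    split_ifs <;> omega
  have e2 : CartanMatrix.D l ⟨l - 3, by omega⟩ ⟨l - 2, by omega⟩ = -1 := by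
    simp only [cartanD_apply, Fin.ext_iff]
    split_ifs <;> omega
  have e3 : CartanMatrix.D l ⟨l - 4, by omega⟩ ⟨l - 3, by omega⟩ = -1 := by
    simp only [cartanD_apply, Fin.ext_iff]
    split_ifs <;> omega
  have e4 : CartanMatrix.D l ⟨l - 2, by omega⟩ ⟨l - 3, by omega⟩ = -1 := by
    simp only [cartanD_apply, Fin.ext_iff]
    split_ifs <;> omega
  have e5 : CartanMatrix.D l ⟨l - 1, by omega⟩ ⟨l - 3, by omega⟩ = -1 := by
    simp only [cartanD_apply, Fin.ext_iff]
    split_ifs <;> omega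
  rw [CartanMatrix.D_diag, e1] at c1
  rw [CartanMatrix.D_diag, e2] at c2
  rw [CartanMatrix.D_diag, e3, e4, e5] at c3
  rw [← extendFin_of_lt u (show l - 3 < l by omega),
    ← extendFin_of_lt u (show l - 1 < l by omega)] at c1
  rw [← extendFin_of_lt u (show l - 3 < l by omega),
    ← extendFin_of_lt u (show l - 2 < l by omega)] at c2
  rw [← extendFin_of_lt u (show l - 4 < l by omega), ← extendFin_of_lt u (show l - 3 < l by omega),
    ← extendFin_of_lt u (show l - 2 < l by omega),
    ← extendFin_of_lt u (show l - 1 < l by omega)] at c3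
  have h3 := hchain (l - 3) le_rfl
  have h4 := hchain (l - 4) (by omega)
  rw [show ((l - 3 : ℕ) : ℤ) = ((l - 4 : ℕ) : ℤ) + 1 by omega] at h3
  -- Twice the relation at the branch node plus those at the two end nodes eliminates the end
  -- coefficients: `2 u_{l-3} ≡ 2 u_{l-4}`, so the doubled step `2 u_0` vanishes. The end
  -- coefficients satisfy `2 u ≡ u_{l-3}`, which is why the exponent is `4`.
  have h0 : n ∣ 2 * extendFin u 0 := by
    have := dvd_sub (dvd_sub (dvd_add (dvd_add c1 c2) (dvd_mul_of_dvd_right c3 2))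
      (dvd_mul_of_dvd_right h3 2)) (dvd_mul_of_dvd_right h4 (-2))
    refine int_dvd_of_eq this ?_
    ring
  have h34 : n ∣ 2 * extendFin u (l - 3) := by
    have := dvd_add (dvd_mul_of_dvd_right h3 2) (dvd_mul_of_dvd_right h0 ((l - 4 : ℕ) + 1 + 1))
    refine int_dvd_of_eq this ?_
    ring
  intro p
  rw [← extendFin_coe u p]
  by_cases hp : p.val = l - 1
  · rw [hp]
    refine int_dvd_of_eq (dvd_add (dvd_mul_of_dvd_right c1 2) h34) ?_
    ring
  · by_cases hp' : p.val = l - 2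
    · rw [hp']
      refine int_dvd_of_eq (dvd_add (dvd_mul_of_dvd_right c2 2) h34) ?_
      ring
    · have := dvd_add (dvd_mul_of_dvd_right (hchain p (by omega)) 4)
        (dvd_mul_of_dvd_right h0 (2 * ((p : ℤ) + 1)))
      refine int_dvd_of_eq this ?_
      ring

end Families

theorem lengthBound_E₆ : LengthBound CartanMatrix.E₆ 1 := by
  intro B hB h
  have h1 := h 0 2
  have h2 := h 1 3
  have h3 := h 2 3
  have h4 := h 3 4
  have h5 := h 4 5
  simp [CartanMatrix.E₆] at h1 h2 h3 h4 h5
  refine ⟨B 0, hB 0, fun q => ⟨1, le_rfl, le_rfl, ?_⟩⟩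
  rw [mul_one]
  fin_cases q <;> simp <;> omega

theorem lengthBound_E₇ : LengthBound CartanMatrix.E₇ 1 := by
  intro B hB h
  have h1 := h 0 2
  have h2 := h 1 3
  have h3 := h 2 3
  have h4 := h 3 4
  have h5 := h 4 5
  have h6 := h 5 6
  simp [CartanMatrix.E₇] at h1 h2 h3 h4 h5 h6
  refine ⟨B 0, hB 0, fun q => ⟨1, le_rfl, le_rfl, ?_⟩⟩
  rw [mul_one]
  fin_cases q <;> simp <;> omega

theorem lengthBound_E₈ : LengthBound CartanMatrix.E₈ 1 := by
  intro B hB h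
  have h1 := h 0 2
  have h2 := h 1 3
  have h3 := h 2 3
  have h4 := h 3 4
  have h5 := h 4 5
  have h6 := h 5 6
  have h7 := h 6 7
  simp [CartanMatrix.E₈] at h1 h2 h3 h4 h5 h6 h7
  refine ⟨B 0, hB 0, fun q => ⟨1, le_rfl, le_rfl, ?_⟩⟩
  rw [mul_one]
  fin_cases q <;> simp <;> omega

theorem lengthBound_F₄ : LengthBound CartanMatrix.F₄ 2 := by
  intro B hB h
  have h1 := h 0 1
  have h2 := h 1 2
  have h3 := h 2 3
  simp [CartanMatrix.F₄] at h1 h2 h3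
  refine ⟨B 3, hB 3, fun q => ?_⟩
  by_cases hq : q.val < 2
  · refine ⟨2, one_le_two, le_rfl, ?_⟩
    fin_cases q <;> simp at hq ⊢ <;> omega
  · refine ⟨1, le_rfl, one_le_two, ?_⟩
    fin_cases q <;> simp at hq ⊢ <;> omega

theorem lengthBound_G₂ : LengthBound CartanMatrix.G₂ 3 := by
  intro B hB h
  have h1 := h 0 1
  simp [CartanMatrix.G₂] at h1
  refine ⟨B 1, hB 1, fun q => ?_⟩
  fin_cases q
  · exact ⟨3, by norm_num, le_rfl, by simp; omega⟩
  · exact ⟨1, le_rfl, by norm_num, by simp⟩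

theorem hasOddRows_E₆ : HasOddRows CartanMatrix.E₆ := by
  simp only [HasOddRows, Int.odd_iff]
  decide

theorem hasOddRows_E₇ : HasOddRows CartanMatrix.E₇ := by
  simp only [HasOddRows, Int.odd_iff]
  decide

theorem hasOddRows_E₈ : HasOddRows CartanMatrix.E₈ := by
  simp only [HasOddRows, Int.odd_iff]
  decide

theorem hasOddRows_F₄ : HasOddRows CartanMatrix.F₄ := by
  simp only [HasOddRows, Int.odd_iff]
  decide

theorem hasOddRows_G₂ : HasOddRows CartanMatrix.G₂ := by
  simp only [HasOddRows, Int.odd_iff]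
  decide

end CartanMatrices

end

end FormalHecke

open MvPowerSeries

namespace FormalHecke

noncomputable section

/-! ### Bases adapted to one or two lattice vectors -/

section Bases

variable {M : Type*} [AddCommGroup M]

/-- The values at `α` of all functionals form an ideal, generated by some `d`. All coordinates of
`α` are multiples of `d`, and a functional attaining `d` takes the value `1` on `α / d`. -/
theorem exists_primitive [Module.Free ℤ M] [Module.Finite ℤ M] {α : M} (hα : α ≠ 0) :
    ∃ (d : ℕ) (α₀ : M) (φ : M →ₗ[ℤ] ℤ), d ≠ 0 ∧ α = d • α₀ ∧ φ α₀ = 1 := by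
  let B := Module.finBasis ℤ M
  obtain ⟨g, hg⟩ := (IsPrincipalIdealRing.principal
    (LinearMap.range (Module.Dual.eval ℤ M α))).principal
  have hmem : ∀ ψ : M →ₗ[ℤ] ℤ, ((g.natAbs : ℕ) : ℤ) ∣ ψ α := by
    intro ψ
    have : ψ α ∈ LinearMap.range (Module.Dual.eval ℤ M α) := ⟨ψ, rfl⟩
    rw [hg, Submodule.mem_span_singleton] at this
    obtain ⟨a, ha⟩ := this
    rw [Int.natAbs_dvd]
    exact ⟨a, by rw [← ha, smul_eq_mul, mul_comm]⟩
  obtain ⟨φ, hφ⟩ : ∃ φ : M →ₗ[ℤ] ℤ, φ α = (g.natAbs : ℤ) := by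
    have h1 : g ∈ LinearMap.range (Module.Dual.eval ℤ M α) := by
      rw [hg]
      exact Submodule.mem_span_singleton_self g
    have h2 : (g.natAbs : ℤ) ∈ LinearMap.range (Module.Dual.eval ℤ M α) := by
      rcases Int.natAbs_eq g with h | h
      · rwa [← h]
      · rw [← neg_mem_iff, ← h]
        exact h1
    obtain ⟨φ, hφ⟩ := h2
    exact ⟨φ, hφ⟩
  have hg0 : (g.natAbs : ℤ) ≠ 0 := by
    intro h0
    refine hα (B.ext_elem fun i => ?_)
    have := hmem (B.coord i)
    rw [h0, zero_dvd_iff] at this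
    simpa using this
  choose a ha using fun i => hmem (B.coord i)
  have hα₀ : α = g.natAbs • ∑ i, a i • B i := by
    conv_lhs => rw [← B.sum_repr α]
    rw [Finset.smul_sum]
    refine Finset.sum_congr rfl fun i _ => ?_
    have : B.repr α i = (g.natAbs : ℤ) * a i := ha i
    rw [this, mul_smul, natCast_zsmul]
  refine ⟨g.natAbs, _, φ, by exact_mod_cast hg0, hα₀, ?_⟩
  rw [hα₀, map_nsmul, nsmul_eq_mul] at hφ
  exact mul_left_cancel₀ hg0 (hφ.trans (mul_one _).symm)

/-- The decomposition `M = ℤ α₀ ⊕ ker φ`, where `φ(α₀) = 1`. -/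
def splitEquiv (φ : M →ₗ[ℤ] ℤ) {α₀ : M} (h : φ α₀ = 1) : M ≃ₗ[ℤ] ℤ × LinearMap.ker φ where
  toFun m := (φ m, ⟨m - φ m • α₀, by simp [h]⟩)
  invFun p := p.1 • α₀ + p.2
  map_add' m m' := by
    ext
    · simp
    · simp [add_smul]
      abel
  map_smul' c m := by
    ext
    · simp
    · simp [mul_smul, smul_sub]
  left_inv m := by simp
  right_inv p := by
    have hp : φ p.2 = 0 := p.2.2
    ext <;> simp [h, hp]

theorem exists_basis_eq_of_dual (φ : M →ₗ[ℤ] ℤ) {α₀ : M} (h : φ α₀ = 1) {σ : Type}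
    (b : Module.Basis σ ℤ (LinearMap.ker φ)) : ∃ B : Module.Basis (Unit ⊕ σ) ℤ M,
      B (Sum.inl ()) = α₀ ∧ ∀ i, B (Sum.inr i) = b i := by
  refine ⟨((Module.Basis.singleton Unit ℤ).prod b).map (splitEquiv φ h).symm, ?_, fun i => ?_⟩
  · rw [Module.Basis.map_apply, LinearEquiv.symm_apply_eq]
    ext <;> simp [splitEquiv, h]
  · have hi : φ (b i) = 0 := (b i).2
    rw [Module.Basis.map_apply, LinearEquiv.symm_apply_eq]
    ext <;> simp [splitEquiv, hi]

variable [Module.Free ℤ M] [Module.Finite ℤ M]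

theorem exists_basis_of_ne_zero {α : M} (hα : α ≠ 0) :
    ∃ (σ : Type) (_ : Finite σ) (B : Module.Basis σ ℤ M) (p : σ) (d : ℕ),
      d ≠ 0 ∧ α = d • B p := by
  obtain ⟨d, α₀, φ, hd, hα₀, hφ⟩ := exists_primitive hα
  obtain ⟨B, hB, -⟩ := exists_basis_eq_of_dual φ hφ (Module.finBasis ℤ (LinearMap.ker φ))
  exact ⟨_, inferInstance, B, _, d, hd, by rw [hB, hα₀]⟩

/-- Hermite normal form of two vectors: split off the primitive vector `α₀` below `α` by `M = ℤ α₀ ⊕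
ker φ`, then treat the component of `β` in `ker φ` in the same way. -/
theorem exists_basis_of_linearIndependent {α β : M} (h : LinearIndependent ℤ ![α, β]) :
    ∃ (σ : Type) (_ : Finite σ) (B : Module.Basis σ ℤ M) (p q : σ) (d : ℕ) (k : ℤ) (c : ℕ),
      p ≠ q ∧ d ≠ 0 ∧ c ≠ 0 ∧ α = d • B p ∧ β = k • B p + c • B q := by
  obtain ⟨d, α₀, φ, hd, hα₀, hφ⟩ := exists_primitive (h.ne_zero 0)
  have hβ : (splitEquiv φ hφ β).2 ≠ 0 := by
    intro h0
    have h1 : β - φ β • α₀ = 0 := congrArg Subtype.val h0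
    rw [LinearIndependent.pair_iff] at h
    have := (h (-(φ β)) d (by
      rw [show α = d • α₀ from hα₀, sub_eq_zero.1 h1]
      simp only [map_smul, hφ, smul_eq_mul, mul_one]
      rw [← natCast_zsmul, smul_smul, smul_smul, ← add_smul]
      convert zero_smul ℤ α₀
      ring)).2
    exact hd (by exact_mod_cast this)
  obtain ⟨c, μ₀, ψ, hc, hμ₀, hψ⟩ := exists_primitive hβ
  obtain ⟨b', hb', -⟩ := exists_basis_eq_of_dual ψ hψ (Module.finBasis ℤ (LinearMap.ker ψ))
  obtain ⟨B, hB, hB'⟩ := exists_basis_eq_of_dual φ hφ b'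
  refine ⟨_, inferInstance, B, Sum.inl (), Sum.inr (Sum.inl ()), d, φ β, c, by simp, hd, hc,
    by rw [hB]; exact hα₀, ?_⟩
  have h1 : β - φ β • α₀ = c • (μ₀ : M) := congrArg Subtype.val hμ₀
  rw [hB, hB', hb', ← h1]
  abel

end Bases

/-! ### Gram determinants in rank two -/

section Gram

variable {M : Type*} [AddCommGroup M]

/-- Positivity is applied to `f(v, v) u - f(u, v) v`, which is nonzero by independence. -/
theorem cauchySchwarz_lt {f : LinearMap.BilinForm ℤ M} (hsymm : ∀ u v, f u v = f v u)
    {Λ : Submodule ℤ M} (hpos : ∀ u ∈ Λ, u ≠ 0 → 0 < f u u) {u v : M} (hu : u ∈ Λ) (hv : v ∈ Λ)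
    (h : LinearIndependent ℤ ![u, v]) : f u v ^ 2 < f u u * f v v := by
  have hv0 : 0 < f v v := hpos v hv (h.ne_zero 1)
  have hw : f v v • u + (-(f u v)) • v ≠ 0 := fun h0 =>
    hv0.ne' ((LinearIndependent.pair_iff.1 h _ _ h0).1)
  have hw' := hpos _ (add_mem (Λ.smul_mem _ hu) (Λ.smul_mem _ hv)) hw
  have : f (f v v • u + (-(f u v)) • v) (f v v • u + (-(f u v)) • v) =
      f v v * (f u u * f v v - f u v ^ 2) := by
    simp only [map_add, map_smul, LinearMap.add_apply, LinearMap.smul_apply, smul_eq_mul,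
      hsymm v u]
    ring
  rw [this] at hw'
  linarith [(pos_iff_pos_of_mul_pos hw').1 hv0]

theorem sq_mod_four (b : ℤ) : b ^ 2 % 4 = 0 ∨ b ^ 2 % 4 = 1 := by
  rcases Int.emod_two_eq_zero_or_one b with h | h
  · obtain ⟨a, rfl⟩ := Int.dvd_of_emod_eq_zero h
    left
    rw [mul_pow, show (2 : ℤ) ^ 2 = 4 by norm_num]
    omega
  · obtain ⟨a, rfl⟩ : ∃ a, b = 2 * a + 1 := ⟨b / 2, by omega⟩
    right
    rw [show (2 * a + 1) ^ 2 = 4 * (a ^ 2 + a) + 1 by ring]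
    omega

/-- The Gram determinants of two pairs of vectors in an even positive definite lattice. -/
theorem exists_gram {f : LinearMap.BilinForm ℤ M} (hsymm : ∀ u v, f u v = f v u)
    {Λ : Submodule ℤ M} (hpos : ∀ u ∈ Λ, u ≠ 0 → 0 < f u u) {κ : ℤ} (hκ : 0 < κ)
    (hself : ∀ u ∈ Λ, κ ∣ f u u) (htwo : ∀ u ∈ Λ, ∀ v ∈ Λ, κ ∣ 2 * f u v)
    {α β ν : M} (hα : α ∈ Λ) (hβ : β ∈ Λ) (hν : ν ∈ Λ) {N k c : ℤ} (hN : N ≠ 0)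
    (h : N • β = k • α + c • ν) (hind : LinearIndependent ℤ ![α, β]) {m s s' : ℤ}
    (hs : f α α = κ * s) (hsm : s ≤ m) (hs' : f β β = κ * s') (hsm' : s' ≤ m) :
    ∃ G G' : ℤ, N ^ 2 * G' = c ^ 2 * G ∧ 3 ≤ G ∧ 0 < G' ∧ (G' % 4 = 0 ∨ G' % 4 = 3) ∧
      G' ≤ 4 * m ^ 2 := by
  have hindν : LinearIndependent ℤ ![α, ν] := by
    rw [LinearIndependent.pair_iff] at hind ⊢
    intro x y hxy
    have h1 := hind (c * x - k * y) (y * N) (by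
      have : (y * N) • β = y • (k • α + c • ν) := by rw [mul_smul, h]
      rw [this]
      have : c • (x • α + y • ν) = 0 := by rw [hxy, smul_zero]
      rw [← this]
      module)
    have hy : y = 0 := (mul_eq_zero.1 h1.2).resolve_right hN
    subst hy
    have hx : x • α = 0 := by simpa using hxy
    exact ⟨(hind x 0 (by simpa using hx)).1, rfl⟩
  obtain ⟨t, ht⟩ := hself ν hν
  obtain ⟨b, hb⟩ := htwo α hα ν hν
  obtain ⟨b', hb'⟩ := htwo α hα β hβ
  have key : ∀ {v : M} {t b : ℤ}, v ∈ Λ → LinearIndependent ℤ ![α, v] → f v v = κ * t →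
      2 * f α v = κ * b → 0 < 4 * s * t - b ^ 2 := by
    intro v t b hv hi ht hb
    have h1 := cauchySchwarz_lt hsymm hpos hα hv hi
    rw [ht, hs] at h1
    have h2 : 0 < κ ^ 2 * (4 * s * t - b ^ 2) := by
      have : κ ^ 2 * b ^ 2 = 4 * f α v ^ 2 := by rw [← mul_pow, ← hb]; ring
      linarith
    exact (pos_iff_pos_of_mul_pos h2).1 (by positivity)
  have hG := key hν hindν ht hb
  have hG' := key hβ hind hs' hb'
  have hs0 : 0 < s := by
    have := hpos α hα (hind.ne_zero 0)
    rw [hs] at this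
    exact (pos_iff_pos_of_mul_pos this).1 hκ
  have hs0' : 0 < s' := by
    have := hpos β hβ (hind.ne_zero 1)
    rw [hs'] at this
    exact (pos_iff_pos_of_mul_pos this).1 hκ
  -- These are the Gram determinants of the even form `2 f / κ` on `(α, ν)` and on `(α, β)`. Since
  -- `N β ≡ c ν` modulo `α`, they satisfy `N² G' = c² G`. A number `4 s t - b²` is `0` or `3` modulo
  -- `4`, so positivity improves to `G ≥ 3`.
  refine ⟨4 * s * t - b ^ 2, 4 * s * s' - b' ^ 2, ?_, ?_, hG', ?_, ?_⟩
  · have e1 : N * f α β = k * f α α + c * f α ν := by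
      have := congrArg (f α) h
      simpa using this
    have e2 : N * (N * f β β) = k * (k * f α α) + 2 * (k * (c * f α ν)) + c * (c * f ν ν) := by
      have := congrArg₂ (fun u v => f u v) h h
      simp only [map_add, map_smul, LinearMap.add_apply, LinearMap.smul_apply, smul_eq_mul,
        hsymm ν α] at this
      linarith
    have e1' : κ * (N * b') = κ * (2 * k * s + c * b) := by
      rw [hs] at e1
      linear_combination 2 * e1 - N * hb' + c * hb
    have e1'' := mul_left_cancel₀ hκ.ne' e1'
    have e2' : κ * (N ^ 2 * s') = κ * (k ^ 2 * s + k * c * b + c ^ 2 * t) := by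
      rw [hs', hs, ht] at e2
      linear_combination e2 + k * c * hb
    have e2'' := mul_left_cancel₀ hκ.ne' e2'
    linear_combination 4 * s * e2'' - (N * b' + 2 * k * s + c * b) * e1''
  · have h4 : (4 * s * t - b ^ 2) % 4 = 0 ∨ (4 * s * t - b ^ 2) % 4 = 3 := by
      rw [mul_assoc]
      rcases sq_mod_four b with h | h <;> omega
    omega
  · rw [mul_assoc]
    rcases sq_mod_four b' with h | h <;> omega
  · nlinarith [mul_le_mul hsm hsm' hs0'.le (by omega : (0 : ℤ) ≤ m)]

/-- If `c ≥ m + 1`, then `3 (m + 1)² ≤ 4 m²`, which fails for `m = 1, 2, 3`. -/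
theorem le_of_gram {c m G G' : ℤ} (hm1 : 1 ≤ m) (hm : m ≤ 3) (h : G' = c ^ 2 * G)
    (hG : 3 ≤ G) (hle : G' ≤ 4 * m ^ 2) : c ≤ m := by
  by_contra! hlt
  have h1 : (m + 1) ^ 2 * 3 ≤ c ^ 2 * G := by
    have : (m + 1) ^ 2 ≤ c ^ 2 := by
      have : m + 1 ≤ c := hlt
      gcongr
    nlinarith [sq_nonneg (m + 1)]
  have h2 : m = 1 ∨ m = 2 ∨ m = 3 := by omega
  rcases h2 with rfl | rfl | rfl <;> omega

/-- The bounds give `3 c² ≤ 64`, so `c ≤ 4`. For `c = 3` the equation `4 G' = 9 G` with `G' ≤ 16`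
leaves only `G' = 9`, which is `1` modulo `4`. -/
theorem eq_of_gram_two {c m G G' : ℤ} (hc : 0 < c) (hm1 : 1 ≤ m) (hm : m ≤ 2)
    (h : 2 ^ 2 * G' = c ^ 2 * G) (hG : 3 ≤ G) (hG0 : 0 < G') (hmod : G' % 4 = 0 ∨ G' % 4 = 3)
    (hle : G' ≤ 4 * m ^ 2) : c = 1 ∨ c = 2 ∨ c = 4 := by
  have hle' : G' ≤ 16 := by nlinarith
  have hc4 : c ≤ 4 := by
    by_contra! hlt
    have : 5 ^ 2 ≤ c ^ 2 := by
      have : 5 ≤ c := hlt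
      gcongr
    nlinarith
  have h3 : c ≠ 3 := by
    rintro rfl
    omega
  omega

end Gram

end

end FormalHecke

open MvPowerSeries

namespace FormalHecke

noncomputable section

variable {R : Type*} [CommRing R]

/-! ### Irreducible summands of the root datum -/

section Components

variable {ι M N : Type*} [Fintype ι] [AddCommGroup M] [Module.Free ℤ M] [AddCommGroup N] {P : RootPairing ι ℤ M N}

variable (P) in
/-- A decomposition of the lattice of a root datum as a direct sum such that each root lies in one
of the summands. -/
structure IsDecomposition {k : ℕ} (L : Fin k → Submodule ℤ M) : Prop where
  isInternal : DirectSum.IsInternal L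
  exists_mem (i : ι) : ∃ j, P.root i ∈ L j

namespace IsDecomposition

variable {k : ℕ} {L : Fin k → Submodule ℤ M}

theorem eq_zero_of_mem (hL : IsDecomposition P L) {a : Fin k} {x : M} (h : x ∈ L a) (h' : x ∈ ⨆ c, ⨆ (_ : c ≠ a), L c) :
    x = 0 :=
  Submodule.disjoint_def.1 (hL.isInternal.submodule_iSupIndep a) x h h'

theorem le_iSup_ne {a c : Fin k} (h : c ≠ a) : L c ≤ ⨆ c, ⨆ (_ : c ≠ a), L c :=
  le_iSup₂_of_le c h le_rfl

/-- The reflected root `α_i - ⟨α_i, α_j^∨⟩ α_j` lies in a single summand. If this is `L a`, the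
multiple of `α_j` lies in `L a` and so vanishes; otherwise `α_i` would lie in the complement of `L
a`. -/
theorem pairing_eq_zero (hL : IsDecomposition P L) {i j : ι} {a c : Fin k} (hi : P.root i ∈ L a) (hj : P.root j ∈ L c)
    (h : a ≠ c) : P.pairing i j = 0 := by
  have hk := P.root_reflectionPerm j i
  rw [P.reflection_apply_root] at hk
  obtain ⟨e, he⟩ := hL.exists_mem (P.reflectionPerm j i)
  rw [hk] at he
  by_cases hea : e = a
  · subst hea
    have h1 : P.pairing i j • P.root j ∈ L e := by
      have := sub_mem hi he
      rwa [sub_sub_cancel] at this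
    have h2 := hL.eq_zero_of_mem h1 (le_iSup_ne h.symm ((L c).smul_mem _ hj))
    exact (smul_eq_zero.1 h2).resolve_right (P.ne_zero j)
  · have h1 : P.root i ∈ ⨆ c, ⨆ (_ : c ≠ a), L c := by
      have := add_mem (le_iSup_ne hea he) (le_iSup_ne h.symm ((L c).smul_mem (P.pairing i j) hj))
      rwa [sub_add_cancel] at this
    exact absurd (hL.eq_zero_of_mem hi h1) (P.ne_zero i)

theorem root_reflectionPerm_mem (hL : IsDecomposition P L) {i : ι} {a : Fin k} (hi : P.root i ∈ L a) (j : ι) :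
    P.root (P.reflectionPerm j i) ∈ L a := by
  rw [P.root_reflectionPerm, P.reflection_apply_root]
  obtain ⟨c, hc⟩ := hL.exists_mem j
  by_cases h : a = c
  · subst h
    exact sub_mem hi ((L a).smul_mem _ hc)
  · rw [hL.pairing_eq_zero hi hc h, zero_smul, sub_zero]
    exact hi

variable [P.IsReduced] (b : P.Base)

/-- Each root in a component is conjugate to a simple root in this component. -/
theorem exists_simple (hL : IsDecomposition P L) (i : ι) : ∀ a, P.root i ∈ L a → ∃ q ∈ b.support, P.root q ∈ L a ∧
    P.RootForm (P.root i) (P.root i) = P.RootForm (P.root q) (P.root q) ∧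
    ((∃ j, Odd (P.pairing q j)) → ∃ j, Odd (P.pairing i j)) := by
  -- Component, squared length and the existence of an odd pairing are unchanged by reflections, and
  -- reflections produce all roots from the simple ones.
  have hrefl : ∀ i j, (∀ a, P.root i ∈ L a → ∃ q ∈ b.support, P.root q ∈ L a ∧
      P.RootForm (P.root i) (P.root i) = P.RootForm (P.root q) (P.root q) ∧
      ((∃ j, Odd (P.pairing q j)) → ∃ j, Odd (P.pairing i j))) →
      ∀ a, P.root (P.reflectionPerm j i) ∈ L a → ∃ q ∈ b.support, P.root q ∈ L a ∧
      P.RootForm (P.root (P.reflectionPerm j i)) (P.root (P.reflectionPerm j i)) =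
        P.RootForm (P.root q) (P.root q) ∧
      ((∃ j, Odd (P.pairing q j)) → ∃ e, Odd (P.pairing (P.reflectionPerm j i) e)) := by
    intro i j ih a ha
    have hi := hL.root_reflectionPerm_mem ha j
    rw [P.reflectionPerm_self] at hi
    obtain ⟨q, hq, hqa, hB, hodd⟩ := ih a hi
    refine ⟨q, hq, hqa, ?_, fun h => ?_⟩
    · rw [P.root_reflectionPerm, P.rootForm_reflection_reflection_apply, hB]
    · obtain ⟨e, he⟩ := hodd h
      refine ⟨P.reflectionPerm j e, ?_⟩
      rwa [P.pairing_reflectionPerm, P.reflectionPerm_self]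
  induction i using b.induction_reflect with
  | h₀ i ih => exact hrefl i i ih
  | h₁ i hi => exact fun a ha => ⟨i, hi, ha, rfl, id⟩
  | h₂ i j ih hj => exact hrefl i j ih

theorem root_mem_span_simple (hL : IsDecomposition P L) (i : ι) : ∀ a, P.root i ∈ L a →
    P.root i ∈ Submodule.span ℤ (P.root '' {q | q ∈ b.support ∧ P.root q ∈ L a}) := by
  induction i using b.induction_reflect with
  | h₀ i ih =>
    intro a ha
    have hi := hL.root_reflectionPerm_mem ha i
    rw [P.reflectionPerm_self] at hi
    rw [P.root_reflectionPerm, P.reflection_apply_self]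
    exact neg_mem (ih a hi)
  | h₁ i hi => exact fun a ha => Submodule.subset_span ⟨i, ⟨hi, ha⟩, rfl⟩
  | h₂ i j ih hj =>
    intro a ha
    have hi := hL.root_reflectionPerm_mem ha j
    rw [P.reflectionPerm_self] at hi
    rw [P.root_reflectionPerm, P.reflection_apply_root]
    obtain ⟨c, hc⟩ := hL.exists_mem j
    by_cases h : a = c
    · subst h
      exact sub_mem (ih a hi) (Submodule.smul_mem _ _ (Submodule.subset_span ⟨j, ⟨hj, hc⟩, rfl⟩))
    · rw [hL.pairing_eq_zero hi hc h, zero_smul, sub_zero]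
      exact ih a hi

theorem mem_rootLattice (hL : IsDecomposition P L) {a : Fin k} {x : M} (hx : x ∈ P.rootSpan ℤ) (hxa : x ∈ L a) :
    x ∈ rootLattice P (L a) := by
  have h : P.rootSpan ℤ ≤ rootLattice P (L a) ⊔ ⨆ c, ⨆ (_ : c ≠ a), L c := by
    rw [RootPairing.rootSpan, Submodule.span_le]
    rintro _ ⟨i, rfl⟩
    obtain ⟨c, hc⟩ := hL.exists_mem i
    by_cases h : c = a
    · subst h
      exact Submodule.mem_sup_left (Submodule.subset_span ⟨hc, i, rfl⟩)
    · exact Submodule.mem_sup_right (le_iSup_ne h hc)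
  obtain ⟨y, hy, z, hz, rfl⟩ := Submodule.mem_sup.1 (h hx)
  have hya : y ∈ L a := by
    have hle : rootLattice P (L a) ≤ L a := Submodule.span_le.2 fun m hm => hm.1
    exact hle hy
  have hza : z ∈ L a := by
    have := sub_mem hxa hya
    rwa [add_sub_cancel_left] at this
  rw [hL.eq_zero_of_mem hza hz, add_zero]
  exact hy

theorem rootLattice_le_rootSpan (a : Fin k) : rootLattice P (L a) ≤ P.rootSpan ℤ :=
  Submodule.span_mono fun _ hm => hm.2

theorem root_mem_rootLattice {a : Fin k} {i : ι} (hi : P.root i ∈ L a) :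
    P.root i ∈ rootLattice P (L a) :=
  Submodule.subset_span ⟨hi, i, rfl⟩

theorem exists_eq_sum (hL : IsDecomposition P L) {a : Fin k} {r : ℕ} (e : Fin r ≃ {i : ι // i ∈ b.support ∧ P.root i ∈ L a})
    {x : M} (hx : x ∈ rootLattice P (L a)) : ∃ u : Fin r → ℤ, x = ∑ p, u p • P.root (e p) := by
  have hle : rootLattice P (L a) ≤ Submodule.span ℤ (Set.range fun p => P.root (e p)) := by
    rw [rootLattice, Submodule.span_le]
    rintro _ ⟨ha, i, rfl⟩
    refine Submodule.span_mono ?_ (hL.root_mem_span_simple b i a ha)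
    rintro _ ⟨q, hq, rfl⟩
    exact ⟨e.symm ⟨q, hq⟩, by simp⟩
  obtain ⟨u, hu⟩ := (Submodule.mem_span_range_iff_exists_fun ℤ).1 (hle hx)
  exact ⟨u, hu.symm⟩

/-- By semisimplicity `n v = ∑ u_p α_p` for some `n ≠ 0`. Pairing with the simple coroots shows that
`n` divides `u C`, hence `N u`, and `n` can be cancelled in the free module `M`. -/
theorem smul_mem_rootLattice (hL : IsDecomposition P L) (hss : IsSemisimpleDatum P) {a : Fin k} {r : ℕ}
    {C : Matrix (Fin r) (Fin r) ℤ} (e : Fin r ≃ {i : ι // i ∈ b.support ∧ P.root i ∈ L a})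
    (he : ∀ p q, P.pairing (e p) (e q) = C p q) {N : ℤ} (hC : KillsCokernel C N) {v : M}
    (hv : v ∈ L a) : N • v ∈ rootLattice P (L a) := by
  obtain ⟨n, hn, hnv⟩ := hss v
  obtain ⟨u, hu⟩ := hL.exists_eq_sum b e (hL.mem_rootLattice hnv ((L a).nsmul_mem hv n))
  have hdvd := hC u n fun q => ⟨P.coroot' (e q) v, by
    have := congrArg (P.coroot' (e q)) hu
    simp only [map_nsmul, map_sum, map_smul, RootPairing.root_coroot'_eq_pairing, he,
      nsmul_eq_mul, smul_eq_mul] at this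
    exact this.symm⟩
  choose w hw using hdvd
  have : n • (N • v) = n • ∑ p, w p • P.root (e p) := by
    rw [smul_comm, hu, Finset.smul_sum, Finset.smul_sum]
    refine Finset.sum_congr rfl fun p _ => ?_
    rw [smul_smul, hw, mul_smul, natCast_zsmul]
  rw [← natCast_zsmul, ← natCast_zsmul] at this
  rw [smul_right_injective M (show (n : ℤ) ≠ 0 by exact_mod_cast hn) this]
  exact sum_mem fun p _ => Submodule.smul_mem _ _ (root_mem_rootLattice (e p).2.2)

/-- The canonical form on the root lattice of a component is a multiple of an even form for which
the squared lengths of the roots are bounded by `2 m`. -/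
theorem exists_length (hL : IsDecomposition P L) {a : Fin k} {r : ℕ} {C : Matrix (Fin r) (Fin r) ℤ}
    (e : Fin r ≃ {i : ι // i ∈ b.support ∧ P.root i ∈ L a})
    (he : ∀ p q, P.pairing (e p) (e q) = C p q) {m : ℤ} (hC : LengthBound C m) :
    ∃ κ, 0 < κ ∧ (∀ u ∈ rootLattice P (L a), κ ∣ P.RootForm u u) ∧
      (∀ u ∈ rootLattice P (L a), ∀ v ∈ rootLattice P (L a), κ ∣ 2 * P.RootForm u v) ∧
      ∀ i, P.root i ∈ L a → ∃ s, 1 ≤ s ∧ s ≤ m ∧ P.RootForm (P.root i) (P.root i) = κ * s := by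
  have hroot : ∀ i, P.root i ∈ P.rootSpan ℤ := fun i => Submodule.subset_span ⟨i, rfl⟩
  have htwo : ∀ i j, 2 * P.RootForm (P.root i) (P.root j) =
      P.pairing i j * P.RootForm (P.root j) (P.root j) :=
    fun i j => (P.posRootForm ℤ).two_mul_apply_root_root i j
  have hsymm : ∀ u v, P.RootForm u v = P.RootForm v u := fun u v => P.rootForm_symmetric.eq u v
  obtain ⟨κ, hκ, hs⟩ := hC (fun q => P.RootForm (P.root (e q)) (P.root (e q)))
    (fun q => P.rootForm_pos_of_ne_zero (hroot _) (P.ne_zero _)) (fun p q => by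
      rw [← he, ← he, ← htwo, ← htwo, hsymm])
  have hlen : ∀ i, P.root i ∈ L a →
      ∃ s, 1 ≤ s ∧ s ≤ m ∧ P.RootForm (P.root i) (P.root i) = κ * s := by
    intro i hi
    obtain ⟨q, hq, hqa, hB, -⟩ := hL.exists_simple b i a hi
    obtain ⟨s, h1, h2, h3⟩ := hs (e.symm ⟨q, hq, hqa⟩)
    refine ⟨s, h1, h2, ?_⟩
    rw [hB, ← h3]
    simp
  have h2 : ∀ u ∈ rootLattice P (L a), ∀ v ∈ rootLattice P (L a), κ ∣ 2 * P.RootForm u v := by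
    intro u hu v hv
    induction hu, hv using Submodule.span_induction₂ with
    | mem_mem x y hx hy =>
      obtain ⟨i, rfl⟩ := hx.2
      obtain ⟨j, rfl⟩ := hy.2
      obtain ⟨s, -, -, h⟩ := hlen j hy.1
      rw [htwo, h]
      exact ⟨P.pairing i j * s, by ring⟩
    | zero_left y hy => simp
    | zero_right x hx => simp
    | add_left x y z hx hy hz h1 h2 =>
      rw [map_add, LinearMap.add_apply, mul_add]
      exact dvd_add h1 h2
    | add_right x y z hx hy hz h1 h2 =>
      rw [map_add, mul_add]
      exact dvd_add h1 h2
    | smul_left r x y hx hy h =>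
      rw [map_smul, LinearMap.smul_apply, smul_eq_mul, mul_left_comm]
      exact dvd_mul_of_dvd_right h _
    | smul_right r x y hx hy h =>
      rw [map_smul, smul_eq_mul, mul_left_comm]
      exact dvd_mul_of_dvd_right h _
  refine ⟨κ, hκ, fun u hu => ?_, h2, hlen⟩
  induction hu using Submodule.span_induction with
  | mem x hx =>
    obtain ⟨i, rfl⟩ := hx.2
    obtain ⟨s, -, -, h⟩ := hlen i hx.1
    exact ⟨s, h⟩
  | zero => simp
  | add x y hx hy h1 h2' =>
    have h3 := h2 x hx y hy
    have : P.RootForm (x + y) (x + y) =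
        P.RootForm x x + P.RootForm y y + 2 * P.RootForm x y := by
      simp only [map_add, LinearMap.add_apply, hsymm y x]
      ring
    rw [this]
    exact dvd_add (dvd_add h1 h2') h3
  | smul r x hx h =>
    rw [map_smul, map_smul, LinearMap.smul_apply, smul_eq_mul, smul_eq_mul]
    exact dvd_mul_of_dvd_right (dvd_mul_of_dvd_right h _) _

/-- Pairing with the coroot of the root itself gives `2 = d ⟨v, α^∨⟩`. -/
theorem _root_.FormalHecke.dvd_two_of_root_eq {i : ι} {d : ℕ} {v : M} (h : P.root i = d • v) :
    d ∣ 2 := by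
  have h1 := congrArg (P.coroot' i) h
  rw [RootPairing.root_coroot'_eq_pairing, RootPairing.pairing_same, map_nsmul,
    nsmul_eq_mul] at h1
  exact Int.natCast_dvd_natCast.1 ⟨_, h1⟩

/-- `d` divides `2` and all pairings of the root with coroots, one of which is odd. -/
theorem eq_one_of_hasOddRows (hL : IsDecomposition P L) {a : Fin k} {r : ℕ} {C : Matrix (Fin r) (Fin r) ℤ}
    (e : Fin r ≃ {i : ι // i ∈ b.support ∧ P.root i ∈ L a})
    (he : ∀ p q, P.pairing (e p) (e q) = C p q) (hC : HasOddRows C) {i : ι}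
    (hi : P.root i ∈ L a) {d : ℕ} {v : M} (h : P.root i = d • v) : d = 1 := by
  obtain ⟨q, hq, hqa, -, hodd⟩ := hL.exists_simple b i a hi
  obtain ⟨p, hp⟩ := hC (e.symm ⟨q, hq, hqa⟩)
  rw [← he] at hp
  obtain ⟨j, hj⟩ := hodd ⟨e p, by simpa using hp⟩
  have h1 := congrArg (P.coroot' j) h
  rw [RootPairing.root_coroot'_eq_pairing, map_nsmul, nsmul_eq_mul] at h1
  have h2 : d ≠ 2 := by
    rintro rfl
    rw [h1] at hj
    exact Int.not_odd_iff_even.2 (even_two_mul _) hj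
  have h3 := Nat.le_of_dvd two_pos (dvd_two_of_root_eq h)
  have h4 : d ≠ 0 := by
    rintro rfl
    exact absurd (dvd_two_of_root_eq h) (by decide)
  omega

/-- For `d = 2` the normalized squared length of the root would be a multiple of `4`, but it lies
between `1` and `3`. -/
theorem eq_one_of_adjoint (hL : IsDecomposition P L) {a : Fin k} {r : ℕ} {C : Matrix (Fin r) (Fin r) ℤ}
    (e : Fin r ≃ {i : ι // i ∈ b.support ∧ P.root i ∈ L a})
    (he : ∀ p q, P.pairing (e p) (e q) = C p q) {m : ℤ} (hC : LengthBound C m) (hm : m ≤ 3)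
    {i : ι} (hi : P.root i ∈ L a) {d : ℕ} {v : M} (h : P.root i = d • v)
    (hv : v ∈ rootLattice P (L a)) : d = 1 := by
  obtain ⟨κ, hκ, hself, -, hlen⟩ := hL.exists_length b e he hC
  obtain ⟨t, ht⟩ := hself v hv
  obtain ⟨s, h1, h2, h3⟩ := hlen i hi
  rw [h, ← natCast_zsmul, map_smul, map_smul, LinearMap.smul_apply, smul_eq_mul, smul_eq_mul,
    ht] at h3
  have h4 : (d : ℤ) * (d * t) = s := by
    refine mul_left_cancel₀ hκ.ne' ?_
    rw [← h3]
    ring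
  have h5 := dvd_two_of_root_eq h
  rcases (Nat.dvd_prime Nat.prime_two).1 h5 with rfl | rfl
  · rfl
  · push_cast at h4
    omega

theorem mem_of_nsmul_mem (hL : IsDecomposition P L) {a : Fin k} {n : ℕ} (hn : n ≠ 0) {v : M}
    (h : n • v ∈ L a) : v ∈ L a := by
  have htop : v ∈ L a ⊔ ⨆ c, ⨆ (_ : c ≠ a), L c := by
    have : L a ⊔ ⨆ c, ⨆ (_ : c ≠ a), L c = ⊤ := by
      rw [eq_top_iff, ← hL.isInternal.submodule_iSup_eq_top]
      refine iSup_le fun c => ?_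
      by_cases hc : c = a
      · rw [hc]
        exact le_sup_left
      · exact (le_iSup_ne hc).trans le_sup_right
    rw [this]
    exact Submodule.mem_top
  obtain ⟨y, hy, z, hz, rfl⟩ := Submodule.mem_sup.1 htop
  have h1 : n • z ∈ L a := by
    have := sub_mem h ((L a).nsmul_mem hy n)
    rwa [smul_add, add_sub_cancel_left] at this
  have h2 : (n : ℤ) • z = 0 := by
    rw [natCast_zsmul]
    exact hL.eq_zero_of_mem h1 (Submodule.smul_of_tower_mem _ n hz)
  rw [(smul_eq_zero.1 h2).resolve_left (by exact_mod_cast hn), add_zero]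
  exact hy

/-- The relation between the Gram determinants of `α_i, α_j` and of `α_i, ν` if
`n • α_j = l • α_i + c • ν`, where `α_i` and `α_j` are independent roots in one component. -/
theorem gram (hL : IsDecomposition P L) {a : Fin k} {r : ℕ}
    {C : Matrix (Fin r) (Fin r) ℤ}
    (e : Fin r ≃ {i : ι // i ∈ b.support ∧ P.root i ∈ L a})
    (he : ∀ p q, P.pairing (e p) (e q) = C p q) {m : ℤ} (hC : LengthBound C m)
    {i j : ι} (hi : P.root i ∈ L a) (hj : P.root j ∈ L a)
    (hind : LinearIndependent ℤ ![P.root i, P.root j]) {ν : M} (hν : ν ∈ rootLattice P (L a))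
    {n l c : ℤ} (hn : n ≠ 0) (h : n • P.root j = l • P.root i + c • ν) :
    ∃ G G' : ℤ, n ^ 2 * G' = c ^ 2 * G ∧ 3 ≤ G ∧ 0 < G' ∧ (G' % 4 = 0 ∨ G' % 4 = 3) ∧
      G' ≤ 4 * m ^ 2 := by
  obtain ⟨κ, hκ, hself, htwo, hlen⟩ := hL.exists_length b e he hC
  obtain ⟨s, -, hs, hs'⟩ := hlen i hi
  obtain ⟨t, -, ht, ht'⟩ := hlen j hj
  exact exists_gram (fun u v => P.rootForm_symmetric.eq u v)
    (fun u hu h0 => P.rootForm_pos_of_ne_zero (rootLattice_le_rootSpan a hu) h0) hκ hself htwo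
    (root_mem_rootLattice hi) (root_mem_rootLattice hj) hν hn h hind hs' hs ht' ht

end IsDecomposition

end Components

end

end FormalHecke

open MvPowerSeries

namespace FormalHecke

noncomputable section

variable {R : Type*} [CommRing R]

theorem isRegular_natCast_of_dvd {c n : ℕ} (h : c ∣ n) (hn : IsRegular (n : R)) :
    IsRegular (c : R) := by
  obtain ⟨e, rfl⟩ := h
  rw [isRegular_iff_mem_nonZeroDivisors] at hn ⊢
  rw [Nat.cast_mul] at hn
  exact (mul_mem_nonZeroDivisors.1 hn).1

/-! ### From the type conditions to regularity -/

section Components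

variable (F : FormalGroup R) {ι M N : Type*} [Fintype ι] [AddCommGroup M] [Module.Free ℤ M]
  [AddCommGroup N] (P : RootPairing ι ℤ M N)

/-- The arithmetic conditions on the roots lying in the summand `L` that are needed for the
regularity of the corresponding elements of the formal group algebra. -/
structure ComponentRegular (L : Submodule ℤ M) : Prop where
  isUnit : ∀ i, P.root i ∈ L → ∀ (d : ℕ) (v : M), P.root i = d • v → IsUnit (d : R)
  isRegular : ∀ i j, P.root i ∈ L → P.root j ∈ L → LinearIndependent ℤ ![P.root i, P.root j] →
    ∀ (d : ℕ) (k : ℤ) (c : ℕ) (u v : M), d ≠ 0 → c ≠ 0 → P.root i = d • u →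
      P.root j = k • u + c • v → IsRegular (formalInt F c)

variable {P} [P.IsReduced] {k : ℕ} {L : Fin k → Submodule ℤ M} (hL : IsDecomposition P L)
  (b : P.Base) {a : Fin k} {r : ℕ} {C : Matrix (Fin r) (Fin r) ℤ}
  (e : Fin r ≃ {i : ι // i ∈ b.support ∧ P.root i ∈ L a})
  (he : ∀ p q, P.pairing (e p) (e q) = C p q) {m : ℤ} (hC : LengthBound C m)

-- With `g = gcd(c, n)`, Bézout puts `g v` in the root lattice. The Gram estimate for `α_j = k α_i +
-- c' (g v)` then bounds `c'` by `m`.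
include hL he hC in
theorem IsDecomposition.exists_eq_mul {n : ℕ} (hn : ∀ v ∈ L a, n • v ∈ rootLattice P (L a))
    (hm1 : 1 ≤ m) (hm : m ≤ 3) {i j : ι} (hi : P.root i ∈ L a) (hj : P.root j ∈ L a)
    (hind : LinearIndependent ℤ ![P.root i, P.root j]) {k : ℤ} {c : ℕ} {v : M} (hc : c ≠ 0)
    (h : P.root j = k • P.root i + c • v) : ∃ g c' : ℕ, c = g * c' ∧ g ∣ n ∧ (c' : ℤ) ≤ m := by
  have hcv : c • v = P.root j - k • P.root i := by rw [h]; abel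
  have hv : v ∈ L a := hL.mem_of_nsmul_mem hc (by
    rw [hcv]
    exact sub_mem hj ((L a).smul_mem _ hi))
  have hcr : c • v ∈ rootLattice P (L a) := by
    rw [hcv]
    exact sub_mem (IsDecomposition.root_mem_rootLattice hj)
      (Submodule.smul_mem _ _ (IsDecomposition.root_mem_rootLattice hi))
  obtain ⟨c', hc'⟩ := Nat.gcd_dvd_left c n
  have hg : c.gcd n • v ∈ rootLattice P (L a) := by
    have : c.gcd n • v = c.gcdA n • (c • v) + c.gcdB n • (n • v) := by
      rw [← natCast_zsmul, Nat.gcd_eq_gcd_ab, ← natCast_zsmul, ← natCast_zsmul, smul_smul,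
        smul_smul, ← add_smul]
      congr 1
      ring
    rw [this]
    exact add_mem (Submodule.smul_mem _ _ hcr) (Submodule.smul_mem _ _ (hn v hv))
  obtain ⟨G, G', h1, h2, -, -, h3⟩ := hL.gram b e he hC hi hj hind hg (n := 1) (l := k) (c := c')
    one_ne_zero (by
      rw [one_smul, natCast_zsmul, smul_smul, mul_comm c', ← hc']
      exact h)
  refine ⟨_, c', hc', Nat.gcd_dvd_right c n, le_of_gram hm1 hm ?_ h2 h3⟩
  rw [← h1, one_pow, one_mul]

-- Here `α_i` may be divisible by `2` in the lattice, so the relation is doubled: `2 α_j = k d' α_i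
-- + c (2 v)` with `d d' = 2`, and all its vectors lie in the root lattice.
include hL he hC in
theorem IsDecomposition.eq_of_two (hn : ∀ v ∈ L a, 2 • v ∈ rootLattice P (L a))
    (hm1 : 1 ≤ m) (hm : m ≤ 2) {i j : ι} (hi : P.root i ∈ L a) (hj : P.root j ∈ L a)
    (hind : LinearIndependent ℤ ![P.root i, P.root j]) {d : ℕ} {k : ℤ} {c : ℕ} {u v : M}
    (hd : d ≠ 0) (hc : c ≠ 0) (hu : P.root i = d • u) (h : P.root j = k • u + c • v) :
    c = 1 ∨ c = 2 ∨ c = 4 := by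
  have hua : u ∈ L a := hL.mem_of_nsmul_mem hd (hu ▸ hi)
  have hcv : c • v = P.root j - k • u := by rw [h]; abel
  have hv : v ∈ L a := hL.mem_of_nsmul_mem hc (by
    rw [hcv]
    exact sub_mem hj ((L a).smul_mem _ hua))
  obtain ⟨d', hd'⟩ := dvd_two_of_root_eq hu
  have hd'2 : (2 : ℤ) = d * d' := by exact_mod_cast hd'
  obtain ⟨G, G', h1, h2, h3, h4, h5⟩ := hL.gram b e he hC hi hj hind (hn v hv) (n := 2)
    (l := k * d') (c := c) two_ne_zero (by
      rw [h, hu, ← natCast_zsmul u d, ← natCast_zsmul v c, ← natCast_zsmul v 2, smul_smul,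
        smul_add, smul_smul, smul_smul, smul_smul]
      congr 2
      · rw [hd'2]
        ring
      · push_cast
        ring)
  have := eq_of_gram_two (by exact_mod_cast Nat.pos_of_ne_zero hc) hm1 hm h1 h2 h3 h4 h5
  omega

-- Taking `n = 1` in `exists_eq_mul` forces `g = 1`, so `c ≤ m`.
include hL he hC in
theorem IsDecomposition.componentRegular_of_mem (hm1 : 1 ≤ m) (hm : m ≤ 3)
    (hd : ∀ i, P.root i ∈ L a → ∀ (d : ℕ) (v : M), P.root i = d • v → d = 1)
    (hmem : ∀ v ∈ L a, v ∈ rootLattice P (L a))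
    (hreg : ∀ c : ℕ, 1 ≤ c → (c : ℤ) ≤ m → IsRegular (formalInt F c)) :
    ComponentRegular F P (L a) where
  isUnit i hi d v h := by
    rw [hd i hi d v h, Nat.cast_one]
    exact isUnit_one
  isRegular i j hi hj hind d k c u v _ hc hu h := by
    have hd1 := hd i hi d u hu
    rw [hd1, one_smul] at hu
    rw [← hu] at h
    obtain ⟨g, c', h1, h2, h3⟩ := hL.exists_eq_mul b e he hC (n := 1)
      (fun v hv => by rw [one_smul]; exact hmem v hv) hm1 hm hi hj hind hc h
    rw [Nat.dvd_one.1 h2, one_mul] at h1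
    exact hreg c (Nat.pos_of_ne_zero hc) (h1 ▸ h3)

-- When all roots have equal length, `m = 1` forces `c' = 1`. Thus `c` divides `n` and inherits its
-- regularity.
include hL he in
theorem IsDecomposition.componentRegular_of_isRegular (hC : LengthBound C 1)
    (hd : ∀ i, P.root i ∈ L a → ∀ (d : ℕ) (v : M), P.root i = d • v → d = 1) {n : ℕ}
    (hmem : ∀ v ∈ L a, n • v ∈ rootLattice P (L a)) (hreg : IsRegular (n : R)) :
    ComponentRegular F P (L a) where
  isUnit i hi d v h := by
    rw [hd i hi d v h, Nat.cast_one]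
    exact isUnit_one
  isRegular i j hi hj hind d k c u v _ hc hu h := by
    have hd1 := hd i hi d u hu
    rw [hd1, one_smul] at hu
    rw [← hu] at h
    obtain ⟨g, c', h1, h2, h3⟩ := hL.exists_eq_mul b e he hC hmem le_rfl (by norm_num) hi hj hind
      hc h
    have hc' : c' = 1 := by
      have : c' ≠ 0 := by
        rintro rfl
        exact hc h1
      omega
    rw [hc', mul_one] at h1
    exact isRegular_formalInt F (isRegular_natCast_of_dvd (h1 ▸ h2) hreg)

-- By `eq_of_two` the index `c` divides `4`, which is regular together with `2`.
include hL he hC in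
theorem IsDecomposition.componentRegular_of_two (hm1 : 1 ≤ m) (hm : m ≤ 2)
    (hd : ∀ i, P.root i ∈ L a → ∀ (d : ℕ) (v : M), P.root i = d • v → IsUnit (d : R))
    (hmem : ∀ v ∈ L a, 2 • v ∈ rootLattice P (L a)) (hreg : IsRegular (2 : R)) :
    ComponentRegular F P (L a) where
  isUnit := hd
  isRegular i j hi hj hind d k c u v hd0 hc hu h := by
    have h4 : IsRegular ((4 : ℕ) : R) := by
      have := hreg.mul hreg
      norm_num at this ⊢
      exact this
    refine isRegular_formalInt F (isRegular_natCast_of_dvd ?_ h4)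
    rcases hL.eq_of_two b e he hC hmem hm1 hm hi hj hind hd0 hc hu h with rfl | rfl | rfl <;>
      decide

theorem isUnit_of_root_eq (h2 : IsUnit (2 : R)) {i : ι} {d : ℕ} {v : M} (h : P.root i = d • v) :
    IsUnit (d : R) := by
  obtain ⟨e, he⟩ := dvd_two_of_root_eq h
  have : IsUnit ((d : R) * e) := by
    rw [← Nat.cast_mul, ← he]
    exact_mod_cast h2
  exact isUnit_of_mul_isUnit_left this

include hL in
theorem IsDecomposition.componentRegular (hss : IsSemisimpleDatum P) {t : DynkinType}
    (ht : HasType b (L a) t) (hF : TypeCondition F (L a) (rootLattice P (L a)) t) :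
    ComponentRegular F P (L a) := by
  obtain ⟨hproper, e, he⟩ := ht
  -- adjoint components
  have hadj : ∀ m : ℤ, LengthBound t.cartan m → 1 ≤ m → m ≤ 3 → L a = rootLattice P (L a) →
      (∀ c : ℕ, 1 ≤ c → (c : ℤ) ≤ m → IsRegular (formalInt F c)) →
      ComponentRegular F P (L a) := by
    intro m hC hm1 hm h hreg
    refine hL.componentRegular_of_mem F b e he hC hm1 hm (fun i hi d v hv => ?_)
      (fun v hv => h ▸ hv) hreg
    have hd0 : d ≠ 0 := by
      rintro rfl
      exact P.ne_zero i (by simpa using hv)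
    exact hL.eq_one_of_adjoint b e he hC hm hi hv (h ▸ hL.mem_of_nsmul_mem hd0 (hv ▸ hi))
  have hreg1 : ∀ c : ℕ, 1 ≤ c → (c : ℤ) ≤ 1 → IsRegular (formalInt F c) := by
    intro c h1 h2
    obtain rfl : c = 1 := by omega
    exact isRegular_formalInt_one F
  have hreg2 : IsRegular (formalInt F 2) →
      ∀ c : ℕ, 1 ≤ c → (c : ℤ) ≤ 2 → IsRegular (formalInt F c) := by
    intro h c h1 h2
    obtain rfl | rfl : c = 1 ∨ c = 2 := by omega
    · exact isRegular_formalInt_one F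
    · exact h
  have hkill : ∀ n : ℕ, KillsCokernel t.cartan n → ∀ v ∈ L a, n • v ∈ rootLattice P (L a) := by
    intro n hn v hv
    rw [← natCast_zsmul]
    exact hL.smul_mem_rootLattice b hss e he hn hv
  have hodd : HasOddRows t.cartan →
      ∀ i, P.root i ∈ L a → ∀ (d : ℕ) (v : M), P.root i = d • v → d = 1 :=
    fun h i hi d v hv => hL.eq_one_of_hasOddRows b e he h hi hv
  -- For `E₈`, `F₄` and `G₂` the Cartan determinant is one, so the lattice is contained in its root
  -- lattice and the argument for adjoint components applies.
  have hone : ∀ m : ℤ, LengthBound t.cartan m → 1 ≤ m → m ≤ 3 → HasOddRows t.cartan →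
      KillsCokernel t.cartan 1 → (∀ c : ℕ, 1 ≤ c → (c : ℤ) ≤ m → IsRegular (formalInt F c)) →
      ComponentRegular F P (L a) := by
    intro m hC hm1 hm ho hk hreg
    refine hL.componentRegular_of_mem F b e he hC hm1 hm (hodd ho) (fun v hv => ?_) hreg
    have := hkill 1 (by exact_mod_cast hk) v hv
    rwa [one_smul] at this
  have htwo : ∀ m : ℤ, LengthBound t.cartan m → 1 ≤ m → m ≤ 2 → KillsCokernel t.cartan 2 →
      IsUnit (2 : R) → ComponentRegular F P (L a) := fun m hC hm1 hm hk h2 =>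
    hL.componentRegular_of_two F b e he hC hm1 hm
      (fun i _ d v hv => isUnit_of_root_eq h2 hv) (hkill 2 hk) h2.isRegular
  by_cases h : L a = rootLattice P (L a)
  · cases t with
    | A l => exact hadj 1 (lengthBound_A hproper) le_rfl (by norm_num) h hreg1
    | B l => exact hadj 2 (lengthBound_B hproper) (by norm_num) (by norm_num) h (hreg2 (hF.1 h))
    | C l => exact hadj 2 (lengthBound_C hproper) (by norm_num) (by norm_num) h (hreg2 (hF.1 h))
    | D l => exact hadj 1 (lengthBound_D hproper) le_rfl (by norm_num) h hreg1
    | E₆ => exact hadj 1 lengthBound_E₆ le_rfl (by norm_num) h hreg1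
    | E₇ => exact hadj 1 lengthBound_E₇ le_rfl (by norm_num) h hreg1
    | E₈ => exact hadj 1 lengthBound_E₈ le_rfl (by norm_num) h hreg1
    | F₄ => exact hadj 2 lengthBound_F₄ (by norm_num) (by norm_num) h (hreg2 hF)
    | G₂ =>
      refine hadj 3 lengthBound_G₂ (by norm_num) le_rfl h fun c h1 h2 => ?_
      by_cases h3 : c = 3
      · exact h3 ▸ hF.2
      · exact hreg2 hF.1 c h1 (by omega)
  · cases t with
    | A l =>
      have hF' := hF h
      by_cases hl : l = 1
      · subst hl
        rw [if_pos rfl] at hF'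
        exact htwo 1 (lengthBound_A le_rfl) le_rfl (by norm_num) killsCokernel_A_one hF'
      · rw [if_neg hl] at hF'
        have hl2 : 2 ≤ l := by
          have : 1 ≤ l := hproper
          omega
        exact hL.componentRegular_of_isRegular F b e he (lengthBound_A hproper)
          (hodd (hasOddRows_A hl2)) (fun v hv => AddSubgroup.nsmul_relIndex_mem
            (rootLattice P (L a)).toAddSubgroup (K := (L a).toAddSubgroup) hv) hF'
    | B l =>
      refine hL.componentRegular_of_two F b e he (lengthBound_B hproper) (by norm_num) le_rfl
        (fun i hi d v hv => ?_) (hkill 2 (killsCokernel_B hproper)) (hF.2 h)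
      rw [hodd (hasOddRows_B hproper) i hi d v hv, Nat.cast_one]
      exact isUnit_one
    | C l =>
      exact htwo 2 (lengthBound_C hproper) (by norm_num) le_rfl (killsCokernel_C hproper) (hF.2 h)
    | D l =>
      refine hL.componentRegular_of_isRegular F b e he (lengthBound_D hproper)
        (hodd (hasOddRows_D hproper)) (hkill 4 (killsCokernel_D hproper)) ?_
      have := (hF h).mul (hF h)
      norm_num at this ⊢
      exact this
    | E₆ =>
      exact hL.componentRegular_of_isRegular F b e he lengthBound_E₆ (hodd hasOddRows_E₆)
        (hkill 3 (killsCokernel_of_det_eq CartanMatrix.E₆_det)) (hF h)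
    | E₇ =>
      exact hL.componentRegular_of_isRegular F b e he lengthBound_E₇ (hodd hasOddRows_E₇)
        (hkill 2 (killsCokernel_of_det_eq CartanMatrix.E₇_det)) (hF.2 h)
    | E₈ =>
      exact hone 1 lengthBound_E₈ le_rfl (by norm_num) hasOddRows_E₈
        (killsCokernel_of_det_eq CartanMatrix.E₈_det) hreg1
    | F₄ =>
      exact hone 2 lengthBound_F₄ (by norm_num) (by norm_num) hasOddRows_F₄
        (killsCokernel_of_det_eq CartanMatrix.F₄_det) (hreg2 hF)
    | G₂ =>
      refine hone 3 lengthBound_G₂ (by norm_num) le_rfl hasOddRows_G₂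
        (killsCokernel_of_det_eq CartanMatrix.G₂_det) fun c h1 h2 => ?_
      by_cases h3 : c = 3
      · exact h3 ▸ hF.2
      · exact hreg2 hF.1 c h1 (by omega)

variable (P) in
/-- The arithmetic conditions on the roots that are needed for the regularity of the elements
`x_α` of the formal group algebra. -/
structure RegularDatum : Prop where
  isUnit : ∀ i, ∃ (σ : Type) (_ : Finite σ) (B : Module.Basis σ ℤ M) (p : σ) (d : ℕ),
    IsUnit (d : R) ∧ P.root i = d • B p
  isRegular : ∀ i j, P.root j ≠ P.root i → P.root j ≠ -P.root i →
    ∃ (σ : Type) (_ : Finite σ) (B : Module.Basis σ ℤ M) (p q : σ) (d : ℕ) (k : ℤ) (c : ℕ),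
      p ≠ q ∧ IsUnit (d : R) ∧ P.root i = d • B p ∧ P.root j = k • B p + c • B q ∧
        IsRegular (formalInt F c)

theorem DivAssumption.regularDatum [Module.Finite ℤ M] (hss : IsSemisimpleDatum P) {b : P.Base}
    (h : DivAssumption F b) : RegularDatum F P := by
  obtain ⟨k, L, hint, hmem, hcomp⟩ := h
  have hL : IsDecomposition P L := ⟨hint, hmem⟩
  have hreg : ∀ a, ComponentRegular F P (L a) := by
    intro a
    obtain ⟨t, ht, hF⟩ := hcomp a
    exact hL.componentRegular F b hss ht hF
  have hunit : ∀ (i : ι) (d : ℕ) (v : M), P.root i = d • v → IsUnit (d : R) := by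
    intro i d v h
    obtain ⟨a, ha⟩ := hmem i
    exact (hreg a).isUnit i ha d v h
  constructor
  · intro i
    obtain ⟨σ, hσ, B, p, d, -, hd⟩ := exists_basis_of_ne_zero (P.ne_zero i)
    exact ⟨σ, hσ, B, p, d, hunit i d _ hd, hd⟩
  · intro i j h1 h2
    have hind : LinearIndependent ℤ ![P.root i, P.root j] := by
      refine RootPairing.IsReduced.linearIndependent P (fun h => h1 (h ▸ rfl)) fun h => h2 ?_
      rw [h, neg_neg]
    obtain ⟨σ, hσ, B, p, q, d, k', c, hpq, hd, hc, hi, hj⟩ :=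
      exists_basis_of_linearIndependent hind
    refine ⟨σ, hσ, B, p, q, d, k', c, hpq, hunit i d _ hi, hi, hj, ?_⟩
    obtain ⟨a, ha⟩ := hmem i
    obtain ⟨a', ha'⟩ := hmem j
    by_cases haa : a = a'
    · subst haa
      exact (hreg a).isRegular i j ha ha' hind d k' c _ _ hd hc hi hj
    -- For roots in different summands, projecting `B q` to the summand of `α_j` shows that `α_j` is
    -- `c` times a lattice vector, so `c` is a unit.
    · refine isRegular_formalInt F (IsUnit.isRegular ?_)
      have hp : B p ∈ L a := hL.mem_of_nsmul_mem hd (hi ▸ ha)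
      have htop : B q ∈ L a' ⊔ ⨆ c, ⨆ (_ : c ≠ a'), L c := by
        have : L a' ⊔ ⨆ c, ⨆ (_ : c ≠ a'), L c = ⊤ := by
          rw [eq_top_iff, ← hint.submodule_iSup_eq_top]
          refine iSup_le fun c => ?_
          by_cases hc : c = a'
          · rw [hc]
            exact le_sup_left
          · exact (IsDecomposition.le_iSup_ne hc).trans le_sup_right
        rw [this]
        exact Submodule.mem_top
      obtain ⟨y, hy, z, hz, hyz⟩ := Submodule.mem_sup.1 htop
      refine hunit j c y ?_
      rw [← sub_eq_zero]
      refine hL.eq_zero_of_mem (sub_mem ha' ((L a').nsmul_mem hy c)) ?_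
      have : P.root j - c • y = k' • B p + c • z := by
        rw [hj, ← hyz, smul_add]
        abel
      rw [this]
      exact add_mem (Submodule.smul_mem _ _ (IsDecomposition.le_iSup_ne haa hp))
        (Submodule.smul_of_tower_mem _ c hz)

end Components

end

end FormalHecke

open MvPowerSeries

namespace FormalHecke

noncomputable section

/-! ### Reflections and the Weyl group -/

section Weyl

variable {ι M N : Type*} [AddCommGroup M] [AddCommGroup N] (P : RootPairing ι ℤ M N)

/-- The reflection in a root, as an element of the Weyl group. -/
abbrev sr (i : ι) : P.weylGroup := RootPairing.weylGroup.ofIdx P i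

variable {P}

theorem weyl_ext {w w' : P.weylGroup} (h : ∀ x : M, w • x = w' • x) : w = w' :=
  Subtype.ext (RootPairing.Equiv.weightHom_injective P (LinearEquiv.ext h))

theorem sr_smul (i : ι) (x : M) : sr P i • x = x - P.coroot' i x • P.root i := rfl

theorem sr_smul_index (i j : ι) : sr P i • j = P.reflectionPerm i j := rfl

theorem root_smul (w : P.weylGroup) (i : ι) : P.root (w • i) = w • P.root i :=
  (P.weylGroup_apply_root w i).symm

theorem root_sr_smul (i j : ι) : P.root (sr P i • j) = P.root j - P.pairing j i • P.root i :=
  P.root_reflectionPerm i j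

theorem root_sr_smul_self (i : ι) : P.root (sr P i • i) = -P.root i := by
  rw [sr_smul_index, P.root_reflectionPerm, P.reflection_apply_self]

theorem sr_mul_self (i : ι) : sr P i * sr P i = 1 := by
  refine weyl_ext fun x => ?_
  rw [mul_smul, one_smul]
  exact P.reflection_same i x

theorem sr_inv (i : ι) : (sr P i)⁻¹ = sr P i := inv_eq_of_mul_eq_one_left (sr_mul_self i)

theorem sr_smul_sr_smul (i j : ι) : sr P i • sr P i • j = j := by
  rw [← mul_smul, sr_mul_self, one_smul]

theorem sr_mul_sr_mul (i : ι) (w : P.weylGroup) : sr P i * (sr P i * w) = w := by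
  rw [← mul_assoc, sr_mul_self, one_mul]

theorem sr_reflectionPerm (i j : ι) : sr P (sr P i • j) = sr P i * sr P j * sr P i := by
  refine weyl_ext fun x => ?_
  rw [mul_smul, mul_smul]
  change P.reflection (P.reflectionPerm i j) x = P.reflection i (P.reflection j (P.reflection i x))
  rw [P.reflection_reflectionPerm]
  rfl

theorem weyl_induction {p : P.weylGroup → Prop} (hsr : ∀ i, p (sr P i)) (hone : p 1)
    (hmul : ∀ w w', p w → p w' → p (w * w')) (w : P.weylGroup) : p w := by
  obtain ⟨w, hw⟩ := w
  exact RootPairing.weylGroup.induction P (pred := fun g hg => p ⟨g, hg⟩) hsr hone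
    (fun x y hx hy h h' => hmul ⟨x, hx⟩ ⟨y, hy⟩ h h') hw

theorem sr_weyl_smul (w : P.weylGroup) (i : ι) : sr P (w • i) = w * sr P i * w⁻¹ := by
  induction w using weyl_induction generalizing i with
  | hsr j => rw [sr_reflectionPerm, sr_inv]
  | hone => simp
  | hmul w w' h h' => rw [mul_smul, h, h', mul_inv_rev]; group

theorem sr_eq_of_root_eq_neg {i j : ι} (h : P.root i = -P.root j) : sr P i = sr P j := by
  have : i = sr P j • j := P.root.injective (by rw [h, root_sr_smul_self])
  rw [this, sr_weyl_smul, sr_inv, sr_mul_self, one_mul]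

/-! ### Positive roots, inversions and reduced words -/

section Positive

variable (b : P.Base)

theorem height_neg {i j : ι} (h : P.root i = -P.root j) : b.height i = -b.height j := by
  have hi : i = P.reflectionPerm j j := P.root.injective (by
    rw [h, P.root_reflectionPerm, P.reflection_apply_self])
  rw [hi]
  exact b.height_reflectionPerm_self j

/-- Heights turn positivity into a sign that is linear along relations between roots, the form
needed for comparing inversion sets. -/
theorem isPosRoot_iff {i : ι} : IsPosRoot b i ↔ 0 < b.height i := by
  have key : ∀ i, IsPosRoot b i → 0 < b.height i := by
    intro i hi
    have : ∀ m ∈ AddSubmonoid.closure (P.root '' b.support),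
        ∃ f : ι → ℤ, (∀ j, 0 ≤ f j) ∧ m = ∑ j ∈ b.support, f j • P.root j := by
      classical
      intro m hm
      induction hm using AddSubmonoid.closure_induction with
      | mem x hx =>
        obtain ⟨j, hj, rfl⟩ := hx
        refine ⟨Pi.single j 1, fun k => ?_, ?_⟩
        · by_cases h : k = j
          · subst h
            simp
          · simp [h]
        · rw [Finset.sum_eq_single_of_mem j hj (fun k _ hk => by simp [hk])]
          simp
      | zero => exact ⟨0, fun _ => le_rfl, by simp⟩
      | add x y _ _ hx hy =>
        obtain ⟨f, hf, rfl⟩ := hx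
        obtain ⟨g, hg, rfl⟩ := hy
        exact ⟨f + g, fun k => add_nonneg (hf k) (hg k), by simp [add_smul, Finset.sum_add_distrib]⟩
    obtain ⟨f, hf, h⟩ := this _ hi
    have h1 := RootPairing.Base.height_eq_sum h
    have h2 : 0 ≤ b.height i := h1 ▸ Finset.sum_nonneg fun j _ => hf j
    exact lt_of_le_of_ne h2 (b.height_ne_zero i).symm
  refine ⟨key i, fun h => ?_⟩
  rcases b.root_mem_or_neg_mem i with hi | hi
  · exact hi
  · have hn : IsPosRoot b (sr P i • i) := by
      rw [IsPosRoot, root_sr_smul_self]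
      exact hi
    have := key _ hn
    rw [height_neg b (root_sr_smul_self i)] at this
    omega

theorem not_isPosRoot_iff {i : ι} : ¬ IsPosRoot b i ↔ b.height i < 0 := by
  rw [isPosRoot_iff]
  have := b.height_ne_zero i
  omega

theorem isPosRoot_of_mem {i : ι} (hi : i ∈ b.support) : IsPosRoot b i :=
  AddSubmonoid.subset_closure ⟨i, hi, rfl⟩

theorem isPosRoot_neg_iff {i j : ι} (h : P.root i = -P.root j) :
    IsPosRoot b i ↔ ¬ IsPosRoot b j := by
  rw [isPosRoot_iff, not_isPosRoot_iff, height_neg b h]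
  omega

theorem isPosRoot_smul_sr_smul_iff (w : P.weylGroup) (i : ι) :
    IsPosRoot b (w • sr P i • i) ↔ ¬ IsPosRoot b (w • i) :=
  isPosRoot_neg_iff b (by rw [root_smul w (sr P i • i), root_sr_smul_self, root_smul w i, smul_neg])

variable [Fintype ι] [P.IsReduced]

theorem isPosRoot_sr_smul {i j : ι} (hj : j ∈ b.support) (hi : IsPosRoot b i) (h : i ≠ j) :
    IsPosRoot b (sr P j • i) := by
  rw [isPosRoot_iff] at hi ⊢
  exact RootPairing.Base.IsPos.reflectionPerm hi hj h

open scoped Classical in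
/-- The set `Σ(w)` of the positive roots `α` such that `w⁻¹(α)` is negative. -/
def inversions (w : P.weylGroup) : Finset ι :=
  Finset.univ.filter fun i => IsPosRoot b i ∧ ¬ IsPosRoot b (w⁻¹ • i)

theorem mem_inversions {w : P.weylGroup} {i : ι} :
    i ∈ inversions b w ↔ IsPosRoot b i ∧ ¬ IsPosRoot b (w⁻¹ • i) := by
  classical
  simp [inversions]

theorem inv_sr_mul_smul (w : P.weylGroup) (i j : ι) :
    (sr P i * w)⁻¹ • j = w⁻¹ • sr P i • j := by
  rw [mul_inv_rev, sr_inv, mul_smul]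

-- A simple reflection permutes the positive roots other than its own, so it carries `Σ(w)` into
-- `Σ(s_j w)`, and only `α_j` is new.
open scoped Classical in
theorem inversions_sr_mul {w : P.weylGroup} {j : ι} (hj : j ∈ b.support)
    (hw : j ∉ inversions b w) :
    j ∉ (inversions b w).image (sr P j • ·) ∧
      inversions b (sr P j * w) = insert j ((inversions b w).image (sr P j • ·)) := by
  have hjpos := isPosRoot_of_mem b hj
  have hneg : ¬ IsPosRoot b (sr P j • j) := by
    have := isPosRoot_smul_sr_smul_iff b 1 j
    rw [one_smul, one_smul] at this
    exact fun h => this.1 h hjpos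
  have hwj : IsPosRoot b (w⁻¹ • j) := by
    by_contra h
    exact hw ((mem_inversions b).2 ⟨hjpos, h⟩)
  refine ⟨fun h => ?_, ?_⟩
  · obtain ⟨i, hi, hij⟩ := Finset.mem_image.1 h
    have : i = sr P j • j := by
      rw [← sr_smul_sr_smul (P := P) j i]
      exact congrArg (fun k : ι => sr P j • k) hij
    exact hneg (this ▸ ((mem_inversions b).1 hi).1)
  · ext i
    rw [Finset.mem_insert, Finset.mem_image, mem_inversions, inv_sr_mul_smul]
    constructor
    · rintro ⟨h1, h2⟩
      by_cases hij : i = j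
      · exact Or.inl hij
      · exact Or.inr ⟨sr P j • i, (mem_inversions b).2 ⟨isPosRoot_sr_smul b hj h1 hij, h2⟩,
          sr_smul_sr_smul j i⟩
    · rintro (rfl | ⟨k, hk, rfl⟩)
      · refine ⟨hjpos, ?_⟩
        rw [isPosRoot_smul_sr_smul_iff, not_not]
        exact hwj
      · obtain ⟨h1, h2⟩ := (mem_inversions b).1 hk
        have hkj : k ≠ j := by
          rintro rfl
          exact h2 hwj
        refine ⟨isPosRoot_sr_smul b hj h1 hkj, ?_⟩
        rwa [sr_smul_sr_smul]

theorem not_mem_inversions_sr_mul {w : P.weylGroup} {j : ι} (hw : j ∈ inversions b w) :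
    j ∉ inversions b (sr P j * w) := by
  rw [mem_inversions, inv_sr_mul_smul, isPosRoot_smul_sr_smul_iff, not_not]
  exact fun h => ((mem_inversions b).1 hw).2 h.2

theorem card_inversions_sr_mul {w : P.weylGroup} {j : ι} (hj : j ∈ b.support)
    (hw : j ∉ inversions b w) :
    (inversions b (sr P j * w)).card = (inversions b w).card + 1 := by
  classical
  obtain ⟨h1, h2⟩ := inversions_sr_mul b hj hw
  rw [h2, Finset.card_insert_of_notMem h1, Finset.card_image_of_injective _ (MulAction.injective _)]

theorem card_inversions_sr_mul_le {w : P.weylGroup} {j : ι} (hj : j ∈ b.support) :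
    (inversions b (sr P j * w)).card ≤ (inversions b w).card + 1 := by
  by_cases hw : j ∈ inversions b w
  · have := card_inversions_sr_mul b hj (not_mem_inversions_sr_mul b hw)
    rw [sr_mul_sr_mul] at this
    omega
  · exact (card_inversions_sr_mul b hj hw).le

/-- The reflection need not be simple. Sending `β` to `s_α β` if this is positive, and to `β`
otherwise, injects `Σ(w)` into `Σ(s_α w)` without `α`. -/
theorem card_inversions_lt {w : P.weylGroup} {i : ι} (hi : IsPosRoot b i)
    (hw : i ∉ inversions b w) : (inversions b w).card < (inversions b (sr P i * w)).card := by
  classical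
  have hwi : IsPosRoot b (w⁻¹ • i) := by
    by_contra h
    exact hw ((mem_inversions b).2 ⟨hi, h⟩)
  have hii : i ∈ inversions b (sr P i * w) := by
    rw [mem_inversions, inv_sr_mul_smul, isPosRoot_smul_sr_smul_iff, not_not]
    exact ⟨hi, hwi⟩
  have hneg : ¬ IsPosRoot b (sr P i • i) := by
    have := isPosRoot_smul_sr_smul_iff b 1 i
    rw [one_smul, one_smul] at this
    exact fun h => this.1 h hi
  rw [← Finset.card_erase_add_one hii, Nat.lt_succ_iff]
  refine Finset.card_le_card_of_injOn (fun j => if IsPosRoot b (sr P i • j) then sr P i • j else j)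
    ?_ ?_
  · intro j hj
    obtain ⟨h1, h2⟩ := (mem_inversions b).1 hj
    simp only
    split_ifs with h
    · refine Finset.mem_erase.2 ⟨fun hji => ?_, (mem_inversions b).2 ⟨h, ?_⟩⟩
      · have : j = sr P i • i := by
          rw [← sr_smul_sr_smul (P := P) i j]
          exact congrArg (fun k : ι => sr P i • k) hji
        exact hneg (this ▸ h1)
      · rwa [inv_sr_mul_smul, sr_smul_sr_smul]
    · refine Finset.mem_erase.2 ⟨fun hji => hw (hji ▸ hj), (mem_inversions b).2 ⟨h1, ?_⟩⟩
      rw [inv_sr_mul_smul]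
      rw [not_isPosRoot_iff] at h h2 ⊢
      rw [isPosRoot_iff] at h1 hi hwi
      have e1 : b.height (sr P i • j) = b.height j + (-P.pairing j i) • b.height i :=
        b.height_add_zsmul (by rw [root_sr_smul, neg_smul, sub_eq_add_neg])
      have e2 : b.height (w⁻¹ • sr P i • j) =
          b.height (w⁻¹ • j) + (-P.pairing j i) • b.height (w⁻¹ • i) :=
        b.height_add_zsmul (by
          rw [root_smul, root_sr_smul, root_smul, root_smul, smul_sub, smul_comm, neg_smul,
            sub_eq_add_neg])
      rw [smul_eq_mul] at e1 e2
      -- As `s_α β` is negative for positive `α` and `β`, the pairing is positive. Then `w⁻¹ s_α β`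
      -- is the negative root `w⁻¹ β` minus a positive multiple of the positive root `w⁻¹ α`, hence
      -- negative.
      have h3 : 0 < P.pairing j i := by
        by_contra! h0
        nlinarith
      nlinarith
  · intro j hj j' hj' h
    have h1 := ((mem_inversions b).1 hj).1
    have h1' := ((mem_inversions b).1 hj').1
    simp only at h
    split_ifs at h with h2 h3 h3
    · exact MulAction.injective _ h
    · rw [← h, sr_smul_sr_smul] at h3
      exact absurd h1 h3
    · rw [h, sr_smul_sr_smul] at h2
      exact absurd h1' h2
    · exact h

/-- The product of the simple reflections in a list. -/
def srProd (l : List b.support) : P.weylGroup := (l.map fun i => sr P i).prod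

theorem srProd_cons (i : b.support) (l : List b.support) :
    srProd b (i :: l) = sr P i * srProd b l := by
  simp [srProd]

theorem srProd_append (l l' : List b.support) :
    srProd b (l ++ l') = srProd b l * srProd b l' := by
  simp [srProd]

theorem exists_srProd_eq (w : P.weylGroup) : ∃ l, srProd b l = w := by
  have hrefl : ∀ i, ∃ l, srProd b l = sr P i := by
    have hconj : ∀ i j, (∃ l, srProd b l = sr P i) → (∃ l, srProd b l = sr P j) →
        ∃ l, srProd b l = sr P (P.reflectionPerm j i) := by
      rintro i j ⟨l, hl⟩ ⟨l', hl'⟩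
      refine ⟨l' ++ l ++ l', ?_⟩
      rw [srProd_append, srProd_append, hl, hl', ← sr_smul_index, sr_reflectionPerm]
    intro i
    induction i using b.induction_reflect with
    | h₀ i ih => exact hconj i i ih ih
    | h₁ i hi => exact ⟨[⟨i, hi⟩], by simp [srProd]⟩
    | h₂ i j ih hj => exact hconj i j ih ⟨[⟨j, hj⟩], by simp [srProd]⟩
  induction w using weyl_induction with
  | hsr i => exact hrefl i
  | hone => exact ⟨[], rfl⟩
  | hmul w w' h h' =>
    obtain ⟨l, rfl⟩ := h
    obtain ⟨l', rfl⟩ := h'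
    exact ⟨l ++ l', srProd_append b l l'⟩

/-- Exchange condition. Let the letters act on `α_j` from right to left. A letter `i` turns a
positive root negative only if that root is `α_i`; then `s_i` is the conjugate of `s_j` by the word
to its right, and the two cancel. -/
theorem exists_srProd_mul_eq (l : List b.support) (j : b.support)
    (h : ¬ IsPosRoot b (srProd b l • (j : ι))) :
    ∃ l' : List b.support, l'.length < l.length ∧ srProd b l * sr P j = srProd b l' := by
  induction l with
  | nil =>
    refine absurd (isPosRoot_of_mem b j.2) ?_
    simpa [srProd] using h
  | cons i l ih =>
    by_cases hl : IsPosRoot b (srProd b l • (j : ι))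
    · refine ⟨l, by simp, ?_⟩
      have hij : srProd b l • (j : ι) = i := by
        by_contra hne
        rw [srProd_cons, mul_smul] at h
        exact h (isPosRoot_sr_smul b i.2 hl hne)
      rw [srProd_cons, ← hij, sr_weyl_smul, mul_assoc (srProd b l * sr P j),
        inv_mul_cancel, mul_one, mul_assoc, sr_mul_self, mul_one]
    · obtain ⟨l', h1, h2⟩ := ih hl
      refine ⟨i :: l', by simpa using h1, ?_⟩
      rw [srProd_cons, srProd_cons, mul_assoc, h2]

/-- Induction on the length of a word with last letter `j`. Without inversions `w α_j` is positive,
so the word without its last letter makes `α_j` negative, and the exchange condition yields a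
shorter word for `w`. -/
theorem eq_one_of_inversions_eq_empty {w : P.weylGroup} (h : inversions b w = ∅) : w = 1 := by
  obtain ⟨l, rfl⟩ := exists_srProd_eq b w
  induction hn : l.length using Nat.strong_induction_on generalizing l with
  | _ n ih =>
    rcases List.eq_nil_or_concat l with rfl | ⟨l₁, j, rfl⟩
    · rfl
    · rw [List.concat_eq_append] at *
      have hj : srProd b (l₁ ++ [j]) = srProd b l₁ * sr P j := by simp [srProd]
      have hpos : IsPosRoot b (srProd b (l₁ ++ [j]) • (j : ι)) := by
        by_contra hneg
        set w := srProd b (l₁ ++ [j])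
        have hmem : w • sr P j • (j : ι) ∈ inversions b w := by
          rw [mem_inversions, isPosRoot_smul_sr_smul_iff, inv_smul_smul]
          refine ⟨hneg, ?_⟩
          have := isPosRoot_smul_sr_smul_iff b 1 (j : ι)
          rw [one_smul, one_smul] at this
          exact fun h => this.1 h (isPosRoot_of_mem b j.2)
        rw [h] at hmem
        exact absurd hmem (Finset.notMem_empty _)
      rw [hj, mul_smul, isPosRoot_smul_sr_smul_iff] at hpos
      obtain ⟨l', h1, h2⟩ := exists_srProd_mul_eq b l₁ j hpos
      rw [hj, h2] at h ⊢
      refine ih l'.length ?_ l' h rfl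
      rw [← hn]
      simp
      omega

/-- If `w⁻¹` kept all simple roots positive, it would keep all positive roots positive, and `Σ(w)`
would be empty. -/
theorem exists_mem_support_mem_inversions {w : P.weylGroup} (hw : w ≠ 1) :
    ∃ j ∈ b.support, j ∈ inversions b w := by
  by_contra! h
  refine hw (eq_one_of_inversions_eq_empty b (Finset.eq_empty_of_forall_notMem fun i hi => ?_))
  obtain ⟨h1, h2⟩ := (mem_inversions b).1 hi
  refine h2 ?_
  have hsimple : ∀ j ∈ b.support, 0 < b.height (w⁻¹ • j) := by
    intro j hj
    have := h j hj
    rw [mem_inversions, not_and, not_not] at this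
    exact (isPosRoot_iff b).1 (this (isPosRoot_of_mem b hj))
  have key : ∀ i, b.IsPos i → 0 < b.height (w⁻¹ • i) := by
    intro i hi
    refine RootPairing.Base.IsPos.induction_on_add hi (p := fun i => 0 < b.height (w⁻¹ • i))
      hsimple fun i j k hk hi hj => ?_
    rw [b.height_add (i := w⁻¹ • i) (j := w⁻¹ • j)]
    · exact add_pos hi (hsimple j hj)
    · rw [root_smul, root_smul, root_smul, hk, smul_add]
  exact (isPosRoot_iff b).2 (key i ((isPosRoot_iff b).1 h1))

end Positive

end Weyl

end

end FormalHecke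

open MvPowerSeries

namespace FormalHecke

noncomputable section

variable {R : Type*} [CommRing R]

/-! ### Cancelling factors one at a time -/

section Divisibility

theorem dvd_of_dvd_mul_of_mem_closure {A : Type*} [CommRing A] {s : Set A} {c m f : A}
    (hs : ∀ x ∈ s, ∀ f, c ∣ x * f → c ∣ f) (hm : m ∈ Submonoid.closure s) (h : c ∣ m * f) :
    c ∣ f := by
  induction hm using Submonoid.closure_induction generalizing f with
  | mem x hx => exact hs x hx f h
  | one => rwa [one_mul] at h
  | mul x y _ _ hx hy => exact hy (hx (by rwa [← mul_assoc]))

/-- Each `c i` divides `f` because it is prime to `x`, and is then cancelled from both sides because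
it is regular. The `c i` need not be prime to one another. -/
theorem prod_dvd_of_dvd_mul {A κ : Type*} [CommRing A] {c : κ → A} {x : A} (T : Finset κ)
    (hreg : ∀ i ∈ T, IsRegular (c i)) (hc : ∀ i ∈ T, ∀ f, c i ∣ x * f → c i ∣ f) {f : A}
    (h : ∏ i ∈ T, c i ∣ x * f) : ∏ i ∈ T, c i ∣ f := by
  classical
  induction T using Finset.induction_on generalizing f with
  | empty => simp
  | insert i T hi ih =>
    rw [Finset.prod_insert hi] at h ⊢
    obtain ⟨f, rfl⟩ := hc i (Finset.mem_insert_self i T) f (dvd_of_mul_right_dvd h)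
    refine mul_dvd_mul_left _ (ih (fun j hj => hreg j (Finset.mem_insert_of_mem hj))
      (fun j hj => hc j (Finset.mem_insert_of_mem hj)) ?_)
    obtain ⟨g, hg⟩ := h
    refine ⟨g, (hreg i (Finset.mem_insert_self i T)).left ?_⟩
    simp only
    linear_combination hg

theorem isRegular_of_associated {A : Type*} [CommRing A] {x y : A} (h : Associated x y)
    (hy : IsRegular y) : IsRegular x := by
  obtain ⟨u, rfl⟩ := h.symm
  exact hy.mul u.isUnit.isRegular

end Divisibility

/-! ### Regularity and coprimality of the elements attached to roots -/

section Roots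

variable (F : FormalGroup R) [F.IsComm] {ι M N : Type*} [AddCommGroup M] [Module.Free ℤ M]
  [Module.Finite ℤ M] [AddCommGroup N] {P : RootPairing ι ℤ M N}

/-- The involution `(t, l) ↦ (-t, l + t m)` maps the product basis to the required one. For a root
`m = α` this makes `α - γ` a basis vector. -/
theorem exists_basis_prod {σ : Type*} [Finite σ] (B : Module.Basis σ ℤ M) (m : M) :
    ∃ B' : Module.Basis (Unit ⊕ σ) ℤ (ℤ × M),
      B' (Sum.inl ()) = (-1, m) ∧ ∀ p, B' (Sum.inr p) = (0, B p) := by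
  let f : ℤ × M →ₗ[ℤ] ℤ × M :=
    (-LinearMap.fst ℤ ℤ M).prod (LinearMap.snd ℤ ℤ M + (LinearMap.fst ℤ ℤ M).smulRight m)
  have hf : Function.Involutive f := by
    rintro ⟨t, l⟩
    simp [f, neg_smul]
  refine ⟨((Module.Basis.singleton Unit ℤ).prod B).map (LinearEquiv.ofInvolutive f hf), ?_, ?_⟩
  · rw [Module.Basis.map_apply, Module.Basis.prod_apply]
    simp [f]
  · intro p
    rw [Module.Basis.map_apply, Module.Basis.prod_apply]
    simp [f]

theorem associated_xr {i : ι} {d : ℕ} (hd : IsUnit (d : R)) {m : M} (h : P.root i = d • m) :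
    Associated (xr F P i) (xΛ F P m) := by
  have : ((0, P.root i) : ℤ × M) = d • (0, m) := by rw [h]; simp
  rw [xr, xΛ, this]
  exact associated_x_nsmul F hd _

theorem exists_xr_add_xr {i j : ι} (h : P.root j = -P.root i) :
    ∃ g, xr F P i + xr F P j + xr F P i * xr F P j * g = 0 := by
  have : ((0, P.root j) : ℤ × M) = -(0, P.root i) := by rw [h]; simp
  rw [xr, xr, xΛ, xΛ, this]
  exact exists_x_add_x_neg F _

theorem associated_xr_of_eq_neg {i j : ι} (h : P.root j = -P.root i) :
    Associated (xr F P j) (xr F P i) := by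
  have : ((0, P.root j) : ℤ × M) = -(0, P.root i) := by rw [h]; simp
  rw [xr, xr, xΛ, xΛ, this]
  exact associated_x_neg F _

theorem xr_dvd_sr_smul_sub (i : ι) (f : SF F P) : xr F P i ∣ sr P i • f - f := by
  refine x_dvd_map_sub F (e := weylAct (sr P i)) (l₀ := (0, P.root i)) ?_ f
  rintro ⟨t, m⟩
  refine ⟨-P.coroot' i m, ?_⟩
  have : weylAct (sr P i) (t, m) = (t, sr P i • m) := rfl
  rw [this, sr_smul]
  simp [sub_eq_add_neg]

variable {F}

theorem RegularDatum.isRegular_xr (h : RegularDatum F P) (i : ι) : IsRegular (xr F P i) := by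
  obtain ⟨σ, _, B, p, d, hd, hi⟩ := h.isUnit i
  obtain ⟨B', -, hB⟩ := exists_basis_prod B 0
  refine isRegular_of_associated (associated_xr F hd hi) ?_
  rw [xΛ, ← hB]
  exact isRegular_x_basis F B' _

theorem RegularDatum.xr_dvd_of_dvd_mul (h : RegularDatum F P) {i j : ι}
    (h1 : P.root j ≠ P.root i) (h2 : P.root j ≠ -P.root i) {f : SF F P}
    (hf : xr F P i ∣ xr F P j * f) : xr F P i ∣ f := by
  obtain ⟨σ, _, B, p, q, d, k, c, hpq, hd, hi, hj, hc⟩ := h.isRegular i j h1 h2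
  obtain ⟨B', -, hB⟩ := exists_basis_prod B 0
  rw [(associated_xr F hd hi).dvd_iff_dvd_left, xΛ, ← hB] at hf ⊢
  refine x_basis_dvd_of_dvd_mul F B' (j := Sum.inr q) (by simpa using hpq) k hc ?_
  have : k • B' (Sum.inr p) + c • B' (Sum.inr q) = (0, P.root j) := by
    rw [hB, hB, hj]
    simp
  rw [this]
  exact hf

theorem associated_xr_sub_xγ (i : ι) :
    Associated (xr F P i - xγ F P) (FGA.x F ((-1, P.root i) : ℤ × M)) := by
  have : ((-1, P.root i) : ℤ × M) = (0, P.root i) - (1, 0) := by simp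
  rw [this]
  exact associated_x_sub_x F _ _

theorem RegularDatum.isRegular_xr_sub_xγ (h : RegularDatum F P) (i : ι) :
    IsRegular (xr F P i - xγ F P) := by
  obtain ⟨σ, _, B, -⟩ := h.isUnit i
  obtain ⟨B', hB, -⟩ := exists_basis_prod B (P.root i)
  refine isRegular_of_associated (associated_xr_sub_xγ i) ?_
  rw [← hB]
  exact isRegular_x_basis F B' _

/-- In a basis containing both `α - γ` and the primitive vector below `β`, the two elements are
distinct variables up to units. -/
theorem RegularDatum.xr_sub_xγ_dvd_of_dvd_mul (h : RegularDatum F P) {i j : ι} {f : SF F P}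
    (hf : xr F P i - xγ F P ∣ xr F P j * f) : xr F P i - xγ F P ∣ f := by
  obtain ⟨σ, _, B, p, d, hd, hj⟩ := h.isUnit j
  obtain ⟨B', hB, hB'⟩ := exists_basis_prod B (P.root i)
  rw [((associated_xr F hd hj).mul_right f).dvd_iff_dvd_right] at hf
  rw [(associated_xr_sub_xγ i).dvd_iff_dvd_left, ← hB] at hf ⊢
  refine x_basis_dvd_of_dvd_mul F B' (j := Sum.inr p) (by simp) 0 (isRegular_formalInt_one F) ?_
  rw [zero_smul, zero_add, one_smul, hB']
  exact hf

theorem RegularDatum.rootMonoid_le (h : RegularDatum F P) :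
    rootMonoid F P ≤ nonZeroDivisors (SF F P) := by
  rw [rootMonoid, Submonoid.closure_le]
  rintro _ ⟨i, rfl⟩
  exact isRegular_iff_mem_nonZeroDivisors.1 (h.isRegular_xr i)

theorem RegularDatum.algebraMap_injective (h : RegularDatum F P) :
    Function.Injective (algebraMap (SF F P) (QF F P)) :=
  IsLocalization.injective _ h.rootMonoid_le

end Roots

/-! ### The localizations `Q` and `Q_α` -/

section Localization

variable (F : FormalGroup R) {ι M N : Type*} [AddCommGroup M] [AddCommGroup N]
  {P : RootPairing ι ℤ M N}

theorem algebraMap_xr_mul_invx (i : ι) :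
    algebraMap (SF F P) (QF F P) (xr F P i) * invx F P i = 1 := by
  have := IsLocalization.mk'_spec' (QF F P) (1 : SF F P) ⟨xr F P i, xr_mem F P i⟩
  rwa [map_one] at this

theorem smul_invx (w : P.weylGroup) (i : ι) : w • invx F P i = invx F P (w • i) := by
  have h1 := algebraMap_xr_mul_invx F (P := P) (w • i)
  have h2 := congrArg (w • ·) (algebraMap_xr_mul_invx F (P := P) i)
  simp only [smul_mul', smul_one, smul_algebraMap_QF, smul_xr] at h2
  linear_combination (invx F P (w • i)) * h2 - (w • invx F P i) * h1

theorem invx_mem_Qα {i j : ι} (h1 : P.root j ≠ P.root i) (h2 : P.root j ≠ -P.root i) :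
    invx F P j ∈ Qα F P i := Algebra.subset_adjoin ⟨j, ⟨h1, h2⟩, rfl⟩

theorem Qα_eq_of_eq_neg {i j : ι} (h : P.root j = -P.root i) : Qα F P j = Qα F P i := by
  rw [Qα, Qα]
  congr 2
  ext k
  simp only [Set.mem_ofPred_eq, h, neg_neg]
  exact and_comm

theorem algebraMap_mem_Qα (i : ι) (s : SF F P) : algebraMap (SF F P) (QF F P) s ∈ Qα F P i :=
  Subalgebra.algebraMap_mem _ s

theorem exists_mul_eq_of_mem_Qα {i : ι} {q : QF F P} (hq : q ∈ Qα F P i) :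
    ∃ m ∈ Submonoid.closure (xr F P '' {j | P.root j ≠ P.root i ∧ P.root j ≠ -P.root i}),
      ∃ s, algebraMap (SF F P) (QF F P) m * q = algebraMap (SF F P) (QF F P) s := by
  rw [Qα] at hq
  induction hq using Algebra.adjoin_induction with
  | mem x hx =>
    obtain ⟨j, hj, rfl⟩ := hx
    exact ⟨xr F P j, Submonoid.subset_closure ⟨j, hj, rfl⟩, 1, by
      rw [algebraMap_xr_mul_invx, map_one]⟩
  | algebraMap s => exact ⟨1, one_mem _, s, by rw [map_one, one_mul]⟩
  | add x y _ _ hx hy =>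
    obtain ⟨m, hm, s, hs⟩ := hx
    obtain ⟨m', hm', s', hs'⟩ := hy
    refine ⟨m * m', mul_mem hm hm', m' * s + m * s', ?_⟩
    simp only [map_mul, map_add]
    linear_combination (algebraMap (SF F P) (QF F P) m') * hs +
      (algebraMap (SF F P) (QF F P) m) * hs'
  | mul x y _ _ hx hy =>
    obtain ⟨m, hm, s, hs⟩ := hx
    obtain ⟨m', hm', s', hs'⟩ := hy
    refine ⟨m * m', mul_mem hm hm', s * s', ?_⟩
    simp only [map_mul]
    linear_combination (algebraMap (SF F P) (QF F P) m' * y) * hs +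
      (algebraMap (SF F P) (QF F P) s) * hs'

theorem smul_mem_Qα (w : P.weylGroup) {i : ι} {q : QF F P} (hq : q ∈ Qα F P i) :
    w • q ∈ Qα F P (w • i) := by
  rw [Qα] at hq
  induction hq using Algebra.adjoin_induction with
  | mem x hx =>
    obtain ⟨j, hj, rfl⟩ := hx
    rw [smul_invx]
    refine invx_mem_Qα F (fun h => hj.1 ?_) (fun h => hj.2 ?_)
    · rw [root_smul, root_smul] at h
      exact MulAction.injective w h
    · rw [root_smul, root_smul, ← smul_neg] at h
      exact MulAction.injective w h
  | algebraMap s =>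
    rw [smul_algebraMap_QF]
    exact algebraMap_mem_Qα F _ _
  | add x y _ _ hx hy =>
    rw [smul_add]
    exact add_mem hx hy
  | mul x y _ _ hx hy =>
    rw [smul_mul']
    exact mul_mem hx hy

theorem sr_smul_mem_Qα {i : ι} {q : QF F P} (hq : q ∈ Qα F P i) : sr P i • q ∈ Qα F P i := by
  rw [← Qα_eq_of_eq_neg F (root_sr_smul_self i)]
  exact smul_mem_Qα F _ hq

variable [F.IsComm] [Module.Free ℤ M] [Module.Finite ℤ M]

/-- On `S` this is `xr_dvd_sr_smul_sub`. The property passes to the inverses of the `x_β`, to sums,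
and to products by the twisted Leibniz rule. -/
theorem exists_sr_smul_sub_eq {i : ι} {q : QF F P} (hq : q ∈ Qα F P i) :
    ∃ g ∈ Qα F P i, sr P i • q - q = algebraMap (SF F P) (QF F P) (xr F P i) * g := by
  have hS : ∀ s : SF F P, ∃ g : SF F P, sr P i • algebraMap (SF F P) (QF F P) s -
      algebraMap (SF F P) (QF F P) s =
        algebraMap (SF F P) (QF F P) (xr F P i) * algebraMap (SF F P) (QF F P) g := by
    intro s
    obtain ⟨g, hg⟩ := xr_dvd_sr_smul_sub F i s
    exact ⟨g, by rw [smul_algebraMap_QF, ← map_sub, hg, map_mul]⟩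
  rw [Qα] at hq
  induction hq using Algebra.adjoin_induction with
  | mem x hx =>
    obtain ⟨j, hj, rfl⟩ := hx
    obtain ⟨g, hg⟩ := hS (xr F P j)
    have hj1 : invx F P j ∈ Qα F P i := invx_mem_Qα F hj.1 hj.2
    have hj2 := sr_smul_mem_Qα F hj1
    refine ⟨-(invx F P j * sr P i • invx F P j * algebraMap (SF F P) (QF F P) g),
      neg_mem (mul_mem (mul_mem hj1 hj2) (algebraMap_mem_Qα F _ _)), ?_⟩
    have h1 := algebraMap_xr_mul_invx F (P := P) j
    have h2 := congrArg (sr P i • ·) h1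
    simp only [smul_mul', smul_one] at h2
    linear_combination (-invx F P j * sr P i • invx F P j) * hg + (invx F P j) * h2 -
      (sr P i • invx F P j) * h1
  | algebraMap s =>
    obtain ⟨g, hg⟩ := hS s
    exact ⟨_, algebraMap_mem_Qα F _ _, hg⟩
  | add x y _ _ hx hy =>
    obtain ⟨g, hg, h⟩ := hx
    obtain ⟨g', hg', h'⟩ := hy
    exact ⟨g + g', add_mem hg hg', by rw [smul_add]; linear_combination h + h'⟩
  | mul x y hx' hy' hx hy =>
    obtain ⟨g, hg, h⟩ := hx
    obtain ⟨g', hg', h'⟩ := hy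
    refine ⟨g * sr P i • y + x * g', add_mem (mul_mem hg (sr_smul_mem_Qα F hy'))
      (mul_mem hx' hg'), ?_⟩
    rw [smul_mul']
    linear_combination (sr P i • y) * h + x * h'

/-- Divide `x_α + x_{-α} + x_α x_{-α} g = 0` by `x_α x_{-α}`. -/
theorem exists_invx_add_invx {i j : ι} (h : P.root j = -P.root i) :
    ∃ g, invx F P i + invx F P j = algebraMap (SF F P) (QF F P) g := by
  obtain ⟨g, hg⟩ := exists_xr_add_xr F h
  have hg := congrArg (algebraMap (SF F P) (QF F P)) hg
  simp only [map_add, map_mul, map_zero] at hg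
  have h1 := algebraMap_xr_mul_invx F (P := P) i
  have h2 := algebraMap_xr_mul_invx F (P := P) j
  refine ⟨-g, ?_⟩
  rw [map_neg]
  linear_combination (invx F P i * invx F P j) * hg - (invx F P j) * h1 - (invx F P i) * h2 -
    algebraMap (SF F P) (QF F P) g * h1 - algebraMap (SF F P) (QF F P) g *
      (algebraMap (SF F P) (QF F P) (xr F P i) * invx F P i) * h2

variable {F}

/-- Denominators are removed one factor at a time. If `x_α q = t` lies in `S`, and `m q = s` with
`m` prime to `x_α`, then `x_α s = m t`, so `x_α ∣ t`. -/
theorem RegularDatum.mem_range_algebraMap (h : RegularDatum F P) {q : QF F P}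
    (hq : ∀ i, q ∈ Qα F P i) : ∃ s, q = algebraMap (SF F P) (QF F P) s := by
  obtain ⟨⟨s, m, hm⟩, hs⟩ := IsLocalization.surj (rootMonoid F P) q
  replace hs : ∃ s, algebraMap (SF F P) (QF F P) m * q = algebraMap (SF F P) (QF F P) s :=
    ⟨s, by rw [← hs, mul_comm]⟩
  clear s
  rw [rootMonoid] at hm
  induction hm using Submonoid.closure_induction generalizing q with
  | one => simpa using hs
  | mul x y _ _ hx hy =>
    refine hy hq (hx (fun i => mul_mem (algebraMap_mem_Qα F i y) (hq i)) ?_)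
    rwa [← mul_assoc, ← map_mul]
  | mem x hx =>
    obtain ⟨i, rfl⟩ := hx
    obtain ⟨t, ht⟩ := hs
    obtain ⟨m, hm, s, hs⟩ := exists_mul_eq_of_mem_Qα F (hq i)
    have hdvd : xr F P i ∣ m * t := by
      refine ⟨s, h.algebraMap_injective ?_⟩
      rw [map_mul, map_mul, ← ht, ← hs]
      ring
    obtain ⟨t', rfl⟩ := dvd_of_dvd_mul_of_mem_closure (fun x hx f hf => by
      obtain ⟨j, hj, rfl⟩ := hx
      exact h.xr_dvd_of_dvd_mul hj.1 hj.2 hf) hm hdvd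
    refine ⟨t', ?_⟩
    rw [map_mul] at ht
    have h1 := algebraMap_xr_mul_invx F (P := P) i
    linear_combination invx F P i * ht + (algebraMap (SF F P) (QF F P) t' - q) * h1

theorem RegularDatum.prod_dvd_of_dvd_mul (h : RegularDatum F P) (T : Finset ι) {m f : SF F P}
    (hm : m ∈ rootMonoid F P) (hf : ∏ i ∈ T, (xr F P i - xγ F P) ∣ m * f) :
    ∏ i ∈ T, (xr F P i - xγ F P) ∣ f := by
  refine FormalHecke.prod_dvd_of_dvd_mul T (fun i _ => h.isRegular_xr_sub_xγ i)
    (fun i _ f hf => ?_) hf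
  refine dvd_of_dvd_mul_of_mem_closure (fun x hx f hf => ?_) hm hf
  obtain ⟨j, rfl⟩ := hx
  exact h.xr_sub_xγ_dvd_of_dvd_mul hf

end Localization

end

end FormalHecke

open MvPowerSeries

namespace FormalHecke

noncomputable section

variable {R : Type*} [CommRing R]

/-! ### Products and leading terms in `Q_W` -/

section TwistedProducts

variable (F : FormalGroup R) {ι M N : Type*} [AddCommGroup M] [AddCommGroup N]
  {P : RootPairing ι ℤ M N}

theorem coeff_ofS_mul (s : SF F P) (z : QW F P) (w : P.weylGroup) :
    (ofS F s * z).coeff w = algebraMap (SF F P) (QF F P) s * z.coeff w :=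
  SkewMonoidAlgebra.coeff_single_one_mul _ _ _

theorem coeff_add_apply (y z : QW F P) (w : P.weylGroup) :
    (y + z).coeff w = y.coeff w + z.coeff w := by
  rw [SkewMonoidAlgebra.coeff_add, Finsupp.add_apply]

theorem coeff_sub_apply (y z : QW F P) (w : P.weylGroup) :
    (y - z).coeff w = y.coeff w - z.coeff w := by
  rw [SkewMonoidAlgebra.coeff_sub, Finsupp.sub_apply]

theorem coeff_single_sr_mul (i : ι) (c : QF F P) (z : QW F P) (w : P.weylGroup) :
    (SkewMonoidAlgebra.single (sr P i) c * z).coeff w = c * sr P i • z.coeff (sr P i * w) := by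
  rw [SkewMonoidAlgebra.coeff_single_mul, sr_inv]

theorem coeff_demX_mul (i : ι) (z : QW F P) (w : P.weylGroup) : (demX F P i * z).coeff w =
    invx F P i * (z.coeff w - sr P i • z.coeff (sr P i * w)) := by
  rw [demX, sub_mul, coeff_sub_apply, SkewMonoidAlgebra.coeff_single_one_mul, coeff_single_sr_mul,
    mul_sub]

theorem smul_xγ (w : P.weylGroup) : w • xγ F P = xγ F P := by
  refine (FGA.map_x F (weylAct w) (1, 0)).trans ?_
  have : weylAct w ((1, 0) : ℤ × M) = (1, 0) := Prod.ext rfl (smul_zero w)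
  rw [this]
  rfl

theorem demT_eq (i : ι) : demT F P i =
    SkewMonoidAlgebra.single 1 (algebraMap (SF F P) (QF F P) (xγ F P) * invx F P i) +
      SkewMonoidAlgebra.single (sr P i)
        (algebraMap (SF F P) (QF F P) (xr F P i - xγ F P) * invx F P i) := by
  have h : algebraMap (SF F P) (QF F P) (xr F P i - xγ F P) * invx F P i =
      -(algebraMap (SF F P) (QF F P) (xγ F P) * invx F P i) + 1 := by
    rw [map_sub, sub_mul, algebraMap_xr_mul_invx]
    ring
  rw [h, SkewMonoidAlgebra.single_add, SkewMonoidAlgebra.single_neg, demT, demX, ofS, mul_sub,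
    SkewMonoidAlgebra.single_mul_single, SkewMonoidAlgebra.single_mul_single]
  simp only [one_smul, one_mul]
  abel

theorem coeff_demT_mul (i : ι) (z : QW F P) (w : P.weylGroup) : (demT F P i * z).coeff w =
    invx F P i * (algebraMap (SF F P) (QF F P) (xγ F P) * z.coeff w +
      algebraMap (SF F P) (QF F P) (xr F P i - xγ F P) * sr P i • z.coeff (sr P i * w)) := by
  rw [demT_eq, add_mul, coeff_add_apply, SkewMonoidAlgebra.coeff_single_one_mul,
    coeff_single_sr_mul]
  ring

theorem mul_mem_of_mem_adjoin (V : AddSubgroup (QW F P)) {T : Set (QW F P)}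
    (hS : ∀ s, ∀ d ∈ V, ofS F s * d ∈ V) (hT : ∀ t ∈ T, ∀ d ∈ V, t * d ∈ V) {z : QW F P}
    (hz : z ∈ Algebra.adjoin R (Set.range (ofS F) ∪ T)) : ∀ d ∈ V, z * d ∈ V := by
  induction hz using Algebra.adjoin_induction with
  | mem x hx =>
    rcases hx with ⟨s, rfl⟩ | hx
    · exact hS s
    · exact hT x hx
  | algebraMap r =>
    intro d hd
    have : algebraMap R (QW F P) r = ofS F (algebraMap R (SF F P) r) := by
      rw [ofS, ← IsScalarTower.algebraMap_apply]
      rfl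
    rw [this]
    exact hS _ d hd
  | add x y _ _ hx hy =>
    intro d hd
    rw [add_mul]
    exact V.add_mem (hx d hd) (hy d hd)
  | mul x y _ _ hx hy =>
    intro d hd
    rw [mul_assoc]
    exact hx _ (hy d hd)

/-- Triangular elimination: if the leading coefficients of the elements of `V` are multiples of
those of elements of `A`, then `V` is contained in `A`. -/
theorem mem_of_leading_coeff (V : AddSubgroup (QW F P)) (A : Subalgebra R (QW F P))
    (hAV : ∀ z ∈ A, z ∈ V) (hS : ∀ s, ofS F s ∈ A) (ℓ : P.weylGroup → ℕ)
    (hy : ∀ w, ∃ y ∈ A, (∀ v, v ≠ w → y.coeff v ≠ 0 → ℓ v < ℓ w) ∧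
      ∀ z ∈ V, (∀ v, z.coeff v ≠ 0 → ℓ v ≤ ℓ w) →
        ∃ s, z.coeff w = algebraMap (SF F P) (QF F P) s * y.coeff w)
    {z : QW F P} (hz : z ∈ V) : z ∈ A := by
  choose y hyA hlt hlead using hy
  suffices key : ∀ n, ∀ z ∈ V, (∀ v, z.coeff v ≠ 0 → ℓ v < n) → z ∈ A by
    refine key (z.support.sup ℓ + 1) z hz fun v hv => Nat.lt_succ_of_le ?_
    exact Finset.le_sup (SkewMonoidAlgebra.mem_support_iff.2 hv)
  intro n
  induction n with
  | zero =>
    intro z _ h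
    have : z = 0 := SkewMonoidAlgebra.ext fun v => by
      by_contra hv
      exact absurd (h v (by simpa using hv)) (Nat.not_lt_zero _)
    rw [this]
    exact A.zero_mem
  | succ n ih =>
    intro z hz h
    have hs : ∀ w, ∃ s, ℓ w = n → z.coeff w = algebraMap (SF F P) (QF F P) s * (y w).coeff w := by
      intro w
      by_cases hw : ℓ w = n
      · obtain ⟨s, hs⟩ := hlead w z hz fun v hv => by rw [hw]; exact Nat.lt_succ_iff.1 (h v hv)
        exact ⟨s, fun _ => hs⟩
      · exact ⟨0, fun h => absurd h hw⟩
    choose s hs using hs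
    -- The top layer of the support. Apart from its leading term each `y w` lives in lower layers,
    -- so one combination removes the whole layer at once.
    set T := z.support.filter fun w => ℓ w = n
    set u := ∑ w ∈ T, ofS F (s w) * y w with hu
    have huA : u ∈ A := sum_mem fun w _ => A.mul_mem (hS _) (hyA w)
    have hcoeff : ∀ v, u.coeff v =
        ∑ w ∈ T, algebraMap (SF F P) (QF F P) (s w) * (y w).coeff v := by
      intro v
      let c : QW F P →+ QF F P :=
        { toFun := fun z => z.coeff v, map_zero' := rfl, map_add' := fun y z => coeff_add_apply F y z v }
      refine (map_sum c _ _).trans (Finset.sum_congr rfl fun w _ => ?_)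
      exact coeff_ofS_mul F (s w) (y w) v
    have hzu : z - u ∈ A := by
      refine ih _ (V.sub_mem hz (hAV u huA)) fun v hv => ?_
      by_contra! hle
      refine hv ?_
      have hne : ∀ w ∈ T, w ≠ v → (y w).coeff v = 0 := by
        intro w hw hwv
        by_contra hc
        have h1 := hlt w v hwv.symm hc
        rw [(Finset.mem_filter.1 hw).2] at h1
        omega
      rw [coeff_sub_apply, sub_eq_zero, hcoeff]
      by_cases hv' : v ∈ T
      · rw [Finset.sum_eq_single_of_mem v hv' fun w hw hwv => by rw [hne w hw hwv, mul_zero]]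
        exact hs v (Finset.mem_filter.1 hv').2
      · rw [Finset.sum_eq_zero fun w hw => by
          rw [hne w hw (fun hwv => hv' (hwv ▸ hw)), mul_zero]]
        by_contra hc
        refine hv' (Finset.mem_filter.2 ⟨SkewMonoidAlgebra.mem_support_iff.2 hc, ?_⟩)
        have := h v hc
        omega
    rw [← sub_add_cancel z u]
    exact A.add_mem hzu huA

/-! ### Leading coefficients along reduced words -/

section Inversions

variable (b : P.Base) [Fintype ι] [P.IsReduced]

theorem ctilde_eq (w : P.weylGroup) :
    ctilde F b w = ∏ i ∈ inversions b w, (xr F P i - xγ F P) := rfl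

theorem inversions_one : inversions b (1 : P.weylGroup) = ∅ := by
  refine Finset.eq_empty_of_forall_notMem fun i hi => ?_
  obtain ⟨h1, h2⟩ := (mem_inversions b).1 hi
  rw [inv_one, one_smul] at h2
  exact h2 h1

theorem prod_inversions_sr_mul {A : Type*} [CommRing A] [MulSemiringAction P.weylGroup A]
    {g : ι → A} (hg : ∀ (w : P.weylGroup) i, w • g i = g (w • i)) {w : P.weylGroup} {j : ι}
    (hj : j ∈ b.support) (hw : j ∉ inversions b w) :
    ∏ i ∈ inversions b (sr P j * w), g i = g j * sr P j • ∏ i ∈ inversions b w, g i := by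
  classical
  obtain ⟨h1, h2⟩ := inversions_sr_mul b hj hw
  rw [h2, Finset.prod_insert h1, Finset.prod_image (MulAction.injective (sr P j)).injOn,
    Finset.smul_prod']
  simp only [hg]

theorem ctilde_sr_mul {w : P.weylGroup} {j : ι} (hj : j ∈ b.support) (hw : j ∉ inversions b w) :
    ctilde F b (sr P j * w) = (xr F P j - xγ F P) * sr P j • ctilde F b w := by
  rw [ctilde_eq, ctilde_eq]
  exact prod_inversions_sr_mul b (g := fun i => xr F P i - xγ F P)
    (fun w i => by rw [smul_sub, smul_xr, smul_xγ]) hj hw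

/-- The element is the product of the `p_i + g_i δ_{s_i}` along a reduced word; its leading
coefficient obeys the same recursion as the product over `Σ(w)`. General `p` and `g` serve both
`-X_α` and `T_α`. -/
theorem exists_coeff_eq_prod (A : Subalgebra R (QW F P)) {p g : ι → QF F P}
    (hg : ∀ (w : P.weylGroup) i, w • g i = g (w • i))
    (ht : ∀ i ∈ b.support,
      SkewMonoidAlgebra.single 1 (p i) + SkewMonoidAlgebra.single (sr P i) (g i) ∈ A)
    (w : P.weylGroup) : ∃ y ∈ A, y.coeff w = ∏ i ∈ inversions b w, g i ∧
      ∀ v, v ≠ w → y.coeff v ≠ 0 → (inversions b v).card < (inversions b w).card := by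
  classical
  induction hn : (inversions b w).card generalizing w with
  | zero =>
    have hw := eq_one_of_inversions_eq_empty b (Finset.card_eq_zero.1 hn)
    subst hw
    refine ⟨1, A.one_mem, ?_, fun v hv h => absurd ?_ h⟩
    · rw [inversions_one, SkewMonoidAlgebra.coeff_one, Finsupp.single_eq_same, Finset.prod_empty]
    · rw [SkewMonoidAlgebra.coeff_one, Finsupp.single_eq_of_ne hv]
  | succ n ih =>
    have hw : w ≠ 1 := by
      rintro rfl
      rw [inversions_one, Finset.card_empty] at hn
      omega
    obtain ⟨j, hj, hjw⟩ := exists_mem_support_mem_inversions b hw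
    obtain ⟨w', rfl⟩ : ∃ w', w = sr P j * w' := ⟨sr P j * w, (sr_mul_sr_mul j w).symm⟩
    have hjw' : j ∉ inversions b w' := by
      have := not_mem_inversions_sr_mul b hjw
      rwa [sr_mul_sr_mul] at this
    have hcard := card_inversions_sr_mul b hj hjw'
    obtain ⟨y, hyA, hyw, hlt⟩ := ih w' (by omega)
    have hcoeff : ∀ v, ((SkewMonoidAlgebra.single 1 (p j) +
        SkewMonoidAlgebra.single (sr P j) (g j)) * y : QW F P).coeff v =
          p j * y.coeff v + g j * sr P j • y.coeff (sr P j * v) := by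
      intro v
      rw [add_mul, coeff_add_apply, SkewMonoidAlgebra.coeff_single_one_mul, coeff_single_sr_mul]
    refine ⟨_, A.mul_mem (ht j hj) hyA, ?_, fun v hv hne => ?_⟩
    · have h0 : y.coeff (sr P j * w') = 0 := by
        by_contra h
        have := hlt (sr P j * w') (fun h' => by rw [h'] at hcard; omega) h
        omega
      rw [hcoeff, h0, mul_zero, zero_add, sr_mul_sr_mul, hyw, prod_inversions_sr_mul b hg hj hjw']
    · rw [hcoeff] at hne
      by_cases h1 : y.coeff v = 0
      · have h2 : y.coeff (sr P j * v) ≠ 0 := by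
          intro h2
          rw [h1, h2, smul_zero, mul_zero, mul_zero, add_zero] at hne
          exact hne rfl
        have h3 := hlt (sr P j * v) (fun h => hv (by rw [← h, sr_mul_sr_mul])) h2
        have h4 := card_inversions_sr_mul_le b (w := sr P j * v) hj
        rw [sr_mul_sr_mul] at h4
        omega
      · by_cases hvw : v = w'
        · rw [hvw]
          omega
        · have := hlt v hvw h1
          omega

end Inversions

end TwistedProducts

/-! ### Stability of the residue conditions and the converse -/

section Residues

variable (F : FormalGroup R) {ι M N : Type*} [AddCommGroup M] [AddCommGroup N]
  (P : RootPairing ι ℤ M N)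

/-- The elements of `Q_W` satisfying R1 and R2, as an additive group. -/
def demazureResidues : AddSubgroup (QW F P) where
  carrier := DFres F P
  zero_mem' := ⟨fun i w => by simp,
    fun i w => by simp⟩
  add_mem' := by
    rintro y z ⟨h1, h2⟩ ⟨h1', h2'⟩
    refine ⟨fun i w => ?_, fun i w => ?_⟩
    · rw [coeff_add_apply, mul_add]
      exact add_mem (h1 i w) (h1' i w)
    · rw [coeff_add_apply, coeff_add_apply, add_add_add_comm]
      exact add_mem (h2 i w) (h2' i w)
  neg_mem' := by
    rintro z ⟨h1, h2⟩
    refine ⟨fun i w => ?_, fun i w => ?_⟩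
    · rw [SkewMonoidAlgebra.coeff_neg, Finsupp.neg_apply, mul_neg]
      exact neg_mem (h1 i w)
    · rw [SkewMonoidAlgebra.coeff_neg, Finsupp.neg_apply, Finsupp.neg_apply, ← neg_add]
      exact neg_mem (h2 i w)

variable {P}

theorem one_mem_demazureResidues : (1 : QW F P) ∈ demazureResidues F P := by
  classical
  have h : ∀ i (w : P.weylGroup), (1 : QW F P).coeff w ∈ Qα F P i := by
    intro i w
    rw [SkewMonoidAlgebra.coeff_one, Finsupp.single_apply]
    split_ifs
    · exact one_mem _
    · exact zero_mem _
  exact ⟨fun i w => mul_mem (algebraMap_mem_Qα F i _) (h i w), fun i w => add_mem (h i _) (h i _)⟩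

theorem ofS_mul_mem_demazureResidues (s : SF F P) {z : QW F P} (hz : z ∈ demazureResidues F P) :
    ofS F s * z ∈ demazureResidues F P := by
  obtain ⟨h1, h2⟩ := hz
  refine ⟨fun i w => ?_, fun i w => ?_⟩
  · rw [coeff_ofS_mul, mul_left_comm]
    exact mul_mem (algebraMap_mem_Qα F i s) (h1 i w)
  · rw [coeff_ofS_mul, coeff_ofS_mul, ← mul_add]
    exact mul_mem (algebraMap_mem_Qα F i s) (h2 i w)

variable [F.IsComm] [Module.Free ℤ M] [Module.Finite ℤ M]

/-- With `s = s_α` and `f = x_α a_w ∈ Q_α`, the element equals `(1/x_α + 1/x_{-α}) s(f) - (s(f) -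
f)/x_α - s(a_w + a_{sw})`, and each of the three terms lies in `Q_α`. -/
theorem sub_sr_smul_mem_Qα {z : QW F P} (hz : z ∈ demazureResidues F P) (j : ι)
    (w : P.weylGroup) : z.coeff w - sr P j • z.coeff (sr P j * w) ∈ Qα F P j := by
  obtain ⟨h1, h2⟩ := hz
  obtain ⟨g, hg⟩ := exists_invx_add_invx F (root_sr_smul_self (P := P) j)
  have hf := h1 j w
  obtain ⟨t, ht, hft⟩ := exists_sr_smul_sub_eq F hf
  have hs := sr_smul_mem_Qα F (h2 j w)
  have hx := algebraMap_xr_mul_invx F (P := P) j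
  have hx' := congrArg (sr P j • ·) hx
  simp only [smul_mul', smul_one, smul_invx] at hx'
  simp only [smul_add, smul_mul'] at hs hft
  have : z.coeff w - sr P j • z.coeff (sr P j * w) =
      algebraMap (SF F P) (QF F P) g * sr P j • (algebraMap (SF F P) (QF F P) (xr F P j) *
        z.coeff w) - t - (sr P j • z.coeff w + sr P j • z.coeff (sr P j * w)) := by
    rw [smul_mul']
    linear_combination (invx F P j) * (-hft) + (-t - z.coeff w) * hx - (sr P j • z.coeff w) * hx' +
      (sr P j • algebraMap (SF F P) (QF F P) (xr F P j) * sr P j • z.coeff w) * hg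
  rw [this]
  exact sub_mem (sub_mem (mul_mem (algebraMap_mem_Qα F j g) (sr_smul_mem_Qα F hf)) ht) hs

/-- Put `s = s_j` and `Y_w = a_w - s(a_{sw})`; the coefficients of the product are `Y_w / x_j`. At
`±α_j`, R1 is `Y_w ∈ Q_{α_j}`, and R2 follows from `Y_{sw} = -s(Y_w)`, as `s` is trivial modulo
`x_j`. At another root `α_i` the factor `1/x_j` lies in `Q_{α_i}`, and `s` carries the conditions at
`s(α_i)` to those at `α_i`. -/
theorem demX_mul_mem_demazureResidues (j : ι) {z : QW F P} (hz : z ∈ demazureResidues F P) :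
    demX F P j * z ∈ demazureResidues F P := by
  have hY := sub_sr_smul_mem_Qα F hz j
  have hYY : ∀ w, invx F P j * (z.coeff w - sr P j • z.coeff (sr P j * w)) +
      invx F P j * (z.coeff (sr P j * w) - sr P j • z.coeff (sr P j * (sr P j * w))) ∈
        Qα F P j := by
    intro w
    obtain ⟨t, ht, h⟩ := exists_sr_smul_sub_eq F (hY w)
    rw [smul_sub, ← mul_smul, sr_mul_self, one_smul] at h
    have hx := algebraMap_xr_mul_invx F (P := P) j
    rw [sr_mul_sr_mul]
    have : invx F P j * (z.coeff w - sr P j • z.coeff (sr P j * w)) +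
        invx F P j * (z.coeff (sr P j * w) - sr P j • z.coeff w) = -t := by
      linear_combination (-invx F P j) * h - t * hx
    rw [this]
    exact neg_mem ht
  obtain ⟨h1, h2⟩ := hz
  have hpm : ∀ i, (P.root i = P.root j ∨ P.root i = -P.root j) →
      Qα F P i = Qα F P j ∧ sr P i = sr P j ∧ xr F P j ∣ xr F P i := by
    rintro i (h | h)
    · obtain rfl := P.root.injective h
      exact ⟨rfl, rfl, dvd_rfl⟩
    · exact ⟨Qα_eq_of_eq_neg F h, sr_eq_of_root_eq_neg h, (associated_xr_of_eq_neg F h).symm.dvd⟩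
  have hne : ∀ i, ¬ (P.root i = P.root j ∨ P.root i = -P.root j) → invx F P j ∈ Qα F P i := by
    intro i h
    refine invx_mem_Qα F (fun h' => h (Or.inl h'.symm)) (fun h' => h (Or.inr ?_))
    rw [h', neg_neg]
  refine ⟨fun i w => ?_, fun i w => ?_⟩
  · rw [coeff_demX_mul]
    by_cases hij : P.root i = P.root j ∨ P.root i = -P.root j
    · obtain ⟨e1, -, u, hu⟩ := hpm i hij
      rw [e1, hu, map_mul]
      have hx := algebraMap_xr_mul_invx F (P := P) j
      have : algebraMap (SF F P) (QF F P) (xr F P j) * algebraMap (SF F P) (QF F P) u *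
          (invx F P j * (z.coeff w - sr P j • z.coeff (sr P j * w))) =
            algebraMap (SF F P) (QF F P) u * (z.coeff w - sr P j • z.coeff (sr P j * w)) := by
        linear_combination (algebraMap (SF F P) (QF F P) u *
          (z.coeff w - sr P j • z.coeff (sr P j * w))) * hx
      rw [this]
      exact mul_mem (algebraMap_mem_Qα F j u) (hY w)
    · have h3 := smul_mem_Qα F (sr P j) (h1 (sr P j • i) (sr P j * w))
      rw [sr_smul_sr_smul, smul_mul', smul_algebraMap_QF, smul_xr, sr_smul_sr_smul] at h3
      rw [mul_left_comm, mul_sub]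
      exact mul_mem (hne i hij) (sub_mem (h1 i w) h3)
  · rw [coeff_demX_mul, coeff_demX_mul]
    by_cases hij : P.root i = P.root j ∨ P.root i = -P.root j
    · obtain ⟨e1, e2, -⟩ := hpm i hij
      have e3 : RootPairing.weylGroup.ofIdx P i = sr P j := e2
      rw [e1, e3]
      exact hYY w
    · have h3 := smul_mem_Qα F (sr P j) (h2 (sr P j • i) (sr P j * w))
      have e : RootPairing.weylGroup.ofIdx P (sr P j • i) * (sr P j * w) =
          sr P j * (RootPairing.weylGroup.ofIdx P i * w) := by
        refine (congrArg (· * (sr P j * w)) (sr_reflectionPerm j i)).trans ?_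
        simp only [mul_assoc, sr_mul_sr_mul]
      rw [sr_smul_sr_smul, smul_add, e] at h3
      rw [← mul_add, sub_add_sub_comm]
      exact mul_mem (hne i hij) (sub_mem (h2 i w) h3)

variable (b : P.Base)

theorem mul_mem_demazureResidues {y z : QW F P} (hy : y ∈ DF F b)
    (hz : z ∈ demazureResidues F P) : y * z ∈ demazureResidues F P :=
  mul_mem_of_mem_adjoin F _ (fun s _ hd => ofS_mul_mem_demazureResidues F s hd)
    (by rintro _ ⟨i, -, rfl⟩ d hd; exact demX_mul_mem_demazureResidues F i hd) hy z hz

-- `δ_{s_α} = 1 - x_α X_α`.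
omit [F.IsComm] [Module.Free ℤ M] [Module.Finite ℤ M] in
theorem demT_mem_DF {i : ι} (hi : i ∈ b.support) : demT F P i ∈ DF F b := by
  have hS : ∀ s, ofS F s ∈ DF F b := fun s => Algebra.subset_adjoin (Or.inl ⟨s, rfl⟩)
  have hX : demX F P i ∈ DF F b := Algebra.subset_adjoin (Or.inr ⟨i, hi, rfl⟩)
  have : demT F P i = ofS F (xγ F P) * demX F P i + (1 - ofS F (xr F P i) * demX F P i) := by
    rw [demT, demX, ofS, ofS, mul_sub, mul_sub, SkewMonoidAlgebra.single_mul_single,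
      SkewMonoidAlgebra.single_mul_single, SkewMonoidAlgebra.single_mul_single,
      SkewMonoidAlgebra.single_mul_single, one_smul, one_mul, one_mul, algebraMap_xr_mul_invx,
      SkewMonoidAlgebra.one_def]
    abel
  rw [this]
  exact add_mem (mul_mem (hS _) hX) (sub_mem (one_mem _) (mul_mem (hS _) hX))

variable [Fintype ι]

/-- The elements of `Q_W` satisfying R1, R2 and R3, as an additive group. -/
def heckeResidues : AddSubgroup (QW F P) where
  carrier := HFres F b
  zero_mem' := ⟨(demazureResidues F P).zero_mem, fun w => ⟨0, by simp⟩⟩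
  add_mem' := by
    rintro y z ⟨h1, h2⟩ ⟨h1', h2'⟩
    refine ⟨(demazureResidues F P).add_mem h1 h1', fun w => ?_⟩
    obtain ⟨q, hq⟩ := h2 w
    obtain ⟨q', hq'⟩ := h2' w
    exact ⟨q + q', by rw [coeff_add_apply, hq, hq', mul_add]⟩
  neg_mem' := by
    rintro z ⟨h1, h2⟩
    refine ⟨(demazureResidues F P).neg_mem h1, fun w => ?_⟩
    obtain ⟨q, hq⟩ := h2 w
    exact ⟨-q, by rw [SkewMonoidAlgebra.coeff_neg, Finsupp.neg_apply, hq, mul_neg]⟩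

variable [P.IsReduced]

theorem one_mem_heckeResidues : (1 : QW F P) ∈ heckeResidues F b := by
  refine ⟨one_mem_demazureResidues F, fun w => ?_⟩
  by_cases hw : w = 1
  · subst hw
    refine ⟨1, ?_⟩
    rw [ctilde_eq, inversions_one, Finset.prod_empty, mul_one, SkewMonoidAlgebra.coeff_one,
      Finsupp.single_eq_same]
    exact (map_one _).symm
  · exact ⟨0, by rw [mul_zero, SkewMonoidAlgebra.coeff_one, Finsupp.single_eq_of_ne hw]⟩

/-- R3 at `w` involves `a_w` and `(x_j - x_γ) s_j(a_{s_j w})`. If `α_j ∈ Σ(w)`, the factor `x_j -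
x_γ` is exactly what `s_j(c̃_{s_j w})` lacks; otherwise `c̃_w` already divides `s_j(c̃_{s_j w})`. -/
theorem demT_mul_mem_heckeResidues {j : ι} (hj : j ∈ b.support) {z : QW F P}
    (hz : z ∈ heckeResidues F b) : demT F P j * z ∈ heckeResidues F b := by
  refine ⟨mul_mem_demazureResidues F b (demT_mem_DF F b hj) hz.1, fun w => ?_⟩
  obtain ⟨q, hq⟩ := hz.2 w
  obtain ⟨q', hq'⟩ := hz.2 (sr P j * w)
  rw [coeff_demT_mul, hq, hq', smul_mul', smul_algebraMap_QF]
  by_cases hw : j ∈ inversions b w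
  · have h := ctilde_sr_mul F b hj (not_mem_inversions_sr_mul b hw)
    rw [sr_mul_sr_mul] at h
    refine ⟨invx F P j * (algebraMap (SF F P) (QF F P) (xγ F P) * q + sr P j • q'), ?_⟩
    rw [h, map_mul]
    ring
  · refine ⟨invx F P j * (algebraMap (SF F P) (QF F P) (xγ F P) * q +
      algebraMap (SF F P) (QF F P) (xr F P j - xγ F P) *
        algebraMap (SF F P) (QF F P) (sr P j • (xr F P j - xγ F P)) * sr P j • q'), ?_⟩
    rw [ctilde_sr_mul F b hj hw, smul_mul', ← mul_smul, sr_mul_self, one_smul, map_mul]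
    ring

theorem mem_demazureResidues_of_mem_DF {z : QW F P} (hz : z ∈ DF F b) :
    z ∈ demazureResidues F P := by
  rw [← mul_one z]
  exact mul_mem_demazureResidues F b hz (one_mem_demazureResidues F)

theorem mem_heckeResidues_of_mem_HF {z : QW F P} (hz : z ∈ HF F b) : z ∈ heckeResidues F b := by
  rw [← mul_one z]
  refine mul_mem_of_mem_adjoin F (heckeResidues F b) (fun s d hd => ⟨?_, fun w => ?_⟩) ?_ hz 1
    (one_mem_heckeResidues F b)
  · exact ofS_mul_mem_demazureResidues F s hd.1
  · obtain ⟨q, hq⟩ := hd.2 w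
    exact ⟨algebraMap (SF F P) (QF F P) s * q, by rw [coeff_ofS_mul, hq, mul_left_comm]⟩
  · rintro _ ⟨i, hi, rfl⟩ d hd
    exact demT_mul_mem_heckeResidues F b hi hd

variable {F}

/-- After multiplication by `∏ x_α` over `Σ(w)` no pole is left at `α ∈ Σ(w)`, by R1. At another
positive `α` the coefficient at the longer element `s_α w` is zero, so R2 excludes a pole. The
intersection of the `Q_α` is `S`. -/
theorem RegularDatum.exists_coeff_eq (h : RegularDatum F P) {z : QW F P}
    (hz : z ∈ demazureResidues F P) {w : P.weylGroup}
    (hw : ∀ v, z.coeff v ≠ 0 → (inversions b v).card ≤ (inversions b w).card) :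
    ∃ s, z.coeff w = algebraMap (SF F P) (QF F P) s * ∏ i ∈ inversions b w, invx F P i := by
  classical
  obtain ⟨h1, h2⟩ := hz
  have hmem : ∀ i, (∏ j ∈ inversions b w, algebraMap (SF F P) (QF F P) (xr F P j)) *
      z.coeff w ∈ Qα F P i := by
    have key : ∀ i, IsPosRoot b i →
        (∏ j ∈ inversions b w, algebraMap (SF F P) (QF F P) (xr F P j)) *
          z.coeff w ∈ Qα F P i := by
      intro i hi
      by_cases hiw : i ∈ inversions b w
      · rw [← Finset.prod_erase_mul _ _ hiw, mul_assoc]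
        exact mul_mem (prod_mem fun j _ => algebraMap_mem_Qα F i _) (h1 i w)
      · have h0 : z.coeff (sr P i * w) = 0 := by
          by_contra hne
          have h3 := hw _ hne
          have h4 := card_inversions_lt b hi hiw
          omega
        have h3 := h2 i w
        rw [h0, add_zero] at h3
        exact mul_mem (prod_mem fun j _ => algebraMap_mem_Qα F i _) h3
    intro i
    by_cases hi : IsPosRoot b i
    · exact key i hi
    · have hr := root_sr_smul_self (P := P) i
      rw [← Qα_eq_of_eq_neg F hr]
      exact key _ ((isPosRoot_neg_iff b hr).2 hi)
  obtain ⟨s, hs⟩ := h.mem_range_algebraMap hmem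
  refine ⟨s, ?_⟩
  rw [← hs, mul_right_comm, ← Finset.prod_mul_distrib,
    Finset.prod_eq_one fun i _ => algebraMap_xr_mul_invx F i, one_mul]

theorem RegularDatum.DFres_eq (h : RegularDatum F P) : DFres F P = (DF F b : Set (QW F P)) := by
  have hsub : ∀ z ∈ DF F b, z ∈ demazureResidues F P :=
    fun z hz => mem_demazureResidues_of_mem_DF F b hz
  refine Set.Subset.antisymm (fun z hz => ?_) hsub
  refine mem_of_leading_coeff F (demazureResidues F P) (DF F b) hsub
    (fun s => Algebra.subset_adjoin (Or.inl ⟨s, rfl⟩)) (fun w => (inversions b w).card)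
    (fun w => ?_) hz
  obtain ⟨y, hy, hyw, hlt⟩ := exists_coeff_eq_prod F b (DF F b) (p := fun i => -invx F P i)
    (g := invx F P) (smul_invx F) (fun i hi => by
      have : demX F P i ∈ DF F b := Algebra.subset_adjoin (Or.inr ⟨i, hi, rfl⟩)
      convert neg_mem this using 1
      rw [demX, SkewMonoidAlgebra.single_neg]
      abel) w
  refine ⟨y, hy, hlt, fun z hz hw => ?_⟩
  rw [hyw]
  exact h.exists_coeff_eq b hz hw

theorem RegularDatum.HFres_eq (h : RegularDatum F P) : HFres F b = (HF F b : Set (QW F P)) := by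
  have hsub : ∀ z ∈ HF F b, z ∈ heckeResidues F b :=
    fun z hz => mem_heckeResidues_of_mem_HF F b hz
  refine Set.Subset.antisymm (fun z hz => ?_) hsub
  refine mem_of_leading_coeff F (heckeResidues F b) (HF F b) hsub
    (fun s => Algebra.subset_adjoin (Or.inl ⟨s, rfl⟩)) (fun w => (inversions b w).card)
    (fun w => ?_) hz
  obtain ⟨y, hy, hyw, hlt⟩ := exists_coeff_eq_prod F b (HF F b)
    (p := fun i => algebraMap (SF F P) (QF F P) (xγ F P) * invx F P i)
    (g := fun i => algebraMap (SF F P) (QF F P) (xr F P i - xγ F P) * invx F P i)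
    (fun w i => by
      rw [smul_mul', smul_invx, smul_algebraMap_QF, smul_sub, smul_xr, smul_xγ])
    (fun i hi => by
      rw [← demT_eq]
      exact Algebra.subset_adjoin (Or.inr ⟨i, hi, rfl⟩)) w
  refine ⟨y, hy, hlt, fun z hz hw => ?_⟩
  obtain ⟨s, hs⟩ := h.exists_coeff_eq b hz.1 hw
  obtain ⟨q, hq⟩ := hz.2 w
  obtain ⟨⟨t, m⟩, htm⟩ := IsLocalization.surj (rootMonoid F P) q
  have hinv : (∏ i ∈ inversions b w, invx F P i) *
      algebraMap (SF F P) (QF F P) (∏ i ∈ inversions b w, xr F P i) = 1 := by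
    rw [map_prod, ← Finset.prod_mul_distrib]
    exact Finset.prod_eq_one fun i _ => by rw [mul_comm, algebraMap_xr_mul_invx]
  -- R3 gives divisibility by `c̃_w` only up to a denominator `m`, a product of the `x_β`. All
  -- factors of `c̃_w` are prime to these, so `c̃_w` divides `s` itself.
  have hdvd : ctilde F b w ∣ m * s := by
    refine ⟨t * ∏ i ∈ inversions b w, xr F P i, h.algebraMap_injective ?_⟩
    rw [hs] at hq
    rw [map_mul, map_mul, map_mul, ← htm]
    simp only
    linear_combination (algebraMap (SF F P) (QF F P) m *
      algebraMap (SF F P) (QF F P) (∏ i ∈ inversions b w, xr F P i)) * hq -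
      (algebraMap (SF F P) (QF F P) m * algebraMap (SF F P) (QF F P) s) * hinv
  rw [ctilde_eq] at hdvd
  obtain ⟨s', rfl⟩ := h.prod_dvd_of_dvd_mul _ m.2 hdvd
  refine ⟨s', ?_⟩
  rw [hs, hyw, Finset.prod_mul_distrib, map_mul, map_prod]
  ring

end Residues

end

end FormalHecke

theorem mainTheorem5 {R : Type*} [CommRing R] (F : FormalGroup R) [F.IsComm]
    {ι M N : Type*} [Fintype ι] [AddCommGroup M] [Module.Free ℤ M] [Module.Finite ℤ M]
    [AddCommGroup N] (P : RootPairing ι ℤ M N) [P.IsReduced]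
    (hss : FormalHecke.IsSemisimpleDatum P) (b : P.Base)
    (hdiv : FormalHecke.DivAssumption F b) :
    FormalHecke.DFres F P = (FormalHecke.DF F b : Set (FormalHecke.QW F P)) ∧
      FormalHecke.HFres F b = (FormalHecke.HF F b : Set (FormalHecke.QW F P)) := by
  have h := FormalHecke.DivAssumption.regularDatum F hss hdiv
  exact ⟨h.DFres_eq b, h.HFres_eq b⟩
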